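/- Let $G$ be a compact Lie group with Lie algebra $\mathfrak g$ and an $\mathrm{Ad}$-invariant inner product, and let $(e_a)$ be an orthonormal basis of $\mathfrak g$, $f_{abc}=e_a\cdot[e_b,e_c]$, $\phi=\frac1{12}\sum f_{abc}\,e_a\wedge e_b\wedge e_c$. Let $M$ be a (Hausdorff, second countable, finite-dimensional) smooth manifold with a smooth $G$-action, with generating vector fields $\xi_M(m)=\frac{d}{dt}\big|_{t=0}\exp(-t\xi)\cdot m$, extended to $\wedge^\bullet\mathfrak g$. Let $(M,P,\Phi)$ be a Hamiltonian quasi-Poisson manifold: $P$ is a $G$-invariant smooth bivector field on $M$ with Schouten bracket $[P,P]=\phi_M$, and $\Phi:M\to G$ is a smooth map with $\Phi(g\cdot m)=g\Phi(m)g^{-1}$ and $$P^\sharp(d(\Phi^*f))=\tfrac12\sum_a\Phi^*\big((e_a^L+e_a^R)f\big)\,(e_a)_M\qquad\text{for all } f\in C^\infty(G,\mathbb R),$$ where $e_a^L,e_a^R$ are the left- and right-invariant vector fields generated by $e_a$, and $P^\sharp(\alpha)(\beta)=P(\alpha,\beta)$. Let $M_*$ (resp. $M_{**}$) be the set of points of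 $M$ with trivial (resp. finite) stabilizer. Then: 1. $\Phi$ has maximal rank on $M_{**}$: $d_m\Phi:T_mM\to T_{\Phi(m)}G$ is surjective for all $m\in M_{**}$. 2. $M_*$ is open in $M$, and $M_*/G\subseteq M/G$ is a Hausdorff second countable space with a structure of smooth manifold of dimension $\dim M-\dim G$ for which $\pi:M_*\to M_*/G$ is a smooth submersion. There is a unique bivector field $Q$ on $M_*/G$ to which $P|_{M_*}$ projects under $\pi$; it is a Poisson structure. For every conjugacy class $\mathcal C\subset G$, the intersection of $M_{\mathcal C}=\Phi^{-1}(\mathcal C)/G$ with $M_*/G$ is a Poisson submanifold of $(M_*/G,Q)$, i.e. an embedded submanifold $S$ such that $Q^\sharp(\alpha)\in T_yS$ for all $y\in S$ and all covectors $\alpha$ at $y$. 3. $M_{**}$ is open in $M$, and $M_{**}/G\subseteq M/G$ is a Hausdorff second countable space with a structure of orbifold of dimension $\dim M-\dim G$ for which $\pi:M_{**}\to M_{**}/G$ is a smooth submersion of orbifolds (it lifts locally, through any point above $\pi(m)$, to submersions into the domains of the orbifold charts). There is a unique bivector field on this orbifold (bivector fields on the domains of the charts, preserved by all local changes of charts)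 to which $P|_{M_{**}}$ projects under all these local lifts; it is a Poisson structure. For every conjugacy class $\mathcal C\subset G$, the intersection of $M_{\mathcal C}$ with $M_{**}/G$ is a Poisson suborbifold, i.e. its preimages in all orbifold charts are Poisson submanifolds, of one and the same dimension. -/

import Mathlib

open scoped Manifold ContDiff
open Module TopologicalSpace

noncomputable section

namespace QuasiPoisson

/-! ### Bivector fields -/

section Bivector

variable {E : Type*} [NormedAddCommGroup E] [NormedSpace ℝ E]

/-- The cotangent space of a manifold modelled on the normed space `E`. -/
abbrev Cotangent (E : Type*) [NormedAddCommGroup E] [NormedSpace ℝ E]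
    {M : Type*} [TopologicalSpace M] [ChartedSpace E M] (m : M) : Type _ :=
  TangentSpace 𝓘(ℝ, E) m →L[ℝ] ℝ

/-- A smooth bivector field `P`, as a family of alternating bilinear forms `(α, β) ↦ P(α, β)` on
the cotangent spaces. Smoothness: `P(df, dg)` is smooth for all smooth functions `f`, `g`. -/
structure BivectorField (E : Type*) [NormedAddCommGroup E] [NormedSpace ℝ E]
    (M : Type*) [TopologicalSpace M] [ChartedSpace E M] where
  form : ∀ m : M, LinearMap.BilinForm ℝ (Cotangent E m)
  alternating : ∀ (m : M) (α : Cotangent E m), form m α α = 0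
  smooth : ∀ f g : M → ℝ, ContMDiff 𝓘(ℝ, E) 𝓘(ℝ, ℝ) ∞ f → ContMDiff 𝓘(ℝ, E) 𝓘(ℝ, ℝ) ∞ g →
    ContMDiff 𝓘(ℝ, E) 𝓘(ℝ, ℝ) ∞
      (fun m => form m (mvfderiv 𝓘(ℝ, E) f m) (mvfderiv 𝓘(ℝ, E) g m))

variable {M : Type*} [TopologicalSpace M] [ChartedSpace E M]

/-- The bracket `{f, g} = P(df, dg)`. -/
def BivectorField.bracket (P : BivectorField E M) (f g : M → ℝ) (m : M) : ℝ :=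
  P.form m (mvfderiv 𝓘(ℝ, E) f m) (mvfderiv 𝓘(ℝ, E) g m)

/-- The tangent vector `v` equals `P^♯(α)`, that is, `β(v) = P(α, β)` for all covectors `β`. -/
def BivectorField.IsSharp (P : BivectorField E M) (m : M) (α : Cotangent E m)
    (v : TangentSpace 𝓘(ℝ, E) m) : Prop :=
  ∀ β : Cotangent E m, β v = P.form m α β

/-- The jacobiator `{{f, g}, h} + {{g, h}, f} + {{h, f}, g}`. -/
def BivectorField.jacobiator (P : BivectorField E M) (f g h : M → ℝ) (m : M) : ℝ :=
  P.bracket (P.bracket f g) h m + P.bracket (P.bracket g h) f m + P.bracket (P.bracket h f) g m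

/-- The value `[P, P](df, dg, dh)` of the Schouten bracket of a bivector field with itself.
The bracket is normalised by
`[X₁ ∧ X₂, Y₁ ∧ Y₂] = ∑ (-1)^(i+j) [Xᵢ, Yⱼ] ∧ Xᵢ' ∧ Yⱼ'` (with `i'`, `j'` the complementary
indices), and multivectors are paired with covectors by determinants. -/
def BivectorField.schouten (P : BivectorField E M) (f g h : M → ℝ) (m : M) : ℝ :=
  -2 * P.jacobiator f g h m

/-- `P` is a Poisson structure: its bracket satisfies the Jacobi identity. -/
def BivectorField.IsPoisson (P : BivectorField E M) : Prop :=
  ∀ f g h : M → ℝ, ContMDiff 𝓘(ℝ, E) 𝓘(ℝ, ℝ) ∞ f → ContMDiff 𝓘(ℝ, E) 𝓘(ℝ, ℝ) ∞ g →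
    ContMDiff 𝓘(ℝ, E) 𝓘(ℝ, ℝ) ∞ h → ∀ m : M, P.jacobiator f g h m = 0

variable {E₂ : Type*} [NormedAddCommGroup E₂] [NormedSpace ℝ E₂]
  {X : Type*} [TopologicalSpace X] [ChartedSpace E₂ X]

/-- For a local diffeomorphism `i : U → M` (below: the inclusion of an open subset), the restriction
`i^* P` of `P` to `U` is mapped to the bivector field `Q` on `X` by `p : U → X`. Here the covector
`α` at `i u` is the one that corresponds under `i` to the pullback of the covector `α'` under `p`. -/
def IsBivectorRelated (E₁ : Type*) [NormedAddCommGroup E₁] [NormedSpace ℝ E₁]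
    {U : Type*} [TopologicalSpace U] [ChartedSpace E₁ U] (P : BivectorField E M) (i : U → M) (p : U → X) (Q : BivectorField E₂ X) :
    Prop :=
  ∀ (u : U) (α β : Cotangent E (i u)) (α' β' : Cotangent E₂ (p u)),
    α.comp (mfderiv 𝓘(ℝ, E₁) 𝓘(ℝ, E) i u) = α'.comp (mfderiv 𝓘(ℝ, E₁) 𝓘(ℝ, E₂) p u) →
    β.comp (mfderiv 𝓘(ℝ, E₁) 𝓘(ℝ, E) i u) = β'.comp (mfderiv 𝓘(ℝ, E₁) 𝓘(ℝ, E₂) p u) →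
    P.form (i u) α β = Q.form (p u) α' β'

/-- A smooth submersion (between finite-dimensional manifolds without boundary). -/
def IsSmoothSubmersion (E₁ E₂ : Type*) [NormedAddCommGroup E₁] [NormedSpace ℝ E₁]
    [NormedAddCommGroup E₂] [NormedSpace ℝ E₂] {U : Type*} [TopologicalSpace U]
    [ChartedSpace E₁ U] {X : Type*} [TopologicalSpace X] [ChartedSpace E₂ X] (p : U → X) : Prop :=
  ContMDiff 𝓘(ℝ, E₁) 𝓘(ℝ, E₂) ∞ p ∧
    ∀ u : U, Function.Surjective (mfderiv 𝓘(ℝ, E₁) 𝓘(ℝ, E₂) p u)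

/-! ### Submanifolds and Poisson submanifolds -/

/-- `e` is a chart of the smooth manifold `M` in which `S` is the linear subspace `V`. -/
def IsSliceChart (S : Set M) (e : OpenPartialHomeomorph M E) (V : Submodule ℝ E) : Prop :=
  e ∈ IsManifold.maximalAtlas 𝓘(ℝ, E) ∞ M ∧ ∀ y ∈ e.source, (y ∈ S ↔ e y ∈ V)

/-- `S` is an embedded smooth submanifold of dimension `k`. -/
def IsSubmanifold (E : Type*) [NormedAddCommGroup E] [NormedSpace ℝ E]
    {M : Type*} [TopologicalSpace M] [ChartedSpace E M] (k : ℕ) (S : Set M) : Prop :=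
  ∀ x ∈ S, ∃ (e : OpenPartialHomeomorph M E) (V : Submodule ℝ E),
    x ∈ e.source ∧ IsSliceChart S e V ∧ finrank ℝ V = k

/-- The bivector field `Q` is tangent to `S`: at every `y ∈ S` all the vectors `Q^♯(α)` lie in
the tangent space `T_y S`, which is `(d_y e)⁻¹(V)` in a slice chart. -/
def BivectorField.IsTangentTo (Q : BivectorField E M) (S : Set M) : Prop :=
  ∀ (e : OpenPartialHomeomorph M E) (V : Submodule ℝ E), IsSliceChart S e V →
    ∀ y ∈ S, y ∈ e.source → ∀ α : Cotangent E y, ∃ v : TangentSpace 𝓘(ℝ, E) y,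
      Q.IsSharp y α v ∧ (mfderiv 𝓘(ℝ, E) 𝓘(ℝ, E) e y v : E) ∈ V

/-- `S` is a (`k`-dimensional, embedded) Poisson submanifold of `(M, Q)`. -/
def IsPoissonSubmanifold (Q : BivectorField E M) (k : ℕ) (S : Set M) : Prop :=
  IsSubmanifold E k S ∧ Q.IsTangentTo S

end Bivector

/-! ### Orbifolds -/

section Orbifold

/-- An orbifold chart on a space `X`: a connected open subset `dom` of the normed space `E`, a
finite group acting effectively and smoothly on it, and an invariant continuous open map
`dom → X` that induces a homeomorphism of the quotient `dom / Γ` onto an open subset of `X`. -/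
structure OrbifoldChart (E : Type*) [NormedAddCommGroup E] [NormedSpace ℝ E]
    (X : Type*) [TopologicalSpace X] where
  dom : Opens E
  isConnected_dom : IsConnected (dom : Set E)
  Γ : Type
  [group : Group Γ]
  [finite : Finite Γ]
  [action : MulAction Γ dom]
  [faithful : FaithfulSMul Γ dom]
  smooth_action : ∀ γ : Γ, ContMDiff 𝓘(ℝ, E) 𝓘(ℝ, E) ∞ (fun u : dom => γ • u)
  toFun : dom → X
  continuous_toFun : Continuous toFun
  isOpenMap_toFun : IsOpenMap toFun
  toFun_eq_iff : ∀ u v : dom, toFun u = toFun v ↔ ∃ γ : Γ, γ • u = v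

variable {E : Type*} [NormedAddCommGroup E] [NormedSpace ℝ E]
  {X : Type*} [TopologicalSpace X]

/-- A diffeomorphism between open subsets of the domains of two charts, over the identity
of `X`: a local change of charts. -/
def OrbifoldChart.IsChange (c c' : OrbifoldChart E X)
    (h : PartialDiffeomorph 𝓘(ℝ, E) 𝓘(ℝ, E) c.dom c'.dom ∞) : Prop :=
  ∀ u ∈ h.source, c'.toFun (h u) = c.toFun u

/-- An orbifold atlas on `X` (of dimension `dim E`): a covering by pairwise compatible orbifold
charts. -/
structure OrbifoldAtlas (E : Type*) [NormedAddCommGroup E] [NormedSpace ℝ E]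
    (X : Type*) [TopologicalSpace X] where
  charts : Set (OrbifoldChart E X)
  covers : ∀ x : X, ∃ c ∈ charts, x ∈ Set.range c.toFun
  compatible : ∀ c ∈ charts, ∀ c' ∈ charts, ∀ (u : c.dom) (u' : c'.dom),
    c.toFun u = c'.toFun u' →
    ∃ h : PartialDiffeomorph 𝓘(ℝ, E) 𝓘(ℝ, E) c.dom c'.dom ∞,
      u ∈ h.source ∧ h u = u' ∧ c.IsChange c' h

/-- A bivector field on an orbifold: a bivector field on the domain of each chart, preserved by all
local changes of charts (in particular by the group of each chart). -/
structure OrbifoldBivectorField (𝒜 : OrbifoldAtlas E X) where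
  field : ∀ c : 𝒜.charts, BivectorField E c.1.dom
  invariant : ∀ (c c' : 𝒜.charts) (h : PartialDiffeomorph 𝓘(ℝ, E) 𝓘(ℝ, E) c.1.dom c'.1.dom ∞),
    c.1.IsChange c'.1 h → ∀ u ∈ h.source, ∀ α β : Cotangent E (h u),
      (field c).form u (α.comp (mfderiv 𝓘(ℝ, E) 𝓘(ℝ, E) h u))
          (β.comp (mfderiv 𝓘(ℝ, E) 𝓘(ℝ, E) h u)) =
        (field c').form (h u) α β

/-- A Poisson structure on an orbifold. -/
def OrbifoldBivectorField.IsPoisson {𝒜 : OrbifoldAtlas E X} (Q : OrbifoldBivectorField 𝒜) :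
    Prop :=
  ∀ c : 𝒜.charts, (Q.field c).IsPoisson

/-- `S ⊆ X` is a (`k`-dimensional, embedded) Poisson suborbifold of a Poisson orbifold: its
preimage in every chart is a `k`-dimensional Poisson submanifold. -/
def IsPoissonSuborbifold {𝒜 : OrbifoldAtlas E X} (Q : OrbifoldBivectorField 𝒜) (k : ℕ)
    (S : Set X) : Prop :=
  ∀ c : 𝒜.charts, IsPoissonSubmanifold (Q.field c) k (c.1.toFun ⁻¹' S)

/-- `q` is a lift of `p : N → X` on the open set `W` to the domain of an orbifold chart, and a
submersion. -/
def OrbifoldChart.IsSubmersiveLift (E₁ : Type*) [NormedAddCommGroup E₁] [NormedSpace ℝ E₁]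
    {N : Type*} [TopologicalSpace N] [ChartedSpace E₁ N] (c : OrbifoldChart E X) (p : N → X)
    (W : Opens N) (q : W → c.dom) : Prop :=
  IsSmoothSubmersion E₁ E q ∧ ∀ w : W, c.toFun (q w) = p w

/-- The map `p` from a manifold `N` to an orbifold `X` is a smooth submersion of orbifolds: it lifts
locally, through any point above `p n`, to submersions into the domains of charts. -/
def IsOrbifoldSubmersion (E₁ : Type*) [NormedAddCommGroup E₁] [NormedSpace ℝ E₁]
    {N : Type*} [TopologicalSpace N] [ChartedSpace E₁ N] (𝒜 : OrbifoldAtlas E X) (p : N → X) :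
    Prop :=
  ∀ c ∈ 𝒜.charts, ∀ (n : N) (u : c.dom), c.toFun u = p n →
    ∃ (W : Opens N) (hn : n ∈ W) (q : W → c.dom), c.IsSubmersiveLift E₁ p W q ∧ q ⟨n, hn⟩ = u

/-- The restriction `i^* P` of `P` to `N` (with `i` the inclusion of an open subset of `M`) is mapped
to the bivector field `Q` on the orbifold `X` by the orbifold submersion `p : N → X`, that is, by
all its local lifts to charts. -/
def IsOrbifoldBivectorRelated (E₁ : Type*) [NormedAddCommGroup E₁] [NormedSpace ℝ E₁]
    {N : Type*} [TopologicalSpace N] [ChartedSpace E₁ N]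
    {E₀ : Type*} [NormedAddCommGroup E₀] [NormedSpace ℝ E₀]
    {M : Type*} [TopologicalSpace M] [ChartedSpace E₀ M] {𝒜 : OrbifoldAtlas E X}
    (P : BivectorField E₀ M) (i : N → M) (p : N → X) (Q : OrbifoldBivectorField 𝒜) : Prop :=
  ∀ (c : 𝒜.charts) (W : Opens N) (q : W → c.1.dom), c.1.IsSubmersiveLift E₁ p W q →
    IsBivectorRelated E₁ P (fun w : W => i w.1) q (Q.field c)

end Orbifold

/-! ### Hamiltonian quasi-Poisson manifolds -/

section Group

variable {F : Type*} [NormedAddCommGroup F] [NormedSpace ℝ F]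
  {G : Type*} [TopologicalSpace G] [ChartedSpace F G] [Group G]

/-- The adjoint action: `Ad_g` is the derivative of `x ↦ g x g⁻¹` at the identity. -/
def Ad (g : G) (ξ : GroupLieAlgebra 𝓘(ℝ, F) G) : GroupLieAlgebra 𝓘(ℝ, F) G :=
  mfderiv 𝓘(ℝ, F) 𝓘(ℝ, F) (fun x : G => g * x * g⁻¹) 1 ξ

/-- The right-invariant vector field `ξ^R`. (The left-invariant one, `ξ^L`, is
`mulInvariantVectorField ξ`.) -/
def rightInvariantField (ξ : GroupLieAlgebra 𝓘(ℝ, F) G) (g : G) : TangentSpace 𝓘(ℝ, F) g :=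
  mfderiv 𝓘(ℝ, F) 𝓘(ℝ, F) (fun x : G => x * g) 1 ξ

/-- An `Ad`-invariant inner product on the Lie algebra of `G`. -/
structure InvariantInnerProduct (F : Type*) [NormedAddCommGroup F] [NormedSpace ℝ F]
    (G : Type*) [TopologicalSpace G] [ChartedSpace F G] [Group G] where
  form : LinearMap.BilinForm ℝ (GroupLieAlgebra 𝓘(ℝ, F) G)
  symm : ∀ ξ η, form ξ η = form η ξ
  pos : ∀ ξ, ξ ≠ 0 → 0 < form ξ ξ
  invariant : ∀ (g : G) (ξ η), form (Ad g ξ) (Ad g η) = form ξ η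

/-- Bases of the Lie algebra of `G`. -/
abbrev LieBasis (F : Type*) [NormedAddCommGroup F] [NormedSpace ℝ F]
    (G : Type*) [TopologicalSpace G] [ChartedSpace F G] [Group G] : Type _ :=
  Basis (Fin (finrank ℝ F)) ℝ (GroupLieAlgebra 𝓘(ℝ, F) G)

/-- The basis `e` is orthonormal. -/
def InvariantInnerProduct.IsOrthonormal (κ : InvariantInnerProduct F G) (e : LieBasis F G) : Prop :=
  ∀ a b, κ.form (e a) (e b) = if a = b then 1 else 0

/-- The structure constants `f_abc = e_a · [e_b, e_c]`. -/
def InvariantInnerProduct.structureConstant (κ : InvariantInnerProduct F G) (e : LieBasis F G)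
    (a b c : Fin (finrank ℝ F)) : ℝ :=
  κ.form (e a) ⁅e b, e c⁆

/-- The operator `𝒟f = ½ ∑ₐ ((eₐ^L + eₐ^R) f) eₐ`, with values in the Lie algebra. -/
def diffOp (e : LieBasis F G) (f : G → ℝ) (g : G) : GroupLieAlgebra 𝓘(ℝ, F) G :=
  ∑ a, ((1 / 2 : ℝ) * mvfderiv 𝓘(ℝ, F) f g
    (mulInvariantVectorField (e a) g + rightInvariantField (e a) g)) • e a

variable {E : Type*} [NormedAddCommGroup E] [NormedSpace ℝ E]
  {M : Type*} [TopologicalSpace M] [ChartedSpace E M] [MulAction G M]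

/-- The generating vector field `ξ_M(m) = d/dt|₀ exp(-tξ) • m`, that is, minus the derivative of
the orbit map `g ↦ g • m` at the identity applied to `ξ`. -/
def generatingField (ξ : GroupLieAlgebra 𝓘(ℝ, F) G) (m : M) : TangentSpace 𝓘(ℝ, E) m :=
  -(mfderiv 𝓘(ℝ, F) 𝓘(ℝ, E) (fun g : G => g • m) 1 ξ)

/-- The derivative `(e_a)_M f` of the function `f` on `M`. -/
def generatingDeriv (e : LieBasis F G) (a : Fin (finrank ℝ F)) (f : M → ℝ) (m : M) : ℝ :=
  mvfderiv 𝓘(ℝ, E) f m (generatingField (E := E) (e a) m)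

/-- The value `φ_M(df, dg, dh)` at `m` of the trivector field generated by the Cartan 3-tensor
`φ = (1/12) f_abc e_a ∧ e_b ∧ e_c`, where trivectors are paired with covectors by determinants. -/
def cartanTrivector (E : Type*) [NormedAddCommGroup E] [NormedSpace ℝ E] {M : Type*}
    [TopologicalSpace M] [ChartedSpace E M] [MulAction G M]
    (κ : InvariantInnerProduct F G) (e : LieBasis F G) (f g h : M → ℝ) (m : M) : ℝ :=
  (1 / 12 : ℝ) * ∑ a, ∑ b, ∑ c, κ.structureConstant e a b c *
    Matrix.det !![generatingDeriv (E := E) e a f m, generatingDeriv (E := E) e a g m,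
        generatingDeriv (E := E) e a h m;
      generatingDeriv (E := E) e b f m, generatingDeriv (E := E) e b g m,
        generatingDeriv (E := E) e b h m;
      generatingDeriv (E := E) e c f m, generatingDeriv (E := E) e c g m,
        generatingDeriv (E := E) e c h m]

/-- `(M, P, Φ)` is a Hamiltonian quasi-Poisson `G`-manifold (for the inner product `κ`): `P` is
`G`-invariant, `[P, P] = φ_M`, and `Φ` is a smooth `Ad`-equivariant map with
`P^♯(d(Φ^* f)) = (Φ^*(𝒟f))_M` for all smooth functions `f` on `G`. -/
structure IsHamiltonianQuasiPoisson (κ : InvariantInnerProduct F G) (P : BivectorField E M)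
    (Φ : M → G) : Prop where
  invariant : ∀ (g : G) (m : M) (α β : Cotangent E (g • m)),
    P.form m (α.comp (mfderiv 𝓘(ℝ, E) 𝓘(ℝ, E) (fun x : M => g • x) m))
        (β.comp (mfderiv 𝓘(ℝ, E) 𝓘(ℝ, E) (fun x : M => g • x) m)) =
      P.form (g • m) α β
  schouten_eq : ∀ e : LieBasis F G, κ.IsOrthonormal e → ∀ f g h : M → ℝ,
    ContMDiff 𝓘(ℝ, E) 𝓘(ℝ, ℝ) ∞ f → ContMDiff 𝓘(ℝ, E) 𝓘(ℝ, ℝ) ∞ g →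
    ContMDiff 𝓘(ℝ, E) 𝓘(ℝ, ℝ) ∞ h →
    ∀ m : M, P.schouten f g h m = cartanTrivector E κ e f g h m
  smooth_moment : ContMDiff 𝓘(ℝ, E) 𝓘(ℝ, F) ∞ Φ
  equivariant : ∀ (g : G) (m : M), Φ (g • m) = g * Φ m * g⁻¹
  moment : ∀ e : LieBasis F G, κ.IsOrthonormal e → ∀ f : G → ℝ,
    ContMDiff 𝓘(ℝ, F) 𝓘(ℝ, ℝ) ∞ f → ∀ m : M,
    P.IsSharp m (mvfderiv 𝓘(ℝ, E) (f ∘ Φ) m) (generatingField (diffOp e f (Φ m)) m)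

end Group

/-! ### Orbit spaces -/

section Orbits

variable (G : Type*) [Group G] {M : Type*} [MulAction G M]

/-- The set `M_*` of points with trivial stabilizer. -/
def freeLocus (M : Type*) [MulAction G M] : Set M := {m | MulAction.stabilizer G m = ⊥}

/-- The set `M_**` of points with finite stabilizer, where the action is locally free. -/
def locallyFreeLocus (M : Type*) [MulAction G M] : Set M :=
  {m | Finite (MulAction.stabilizer G m)}

/-- The orbit space `M / G` (with the quotient topology). -/
abbrev OrbitSpace (M : Type*) [MulAction G M] : Type _ := Quotient (MulAction.orbitRel G M)

/-- The image `S / G` in `M / G` of a (`G`-invariant) subset `S` of `M`. As a type, it has the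
subspace topology. -/
def orbitImage (S : Set M) : Set (OrbitSpace G M) := Quotient.mk (MulAction.orbitRel G M) '' S

/-- The projection `U → U / G` for an open subset `U` of `M`. -/
def orbitMap [TopologicalSpace M] (U : Opens M) (m : U) : orbitImage G (U : Set M) :=
  ⟨Quotient.mk (MulAction.orbitRel G M) m.1, Set.mem_image_of_mem _ m.2⟩

variable {G} in
/-- The reduced space `M_C = Φ⁻¹(C) / G`, a subset of `M / G`. -/
def reducedSpace (Φ : M → G) (C : ConjClasses G) : Set (OrbitSpace G M) :=
  orbitImage G (Φ ⁻¹' C.carrier)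

end Orbits

end QuasiPoisson

end

/-! Two facts hold at a point `m` with finite stabilizer. First, the infinitesimal action is
injective: if the generating field of `ξ` vanishes at `m`, the integral curve through 1 of the
left-invariant field of `ξ` stays in the stabilizer, which is discrete, so `ξ = 0`
(`orb_injective`). Second, `Φ` is a submersion: if a covector `θ` kills the image of `dΦ` and `df =
θ` at `Φ m`, then `d(Φ^*f) = 0`, so the moment condition makes the generating field of `𝒟f` vanish
at `m`. Hence `𝒟f = 0`, that is, `θ(ξ^L + ξ^R) = 0` for all `ξ`. Equivariance gives `θ(ξ^R - ξ^L) =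
0`, so `θ = 0` (`IsHamiltonianQuasiPoisson.tmap_moment_surjective`).

The local structure of the quotient comes from slices (`exists_slice`): transversals to the orbits
on which the finite stabilizer acts linearly, and which an orbit meets in a single orbit of that
finite group. They give orbifold charts, and ordinary charts where the stabilizer is trivial. The
working tool is a lift: a smooth map `q` from an open part of `M` to the parameters of a slice, over
the orbit space. Two lifts differ at each point by an element of the finite group, which might vary
with the point. Since a real vector space is not a finite union of proper subspaces, a single
element relates them to first order (`exists_eq_tmap_of_finite`). Together with the invariance of
`P`, this shows that all lifts push `P` to the same bivector on the slice
(`Slice.IsLiftAt.form_eq`). Compatibility with changes of charts and with all lifts of the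
projection follows, and uniqueness holds because lifts are submersions through every point of a
chart.

Brackets of functions pulled back from the quotient are again pulled back, and the differentials of
such functions kill the orbit directions. The trivector `φ_M` is built from orbit directions, so the
Jacobi identity holds downstairs. A conjugacy class is locally the zero set of a submersion `c`, by
the constant rank theorem and the compactness of `G` (`exists_conj_equations`); since `Φ` is a
submersion, the reduced space is locally the zero set of the submersion induced by `c ∘ Φ`. The
fields `P^♯(d(Φ^*f))` are tangent to the orbits, so `P(q^*α, d(Φ^*f)) = 0`. This says that
`P^♯(q^*α)` is tangent to the level sets of `Φ`, hence that the reduced bivector is tangent to the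
reduced space. The structure `IsReductionAt` isolates what these arguments use, and serves both
quotients. -/

noncomputable section

namespace QuasiPoisson

set_option linter.unusedSectionVars false

open Filter Topology

/-! ### Smooth germs and their derivatives, with every tangent space read as the model space -/

section Calculus

variable {E E₁ E₂ E₃ : Type*} [NormedAddCommGroup E] [NormedSpace ℝ E]
  [NormedAddCommGroup E₁] [NormedSpace ℝ E₁] [NormedAddCommGroup E₂] [NormedSpace ℝ E₂]
  [NormedAddCommGroup E₃] [NormedSpace ℝ E₃]
  {M M₁ M₂ M₃ : Type*} [TopologicalSpace M] [ChartedSpace E M]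
  [TopologicalSpace M₁] [ChartedSpace E₁ M₁] [TopologicalSpace M₂] [ChartedSpace E₂ M₂]
  [TopologicalSpace M₃] [ChartedSpace E₃ M₃]

/-- The derivative of a map between manifolds, as a map between the model spaces. -/
def tmap (E₁ E₂ : Type*) [NormedAddCommGroup E₁] [NormedSpace ℝ E₁] [NormedAddCommGroup E₂]
    [NormedSpace ℝ E₂] {M₁ M₂ : Type*} [TopologicalSpace M₁] [ChartedSpace E₁ M₁]
    [TopologicalSpace M₂] [ChartedSpace E₂ M₂] (f : M₁ → M₂) (x : M₁) : E₁ →L[ℝ] E₂ :=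
  mfderiv 𝓘(ℝ, E₁) 𝓘(ℝ, E₂) f x

/-- Smoothness in a neighbourhood of a point. -/
def SmoothNear (E₁ E₂ : Type*) [NormedAddCommGroup E₁] [NormedSpace ℝ E₁] [NormedAddCommGroup E₂]
    [NormedSpace ℝ E₂] {M₁ M₂ : Type*} [TopologicalSpace M₁] [ChartedSpace E₁ M₁]
    [TopologicalSpace M₂] [ChartedSpace E₂ M₂] (f : M₁ → M₂) (x : M₁) : Prop :=
  ∀ᶠ y in 𝓝 x, ContMDiffAt 𝓘(ℝ, E₁) 𝓘(ℝ, E₂) ∞ f y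

lemma SmoothNear.contMDiffAt {f : M₁ → M₂} {x : M₁} (h : SmoothNear E₁ E₂ f x) :
    ContMDiffAt 𝓘(ℝ, E₁) 𝓘(ℝ, E₂) ∞ f x := h.self_of_nhds

lemma SmoothNear.mdifferentiableAt {f : M₁ → M₂} {x : M₁} (h : SmoothNear E₁ E₂ f x) :
    MDifferentiableAt 𝓘(ℝ, E₁) 𝓘(ℝ, E₂) f x := h.contMDiffAt.mdifferentiableAt (by simp)

lemma SmoothNear.continuousAt {f : M₁ → M₂} {x : M₁} (h : SmoothNear E₁ E₂ f x) :
    ContinuousAt f x := h.contMDiffAt.continuousAt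

/-- Smoothness of order `∞` at a single point would not suffice for this: there the neighbourhood
may shrink with the order of differentiability. -/
lemma SmoothNear.eventually {f : M₁ → M₂} {x : M₁} (h : SmoothNear E₁ E₂ f x) :
    ∀ᶠ y in 𝓝 x, SmoothNear E₁ E₂ f y := eventually_eventually_nhds.2 h

lemma SmoothNear.comp {g : M₂ → M₃} {f : M₁ → M₂} {x : M₁}
    (hg : SmoothNear E₂ E₃ g (f x)) (hf : SmoothNear E₁ E₂ f x) :
    SmoothNear E₁ E₃ (g ∘ f) x := by
  filter_upwards [hf, hf.continuousAt.eventually hg] with y h1 h2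
  exact h2.comp y h1

lemma SmoothNear.congr {f g : M₁ → M₂} {x : M₁} (hf : SmoothNear E₁ E₂ f x) (h : g =ᶠ[𝓝 x] f) :
    SmoothNear E₁ E₂ g x := by
  filter_upwards [hf, eventually_eventually_nhds.2 h] with y h1 h2
  exact h1.congr_of_eventuallyEq h2

lemma smoothNear_of_contMDiff {f : M₁ → M₂} (h : ContMDiff 𝓘(ℝ, E₁) 𝓘(ℝ, E₂) ∞ f) (x : M₁) :
    SmoothNear E₁ E₂ f x := Eventually.of_forall fun y => h y

lemma smoothNear_of_contDiff {f : E₁ → E₂} (h : ContDiff ℝ ∞ f) (x : E₁) :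
    SmoothNear E₁ E₂ f x := smoothNear_of_contMDiff h.contMDiff x

lemma smoothNear_of_contMDiffOn {f : M₁ → M₂} {O : Set M₁} (hO : IsOpen O)
    (h : ContMDiffOn 𝓘(ℝ, E₁) 𝓘(ℝ, E₂) ∞ f O) {x : M₁} (hx : x ∈ O) :
    SmoothNear E₁ E₂ f x := by
  filter_upwards [hO.mem_nhds hx] with y hy
  exact h.contMDiffAt (hO.mem_nhds hy)

lemma contMDiff_of_smoothNear {f : M₁ → M₂} (h : ∀ x, SmoothNear E₁ E₂ f x) :
    ContMDiff 𝓘(ℝ, E₁) 𝓘(ℝ, E₂) ∞ f := fun x => (h x).contMDiffAt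

lemma smoothNear_id (x : M₁) : SmoothNear E₁ E₁ (fun y : M₁ => y) x :=
  smoothNear_of_contMDiff contMDiff_id x

lemma smoothNear_const (c : M₂) (x : M₁) : SmoothNear E₁ E₂ (fun _ : M₁ => c) x :=
  smoothNear_of_contMDiff contMDiff_const x

lemma tmap_comp {g : M₂ → M₃} {f : M₁ → M₂} {x : M₁}
    (hg : MDifferentiableAt 𝓘(ℝ, E₂) 𝓘(ℝ, E₃) g (f x))
    (hf : MDifferentiableAt 𝓘(ℝ, E₁) 𝓘(ℝ, E₂) f x) :
    tmap E₁ E₃ (g ∘ f) x = (tmap E₂ E₃ g (f x)).comp (tmap E₁ E₂ f x) :=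
  mfderiv_comp x hg hf

lemma SmoothNear.tmap_comp {g : M₂ → M₃} {f : M₁ → M₂} {x : M₁}
    (hg : SmoothNear E₂ E₃ g (f x)) (hf : SmoothNear E₁ E₂ f x) :
    tmap E₁ E₃ (g ∘ f) x = (tmap E₂ E₃ g (f x)).comp (tmap E₁ E₂ f x) :=
  QuasiPoisson.tmap_comp hg.mdifferentiableAt hf.mdifferentiableAt

lemma tmap_congr {f g : M₁ → M₂} {x : M₁} (h : f =ᶠ[𝓝 x] g) :
    tmap E₁ E₂ f x = tmap E₁ E₂ g x := by
  have hx := h.eq_of_nhds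
  unfold tmap
  have := h.mfderiv_eq (I := 𝓘(ℝ, E₁)) (I' := 𝓘(ℝ, E₂))
  exact this

lemma tmap_id (x : M₁) : tmap E₁ E₁ (fun y : M₁ => y) x = ContinuousLinearMap.id ℝ E₁ :=
  mfderiv_id

lemma tmap_const (c : M₂) (x : M₁) : tmap E₁ E₂ (fun _ : M₁ => c) x = 0 :=
  mfderiv_const

lemma tmap_eq_fderiv (f : E₁ → E₂) (x : E₁) : tmap E₁ E₂ f x = fderiv ℝ f x :=
  mfderiv_eq_fderiv

lemma tmap_clm (L : E₁ →L[ℝ] E₂) (x : E₁) : tmap E₁ E₂ L x = L := by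
  rw [tmap_eq_fderiv, L.fderiv]

lemma tmap_eq_id_of_eventuallyEq {f : M₁ → M₁} {x : M₁} (h : ∀ᶠ y in 𝓝 x, f y = y) :
    tmap E₁ E₁ f x = ContinuousLinearMap.id ℝ E₁ := by
  rw [tmap_congr (g := fun y => y) h, tmap_id]

lemma tmap_eq_zero_of_eventuallyEq {f : M₁ → M₂} {x : M₁} {c : M₂} (h : ∀ᶠ y in 𝓝 x, f y = c) :
    tmap E₁ E₂ f x = 0 := by
  rw [tmap_congr (g := fun _ => c) h, tmap_const]

/-! ### Open subsets -/

/-- The preferred chart of `U` at `u` is the restriction of the chart of `M₁`, so the inclusion is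
the identity in charts. Passing to open subsets therefore does not change derivatives at all. -/
lemma tmap_val (U : Opens M₁) (u : U) :
    tmap E₁ E₁ (Subtype.val : U → M₁) u = ContinuousLinearMap.id ℝ E₁ := by
  have hd : MDifferentiableAt 𝓘(ℝ, E₁) 𝓘(ℝ, E₁) (Subtype.val : U → M₁) u :=
    (contMDiff_subtype_val (n := ∞) u).mdifferentiableAt (by simp)
  have : tmap E₁ E₁ (Subtype.val : U → M₁) u = fderivWithin ℝ
      (writtenInExtChartAt 𝓘(ℝ, E₁) 𝓘(ℝ, E₁) u (Subtype.val : U → M₁))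
      (Set.range 𝓘(ℝ, E₁)) (extChartAt 𝓘(ℝ, E₁) u u) := hd.mfderiv
  rw [this]
  simp only [modelWithCornersSelf_coe, Set.range_id, fderivWithin_univ]
  have h2 : writtenInExtChartAt 𝓘(ℝ, E₁) 𝓘(ℝ, E₁) u (Subtype.val : U → M₁)
      =ᶠ[𝓝 (extChartAt 𝓘(ℝ, E₁) u u)] id := by
    have h3 : (extChartAt 𝓘(ℝ, E₁) u).target ∈ 𝓝 (extChartAt 𝓘(ℝ, E₁) u u) :=
      extChartAt_target_mem_nhds u
    filter_upwards [h3] with y hy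
    exact (extChartAt 𝓘(ℝ, E₁) u).right_inv hy
  rw [h2.fderiv_eq, fderiv_id]

lemma smoothNear_val (U : Opens M₁) (u : U) : SmoothNear E₁ E₁ (Subtype.val : U → M₁) u :=
  smoothNear_of_contMDiff contMDiff_subtype_val u

lemma smoothNear_val_comp_iff {U : Opens M₂} {f : M₁ → U} {x : M₁} :
    SmoothNear E₁ E₂ (Subtype.val ∘ f) x ↔ SmoothNear E₁ E₂ f x := by
  simp only [SmoothNear, ContMDiffAt.subtypeVal_comp_iff]

lemma smoothNear_comp_val_iff {U : Opens M₁} {f : M₁ → M₂} {x : U} :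
    SmoothNear E₁ E₂ (fun y : U => f y) x ↔ SmoothNear E₁ E₂ f x := by
  unfold SmoothNear
  simp only [contMDiffAt_subtype_iff]
  have := U.isOpenEmbedding'.map_nhds_eq x
  rw [← this]; rfl

lemma tmap_val_comp {U : Opens M₂} {f : M₁ → U} {x : M₁} (h : SmoothNear E₁ E₂ f x) :
    tmap E₁ E₂ (fun y => (f y : M₂)) x = tmap E₁ E₂ f x := by
  have := SmoothNear.tmap_comp (smoothNear_val U (f x)) h
  rw [tmap_val] at this
  exact this

lemma tmap_comp_val {U : Opens M₁} {f : M₁ → M₂} {x : U} (h : SmoothNear E₁ E₂ f x) :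
    tmap E₁ E₂ (fun y : U => f y) x = tmap E₁ E₂ f x := by
  have := SmoothNear.tmap_comp h (smoothNear_val U x)
  rw [tmap_val] at this
  exact this

/-! ### Charts -/

lemma smoothNear_extChartAt [IsManifold 𝓘(ℝ, E₁) ∞ M₁] (x : M₁) :
    SmoothNear E₁ E₁ (extChartAt 𝓘(ℝ, E₁) x) x :=
  smoothNear_of_contMDiffOn (chartAt E₁ x).open_source contMDiffOn_extChartAt
    (mem_chart_source E₁ x)

lemma smoothNear_extChartAt_symm [IsManifold 𝓘(ℝ, E₁) ∞ M₁] (x : M₁) :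
    SmoothNear E₁ E₁ (extChartAt 𝓘(ℝ, E₁) x).symm (extChartAt 𝓘(ℝ, E₁) x x) :=
  smoothNear_of_contMDiffOn (isOpen_extChartAt_target x) (contMDiffOn_extChartAt_symm x)
    (mem_extChartAt_target x)

lemma extChartAt_symm_extChartAt_eventually (x : M₁) :
    ∀ᶠ y in 𝓝 x, (extChartAt 𝓘(ℝ, E₁) x).symm (extChartAt 𝓘(ℝ, E₁) x y) = y := by
  filter_upwards [extChartAt_source_mem_nhds (I := 𝓘(ℝ, E₁)) x] with y hy
  exact (extChartAt 𝓘(ℝ, E₁) x).left_inv hy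

lemma extChartAt_extChartAt_symm_eventually (x : M₁) :
    ∀ᶠ y in 𝓝 (extChartAt 𝓘(ℝ, E₁) x x),
      extChartAt 𝓘(ℝ, E₁) x ((extChartAt 𝓘(ℝ, E₁) x).symm y) = y := by
  filter_upwards [extChartAt_target_mem_nhds (I := 𝓘(ℝ, E₁)) x] with y hy
  exact (extChartAt 𝓘(ℝ, E₁) x).right_inv hy

end Calculus

/-! ### The inverse function theorem and the extension of germs -/

section InverseFunction

variable {E E₁ E₂ E₃ : Type*} [NormedAddCommGroup E] [NormedSpace ℝ E]
  [NormedAddCommGroup E₁] [NormedSpace ℝ E₁] [NormedAddCommGroup E₂] [NormedSpace ℝ E₂]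
  [NormedAddCommGroup E₃] [NormedSpace ℝ E₃]
  {M M₁ M₂ M₃ : Type*} [TopologicalSpace M] [ChartedSpace E M]
  [TopologicalSpace M₁] [ChartedSpace E₁ M₁] [TopologicalSpace M₂] [ChartedSpace E₂ M₂]
  [TopologicalSpace M₃] [ChartedSpace E₃ M₃]

/-- Derivatives are computed in the preferred charts, and in its own coordinates the chart is the
identity. -/
lemma tmap_extChartAt_self [IsManifold 𝓘(ℝ, E₁) ∞ M₁] (x : M₁) :
    tmap E₁ E₁ (extChartAt 𝓘(ℝ, E₁) x) x = ContinuousLinearMap.id ℝ E₁ := by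
  have hd := (smoothNear_extChartAt (E₁ := E₁) x).mdifferentiableAt
  have : tmap E₁ E₁ (extChartAt 𝓘(ℝ, E₁) x) x = fderivWithin ℝ
      (writtenInExtChartAt 𝓘(ℝ, E₁) 𝓘(ℝ, E₁) x (extChartAt 𝓘(ℝ, E₁) x))
      (Set.range 𝓘(ℝ, E₁)) (extChartAt 𝓘(ℝ, E₁) x x) := hd.mfderiv
  rw [this]
  simp only [modelWithCornersSelf_coe, Set.range_id, fderivWithin_univ]
  have h2 : writtenInExtChartAt 𝓘(ℝ, E₁) 𝓘(ℝ, E₁) x (extChartAt 𝓘(ℝ, E₁) x)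
      =ᶠ[𝓝 (extChartAt 𝓘(ℝ, E₁) x x)] id := extChartAt_extChartAt_symm_eventually x
  rw [h2.fderiv_eq, fderiv_id]

lemma tmap_comp_eq_id {f : M₁ → M₂} {r : M₂ → M₁} {x : M₁} (hf : SmoothNear E₁ E₂ f x)
    (hr : SmoothNear E₂ E₁ r (f x)) (h : ∀ᶠ y in 𝓝 x, r (f y) = y) :
    (tmap E₂ E₁ r (f x)).comp (tmap E₁ E₂ f x) = ContinuousLinearMap.id ℝ E₁ := by
  rw [← hr.tmap_comp hf]
  exact tmap_eq_id_of_eventuallyEq h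

lemma smoothNear_iff_contDiffAt {f : E₁ → E₂} {x : E₁} :
    SmoothNear E₁ E₂ f x ↔ ∀ᶠ y in 𝓝 x, ContDiffAt ℝ ∞ f y := by
  simp only [SmoothNear, contMDiffAt_iff_contDiffAt]

lemma SmoothNear.contDiffAt {f : E₁ → E₂} {x : E₁} (h : SmoothNear E₁ E₂ f x) :
    ContDiffAt ℝ ∞ f x := h.contMDiffAt.contDiffAt

lemma exists_localInverse_vector [FiniteDimensional ℝ E₁] [FiniteDimensional ℝ E₂]
    {f : E₁ → E₂} {x : E₁} (hf : SmoothNear E₁ E₂ f x)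
    (hb : Function.Bijective (tmap E₁ E₂ f x)) :
    ∃ r : E₂ → E₁, SmoothNear E₂ E₁ r (f x) ∧ r (f x) = x ∧ (∀ᶠ y in 𝓝 x, r (f y) = y) ∧
      ∀ᶠ z in 𝓝 (f x), f (r z) = z := by
  have : CompleteSpace E₁ := FiniteDimensional.complete ℝ E₁
  rw [tmap_eq_fderiv] at hb
  let e : E₁ ≃L[ℝ] E₂ := (LinearEquiv.ofBijective (fderiv ℝ f x : E₁ →ₗ[ℝ] E₂) hb).toContinuousLinearEquiv
  have he : (e : E₁ →L[ℝ] E₂) = fderiv ℝ f x := by ext v; rfl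
  have hd : HasStrictFDerivAt f (e : E₁ →L[ℝ] E₂) x := by
    rw [he]; exact hf.contDiffAt.hasStrictFDerivAt (by simp)
  let h := hd.toOpenPartialHomeomorph f
  have hx : x ∈ h.source := hd.mem_toOpenPartialHomeomorph_source
  have hcoe : (h : E₁ → E₂) = f := hd.toOpenPartialHomeomorph_coe
  have hfx : f x ∈ h.target := by rw [← hcoe]; exact h.map_source hx
  have hrx : h.symm (f x) = x := by rw [← hcoe]; exact h.left_inv hx
  refine ⟨h.symm, ?_, hrx, ?_, ?_⟩
  · rw [smoothNear_iff_contDiffAt]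
    have hcont : ContinuousAt (fderiv ℝ f) x :=
      (hf.contDiffAt.fderiv_right (m := 0) (by simp)).continuousAt
    -- Invertible operators form an open set, so the derivative stays invertible near `x`, and the
    -- inverse is smooth near `f x` rather than only at this point.
    have h1 : ∀ᶠ y in 𝓝 x, fderiv ℝ f y ∈ Set.range ((↑) : (E₁ ≃L[ℝ] E₂) → E₁ →L[ℝ] E₂) := by
      apply hcont.eventually_mem
      rw [← he]; exact ContinuousLinearEquiv.nhds e
    have h2 := (smoothNear_iff_contDiffAt.1 hf).and h1
    have hs : Tendsto h.symm (𝓝 (f x)) (𝓝 x) := by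
      have := h.continuousAt_symm hfx
      rwa [ContinuousAt, hrx] at this
    filter_upwards [hs.eventually h2, h.open_target.mem_nhds hfx] with z hz hzt
    obtain ⟨hz1, e', he'⟩ := hz
    refine h.contDiffAt_symm (f₀' := e') hzt ?_ ?_
    · rw [hcoe, he']; exact (hz1.differentiableAt (by simp)).hasFDerivAt
    · rw [hcoe]; exact hz1
  · filter_upwards [h.open_source.mem_nhds hx] with y hy
    rw [← hcoe]; exact h.left_inv hy
  · filter_upwards [h.open_target.mem_nhds hfx] with y hy
    have := h.right_inv hy
    rwa [hcoe] at this

/-- The inverse function theorem on manifolds. -/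
theorem exists_localInverse [FiniteDimensional ℝ E₁] [FiniteDimensional ℝ E₂]
    [IsManifold 𝓘(ℝ, E₁) ∞ M₁] [IsManifold 𝓘(ℝ, E₂) ∞ M₂]
    {f : M₁ → M₂} {x : M₁} (hf : SmoothNear E₁ E₂ f x)
    (hb : Function.Bijective (tmap E₁ E₂ f x)) :
    ∃ r : M₂ → M₁, SmoothNear E₂ E₁ r (f x) ∧ r (f x) = x ∧ (∀ᶠ y in 𝓝 x, r (f y) = y) ∧
      ∀ᶠ z in 𝓝 (f x), f (r z) = z := by
  set φ := extChartAt 𝓘(ℝ, E₁) x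
  set ψ := extChartAt 𝓘(ℝ, E₂) (f x)
  have hφ : SmoothNear E₁ E₁ φ x := smoothNear_extChartAt x
  have hψ : SmoothNear E₂ E₂ ψ (f x) := smoothNear_extChartAt (f x)
  have hφs : SmoothNear E₁ E₁ φ.symm (φ x) := smoothNear_extChartAt_symm x
  have hψs : SmoothNear E₂ E₂ ψ.symm (ψ (f x)) := smoothNear_extChartAt_symm (f x)
  have hx : φ.symm (φ x) = x := extChartAt_to_inv x
  have hy : ψ.symm (ψ (f x)) = f x := extChartAt_to_inv (f x)
  have hφi := extChartAt_symm_extChartAt_eventually (E₁ := E₁) x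
  have hφi' := extChartAt_extChartAt_symm_eventually (E₁ := E₁) x
  have hψi := extChartAt_symm_extChartAt_eventually (E₁ := E₂) (f x)
  have hfs : SmoothNear E₁ E₂ (f ∘ φ.symm) (φ x) := by
    refine SmoothNear.comp ?_ hφs
    rwa [hx]
  have hF : SmoothNear E₁ E₂ (ψ ∘ (f ∘ φ.symm)) (φ x) := by
    refine SmoothNear.comp ?_ hfs
    simpa only [Function.comp_apply, hx] using hψ
  have hFx : (ψ ∘ (f ∘ φ.symm)) (φ x) = ψ (f x) := by simp [hx]
  have hder : tmap E₁ E₂ (ψ ∘ (f ∘ φ.symm)) (φ x) =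
      (tmap E₂ E₂ ψ (f x)).comp ((tmap E₁ E₂ f x).comp (tmap E₁ E₁ φ.symm (φ x))) := by
    rw [SmoothNear.tmap_comp (by simpa only [Function.comp_apply, hx] using hψ) hfs,
      SmoothNear.tmap_comp (by rwa [hx]) hφs]
    simp only [Function.comp_apply, hx]
  have hs1 := tmap_comp_eq_id hφ hφs hφi
  have hi1 : tmap E₁ E₁ φ.symm (φ x) = ContinuousLinearMap.id ℝ E₁ := by
    rw [tmap_extChartAt_self] at hs1
    simpa using hs1
  -- The charts have derivative the identity at their base points, so `f` read in charts has the
  -- same derivative as `f`.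
  obtain ⟨r, hr, hrx, hr1, hr2⟩ := exists_localInverse_vector hF (by
    rw [hder, tmap_extChartAt_self, hi1]; simpa using hb)
  rw [hFx] at hr hr2 hrx
  have c1 : Tendsto φ (𝓝 x) (𝓝 (φ x)) := hφ.continuousAt
  have c2 : Tendsto ψ (𝓝 (f x)) (𝓝 (ψ (f x))) := hψ.continuousAt
  have c3 : Tendsto r (𝓝 (ψ (f x))) (𝓝 (φ x)) := by
    have := hr.continuousAt; rwa [ContinuousAt, hrx] at this
  have hrψ : SmoothNear E₂ E₁ (r ∘ ψ) (f x) := hr.comp hψ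
  have c4 : Tendsto (fun z => φ.symm (r (ψ z))) (𝓝 (f x)) (𝓝 x) := by
    have := hφs.continuousAt
    rw [ContinuousAt, hx] at this
    exact this.comp (c3.comp c2)
  refine ⟨φ.symm ∘ (r ∘ ψ), SmoothNear.comp (by simpa [hrx] using hφs) hrψ, ?_, ?_, ?_⟩
  · simp [hrx, hx]
  · filter_upwards [c1.eventually hr1, hφi] with y h1 h2
    simp only [Function.comp_apply] at h1 ⊢
    rw [h2] at h1
    rw [h1, h2]
  · have c5 : Tendsto (fun z => f (φ.symm (r (ψ z)))) (𝓝 (f x)) (𝓝 (f x)) :=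
      hf.continuousAt.tendsto.comp c4
    filter_upwards [c2.eventually hr2, hψi, c5.eventually hψi] with z h1 h2 h3
    simp only [Function.comp_apply] at h1 ⊢
    rw [← h3, h1, h2]

/-- Germs of mutually inverse smooth maps give a partial diffeomorphism. -/
lemma exists_partialDiffeomorph {f : M₁ → M₂} {r : M₂ → M₁} {x : M₁}
    (hf : SmoothNear E₁ E₂ f x) (hr : SmoothNear E₂ E₁ r (f x))
    (h1 : ∀ᶠ y in 𝓝 x, r (f y) = y) (h2 : ∀ᶠ z in 𝓝 (f x), f (r z) = z) {O : Set M₁}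
    (hO : O ∈ 𝓝 x) :
    ∃ h : PartialDiffeomorph 𝓘(ℝ, E₁) 𝓘(ℝ, E₂) M₁ M₂ ∞,
      x ∈ h.source ∧ h.source ⊆ O ∧ (h : M₁ → M₂) = f ∧ h.invFun = r := by
  have hrx : r (f x) = x := h1.self_of_nhds
  obtain ⟨A, hA, hAo, hxA⟩ := eventually_nhds_iff.1 (hf.and (h1.and hO))
  obtain ⟨B, hB, hBo, hxB⟩ := eventually_nhds_iff.1 (hr.and h2)
  have hfA : ContMDiffOn 𝓘(ℝ, E₁) 𝓘(ℝ, E₂) ∞ f A := fun y hy => (hA y hy).1.contMDiffWithinAt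
  have hrB : ContMDiffOn 𝓘(ℝ, E₂) 𝓘(ℝ, E₁) ∞ r B := fun y hy => (hB y hy).1.contMDiffWithinAt
  refine ⟨{ toFun := f, invFun := r, source := A ∩ f ⁻¹' B, target := B ∩ r ⁻¹' A,
            map_source' := ?_, map_target' := ?_, left_inv' := ?_, right_inv' := ?_,
            open_source := hfA.continuousOn.isOpen_inter_preimage hAo hBo,
            open_target := hrB.continuousOn.isOpen_inter_preimage hBo hAo,
            contMDiffOn_toFun := hfA.mono Set.inter_subset_left,
            contMDiffOn_invFun := hrB.mono Set.inter_subset_left }, ⟨hxA, hxB⟩,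
            fun y hy => (hA y hy.1).2.2, rfl, rfl⟩
  · rintro y ⟨hy1, hy2⟩
    exact ⟨hy2, by rw [Set.mem_preimage, (hA y hy1).2.1]; exact hy1⟩
  · rintro y ⟨hy1, hy2⟩
    exact ⟨hy2, by rw [Set.mem_preimage, (hB y hy1).2]; exact hy1⟩
  · rintro y ⟨hy1, hy2⟩
    exact (hA y hy1).2.1
  · rintro y ⟨hy1, hy2⟩
    exact (hB y hy1).2

/-- A function that is smooth near a point agrees near this point with a smooth function. -/
lemma exists_contMDiff_eventuallyEq [FiniteDimensional ℝ E₁] [IsManifold 𝓘(ℝ, E₁) ∞ M₁]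
    [T2Space M₁] {f : M₁ → E₂} {x : M₁} (hf : SmoothNear E₁ E₂ f x) :
    ∃ f' : M₁ → E₂, ContMDiff 𝓘(ℝ, E₁) 𝓘(ℝ, E₂) ∞ f' ∧ f' =ᶠ[𝓝 x] f := by
  -- The support of the bump function lies where `f` is smooth. In this way the hypotheses on `P`,
  -- which only speak of globally smooth functions, apply to germs.
  obtain ⟨b, -, hb⟩ := (SmoothBumpFunction.nhds_basis_tsupport (I := 𝓘(ℝ, E₁)) x).mem_iff.1 hf
  refine ⟨fun y => b y • f y, contMDiff_of_tsupport fun y hy => ?_, ?_⟩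
  · have : y ∈ tsupport b := tsupport_smul_subset_left b f hy
    exact b.contMDiffAt.smul (hb this)
  · filter_upwards [b.eventuallyEq_one] with y hy
    simp [hy]

end InverseFunction

/-! ### First-order comparison of maps that differ by finitely many linear maps -/

section Pigeonhole

variable {E E₁ E₂ E₃ : Type*} [NormedAddCommGroup E] [NormedSpace ℝ E]
  [NormedAddCommGroup E₁] [NormedSpace ℝ E₁] [NormedAddCommGroup E₂] [NormedSpace ℝ E₂]
  [NormedAddCommGroup E₃] [NormedSpace ℝ E₃]
  {M M₁ M₂ M₃ : Type*} [TopologicalSpace M] [ChartedSpace E M]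
  [TopologicalSpace M₁] [ChartedSpace E₁ M₁] [TopologicalSpace M₂] [ChartedSpace E₂ M₂]
  [TopologicalSpace M₃] [ChartedSpace E₃ M₃]

lemma tmap_extChartAt_symm_self [IsManifold 𝓘(ℝ, E₁) ∞ M₁] (x : M₁) :
    tmap E₁ E₁ (extChartAt 𝓘(ℝ, E₁) x).symm (extChartAt 𝓘(ℝ, E₁) x x) =
      ContinuousLinearMap.id ℝ E₁ := by
  have h := tmap_comp_eq_id (smoothNear_extChartAt (E₁ := E₁) x) (smoothNear_extChartAt_symm x)
    (extChartAt_symm_extChartAt_eventually x)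
  rw [tmap_extChartAt_self] at h
  simpa using h

lemma SmoothNear.comp_extChartAt_symm [IsManifold 𝓘(ℝ, E₁) ∞ M₁] {f : M₁ → M₂} {x : M₁}
    (hf : SmoothNear E₁ E₂ f x) :
    SmoothNear E₁ E₂ (f ∘ (extChartAt 𝓘(ℝ, E₁) x).symm) (extChartAt 𝓘(ℝ, E₁) x x) := by
  refine SmoothNear.comp ?_ (smoothNear_extChartAt_symm x)
  rwa [extChartAt_to_inv]

lemma SmoothNear.tmap_comp_extChartAt_symm [IsManifold 𝓘(ℝ, E₁) ∞ M₁] {f : M₁ → M₂} {x : M₁}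
    (hf : SmoothNear E₁ E₂ f x) :
    tmap E₁ E₂ (f ∘ (extChartAt 𝓘(ℝ, E₁) x).symm) (extChartAt 𝓘(ℝ, E₁) x x) =
      tmap E₁ E₂ f x := by
  rw [SmoothNear.tmap_comp (by rwa [extChartAt_to_inv]) (smoothNear_extChartAt_symm x),
    tmap_extChartAt_symm_self, extChartAt_to_inv]
  simp

lemma tendsto_extChartAt_symm (x : M₁) :
    Tendsto (extChartAt 𝓘(ℝ, E₁) x).symm (𝓝 (extChartAt 𝓘(ℝ, E₁) x x)) (𝓝 x) := by
  have := continuousAt_extChartAt_symm (I := 𝓘(ℝ, E₁)) x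
  rwa [ContinuousAt, extChartAt_to_inv] at this

/-- On the line through `x` in the direction `v`, some index `i` serves for parameters `t ≠ 0`
accumulating at 0, so `f` and `ρ i ∘ g` have the same value at `x` and the same derivative along
`v`. The index depends on `v`, but the vectors served by a given index form a subspace, and finitely
many proper subspaces cannot cover a real vector space. -/
lemma exists_eq_fderiv_of_finite {ι : Type*} [Finite ι] {f g : E₁ → E₂} {x : E₁}
    (ρ : ι → E₂ →L[ℝ] E₂) (hf : DifferentiableAt ℝ f x) (hg : DifferentiableAt ℝ g x)
    (h : ∀ᶠ y in 𝓝 x, ∃ i, f y = ρ i (g y)) :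
    ∃ i, f x = ρ i (g x) ∧ fderiv ℝ f x = (ρ i).comp (fderiv ℝ g x) := by
  have key : ∀ v : E₁, ∃ i : {i // f x = ρ i (g x)},
      v ∈ LinearMap.ker (fderiv ℝ f x - (ρ i).comp (fderiv ℝ g x) : E₁ →L[ℝ] E₂).toLinearMap := by
    intro v
    have hl : HasDerivAt (fun t : ℝ => x + t • v) v 0 := by
      simpa using ((hasDerivAt_id (0 : ℝ)).smul_const v).const_add x
    have hl0 : Tendsto (fun t : ℝ => x + t • v) (𝓝 0) (𝓝 x) := by
      have := hl.continuousAt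
      simpa [ContinuousAt] using this
    have h1 : ∀ᶠ t in 𝓝[≠] (0 : ℝ), ∃ i, f (x + t • v) = ρ i (g (x + t • v)) :=
      (hl0.mono_left nhdsWithin_le_nhds).eventually h
    obtain ⟨i, hi⟩ := frequently_exists.1 h1.frequently
    let u : ℝ → E₂ := fun t => f (x + t • v) - ρ i (g (x + t • v))
    have hu : HasDerivAt u (fderiv ℝ f x v - ρ i (fderiv ℝ g x v)) 0 := by
      have hf' : HasFDerivAt f (fderiv ℝ f x) (x + (0 : ℝ) • v) := by simpa using hf.hasFDerivAt
      have hg' : HasFDerivAt g (fderiv ℝ g x) (x + (0 : ℝ) • v) := by simpa using hg.hasFDerivAt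
      exact (hf'.comp_hasDerivAt 0 hl).sub
        ((ρ i).hasFDerivAt.comp_hasDerivAt 0 (hg'.comp_hasDerivAt 0 hl))
    have hi' : ∃ᶠ t in 𝓝[≠] (0 : ℝ), u t = 0 := hi.mono fun t ht => sub_eq_zero.2 ht
    have hu0 : u 0 = 0 := by
      have h2 : Tendsto u (𝓝[≠] 0) (𝓝 (u 0)) := hu.continuousAt.tendsto.mono_left nhdsWithin_le_nhds
      exact (isClosed_singleton (x := (0 : E₂))).mem_of_frequently_of_tendsto hi' h2
    have hd0 : fderiv ℝ f x v - ρ i (fderiv ℝ g x v) = 0 := by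
      have h2 := hu.tendsto_slope_zero
      refine (isClosed_singleton (x := (0 : E₂))).mem_of_frequently_of_tendsto
        (hi'.mono fun t ht => ?_) h2
      simp [ht, hu0]
    exact ⟨⟨i, by simpa [u, sub_eq_zero] using hu0⟩, by simpa using hd0⟩
  obtain ⟨i, hi⟩ := Subspace.exists_eq_top_of_iUnion_eq_univ (k := ℝ)
    (p := fun i : {i // f x = ρ i (g x)} =>
      LinearMap.ker (fderiv ℝ f x - (ρ i).comp (fderiv ℝ g x) : E₁ →L[ℝ] E₂).toLinearMap)
    (Set.eq_univ_of_forall fun v => Set.mem_iUnion.2 (key v))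
  refine ⟨i, i.2, ?_⟩
  ext v
  have : v ∈ LinearMap.ker (fderiv ℝ f x - (ρ i).comp (fderiv ℝ g x) : E₁ →L[ℝ] E₂).toLinearMap := by
    rw [hi]; trivial
  simpa [sub_eq_zero] using this

/-- If near `x` the value of `f` is obtained from that of `g` by one of finitely many linear maps,
then one of these maps does so at `x` to first order. -/
lemma exists_eq_tmap_of_finite [IsManifold 𝓘(ℝ, E₁) ∞ M₁] {ι : Type*} [Finite ι]
    {f g : M₁ → E₂} {x : M₁} (ρ : ι → E₂ →L[ℝ] E₂) (hf : SmoothNear E₁ E₂ f x)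
    (hg : SmoothNear E₁ E₂ g x) (h : ∀ᶠ y in 𝓝 x, ∃ i, f y = ρ i (g y)) :
    ∃ i, f x = ρ i (g x) ∧ tmap E₁ E₂ f x = (ρ i).comp (tmap E₁ E₂ g x) := by
  obtain ⟨i, h1, h2⟩ := exists_eq_fderiv_of_finite (f := f ∘ (extChartAt 𝓘(ℝ, E₁) x).symm)
    (g := g ∘ (extChartAt 𝓘(ℝ, E₁) x).symm) (x := extChartAt 𝓘(ℝ, E₁) x x) ρ
    (hf.comp_extChartAt_symm.contDiffAt.differentiableAt (by simp))
    (hg.comp_extChartAt_symm.contDiffAt.differentiableAt (by simp))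
    ((tendsto_extChartAt_symm x).eventually h)
  refine ⟨i, by simpa [extChartAt_to_inv] using h1, ?_⟩
  rwa [← tmap_eq_fderiv, ← tmap_eq_fderiv, hf.tmap_comp_extChartAt_symm,
    hg.tmap_comp_extChartAt_symm] at h2

end Pigeonhole

/-! ### Slice charts for zero sets of submersions -/

section Submersion

variable {E₁ E₂ : Type*} [NormedAddCommGroup E₁] [NormedSpace ℝ E₁] [FiniteDimensional ℝ E₁]
  [NormedAddCommGroup E₂] [NormedSpace ℝ E₂] [FiniteDimensional ℝ E₂]
  {M : Type*} [TopologicalSpace M] [ChartedSpace E₁ M] [IsManifold 𝓘(ℝ, E₁) ∞ M]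

/-- The zero set of a submersion is a linear subspace in a suitable chart. -/
lemma exists_isSliceChart {S : Set M} {x : M} {c : M → E₂} (hc : SmoothNear E₁ E₂ c x)
    (hsurj : Function.Surjective (tmap E₁ E₂ c x)) (hS : ∀ᶠ y in 𝓝 x, (y ∈ S ↔ c y = 0)) :
    ∃ (e : OpenPartialHomeomorph M E₁) (V : Submodule ℝ E₁), x ∈ e.source ∧ IsSliceChart S e V ∧
      finrank ℝ V = finrank ℝ E₁ - finrank ℝ E₂ ∧
      ∀ v, tmap E₁ E₂ c x v = 0 → tmap E₁ E₁ e x v ∈ V := by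
  set L := tmap E₁ E₂ c x with hL
  obtain ⟨R, hR⟩ := (L : E₁ →ₗ[ℝ] E₂).exists_rightInverse_of_surjective
    (LinearMap.range_eq_top.2 hsurj)
  let R' : E₂ →L[ℝ] E₁ := LinearMap.toContinuousLinearMap R
  have hLR : ∀ z, L (R' z) = z := fun z => LinearMap.congr_fun hR z
  let V : Submodule ℝ E₁ := LinearMap.ker (L : E₁ →ₗ[ℝ] E₂)
  let Q : E₁ →L[ℝ] E₁ := ContinuousLinearMap.id ℝ E₁ - R'.comp L
  have hQ : ∀ z, L (Q z) = 0 := fun z => by simp [Q, hLR]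
  set φ := extChartAt 𝓘(ℝ, E₁) x with hφ
  -- The new coordinates satisfy `L ∘ ψ = c`, so the zero set of `c` becomes the kernel `V` of `L`.
  -- Their derivative at `x` is `Q + R' ∘ L`, the identity.
  let ψ : M → E₁ := fun y => Q (φ y) + R' (c y)
  have hQφ : SmoothNear E₁ E₁ (Q ∘ φ) x :=
    (smoothNear_of_contDiff Q.contDiff _).comp (smoothNear_extChartAt x)
  have hRc : SmoothNear E₁ E₁ (R' ∘ c) x := (smoothNear_of_contDiff R'.contDiff _).comp hc
  have hψ : SmoothNear E₁ E₁ ψ x := by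
    filter_upwards [hQφ, hRc] with y h1 h2
    exact h1.add h2
  have htψ : tmap E₁ E₁ ψ x = ContinuousLinearMap.id ℝ E₁ := by
    have h1 : tmap E₁ E₁ ψ x = tmap E₁ E₁ (Q ∘ φ) x + tmap E₁ E₁ (R' ∘ c) x :=
      mfderiv_add hQφ.mdifferentiableAt hRc.mdifferentiableAt
    rw [h1, SmoothNear.tmap_comp (smoothNear_of_contDiff Q.contDiff _) (smoothNear_extChartAt x),
      SmoothNear.tmap_comp (smoothNear_of_contDiff R'.contDiff _) hc, tmap_clm, tmap_clm,
      tmap_extChartAt_self, ← hL]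
    ext v
    simp [Q]
  have hmem : ∀ y, ψ y ∈ V ↔ c y = 0 := fun y => by
    change L (Q (φ y) + R' (c y)) = 0 ↔ _
    rw [map_add, hQ, hLR, zero_add]
  obtain ⟨r, hr, hrx, h1, h2⟩ := exists_localInverse hψ (by rw [htψ]; exact Function.bijective_id)
  obtain ⟨h, hx, hO, hcoe, -⟩ := exists_partialDiffeomorph hψ hr h1 h2 hS
  refine ⟨h.toOpenPartialHomeomorph, V, hx, ⟨?_, fun y hy => ?_⟩, ?_, ?_⟩
  · exact OpenPartialHomeomorph.mem_maximalAtlas_of_contMDiffOn _ h.contMDiffOn_toFun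
      h.contMDiffOn_invFun
  · have : h.toOpenPartialHomeomorph y = ψ y := congrFun hcoe y
    rw [this, hmem]
    exact hO hy
  · have := LinearMap.finrank_range_add_finrank_ker (L : E₁ →ₗ[ℝ] E₂)
    rw [LinearMap.range_eq_top.2 hsurj, finrank_top] at this
    change finrank ℝ (LinearMap.ker (L : E₁ →ₗ[ℝ] E₂)) = _
    omega
  · intro v hv
    have : tmap E₁ E₁ h.toOpenPartialHomeomorph x = tmap E₁ E₁ ψ x := by
      congr 1
    rw [this, htψ]
    exact hv

lemma smoothNear_of_isSliceChart {S : Set M} {e : OpenPartialHomeomorph M E₁} {V : Submodule ℝ E₁}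
    (h : IsSliceChart S e V) {y : M} (hy : y ∈ e.source) : SmoothNear E₁ E₁ e y :=
  smoothNear_of_contMDiffOn e.open_source (contMDiffOn_of_mem_maximalAtlas h.1) hy

lemma smoothNear_symm_of_isSliceChart {S : Set M} {e : OpenPartialHomeomorph M E₁}
    {V : Submodule ℝ E₁} (h : IsSliceChart S e V) {y : M} (hy : y ∈ e.source) :
    SmoothNear E₁ E₁ e.symm (e y) :=
  smoothNear_of_contMDiffOn e.open_target (contMDiffOn_symm_of_mem_maximalAtlas h.1)
    (e.map_source hy)

/-- The tangent space of a submanifold does not depend on the slice chart. -/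
lemma IsSliceChart.tmap_mem {S : Set M} {e e' : OpenPartialHomeomorph M E₁}
    {V V' : Submodule ℝ E₁} (h : IsSliceChart S e V) (h' : IsSliceChart S e' V') {y : M}
    (hyS : y ∈ S) (hy : y ∈ e.source) (hy' : y ∈ e'.source) {v : E₁}
    (hv : tmap E₁ E₁ e y v ∈ V) : tmap E₁ E₁ e' y v ∈ V' := by
  have he := smoothNear_of_isSliceChart h hy
  have hes := smoothNear_symm_of_isSliceChart h hy
  have he' := smoothNear_of_isSliceChart h' hy'
  have hey : e.symm (e y) = y := e.left_inv hy
  set w := tmap E₁ E₁ e y v with hw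
  have hwv : tmap E₁ E₁ e.symm (e y) w = v := by
    have := tmap_comp_eq_id he hes (by
      filter_upwards [e.open_source.mem_nhds hy] with z hz using e.left_inv hz)
    exact DFunLike.congr_fun this v
  have hcomp : SmoothNear E₁ E₁ (e' ∘ e.symm) (e y) := SmoothNear.comp (by rwa [hey]) hes
  have hfd : HasFDerivAt (e' ∘ e.symm) (tmap E₁ E₁ (e' ∘ e.symm) (e y)) (e y) := by
    rw [tmap_eq_fderiv]
    exact (hcomp.contDiffAt.differentiableAt (by simp)).hasFDerivAt
  -- The segment `e y + t • w` lies in `V`, so `e.symm` carries it into `S` and `e'` then carries it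
  -- into `V'`. The difference quotients lie in the closed subspace `V'`, hence so does their limit.
  have hl : HasDerivAt (fun t : ℝ => e y + t • w) w 0 := by
    simpa using ((hasDerivAt_id (0 : ℝ)).smul_const w).const_add (e y)
  have hl0 : Tendsto (fun t : ℝ => e y + t • w) (𝓝 0) (𝓝 (e y)) := by
    simpa [ContinuousAt] using hl.continuousAt
  have hd : HasDerivAt (fun t : ℝ => (e' ∘ e.symm) (e y + t • w))
      (tmap E₁ E₁ (e' ∘ e.symm) (e y) w) 0 := by
    have hfd' : HasFDerivAt (e' ∘ e.symm) (tmap E₁ E₁ (e' ∘ e.symm) (e y)) (e y + (0 : ℝ) • w) := by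
      simpa using hfd
    exact hfd'.comp_hasDerivAt (0 : ℝ) hl
  have hval : tmap E₁ E₁ (e' ∘ e.symm) (e y) w = tmap E₁ E₁ e' y v := by
    rw [SmoothNear.tmap_comp (by rwa [hey]) hes, hey]
    exact congrArg _ hwv
  rw [hval] at hd
  have hclosed : IsClosed (V' : Set E₁) := V'.closed_of_finiteDimensional
  have heV : ∀ᶠ t : ℝ in 𝓝 0, (e' ∘ e.symm) (e y + t • w) ∈ V' := by
    have h1 : ∀ᶠ z in 𝓝 (e y), z ∈ e.target ∧ e.symm z ∈ e'.source := by
      refine Eventually.and (e.open_target.mem_nhds (e.map_source hy)) ?_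
      have := hes.continuousAt
      rw [ContinuousAt, hey] at this
      exact this.eventually (e'.open_source.mem_nhds hy')
    filter_upwards [hl0.eventually h1] with t ht
    refine (h'.2 _ ht.2).1 ((h.2 _ (e.map_target ht.1)).2 ?_)
    rw [e.right_inv ht.1]
    exact V.add_mem ((h.2 y hy).1 hyS) (V.smul_mem t hv)
  have hlim := hd.tendsto_slope_zero
  refine hclosed.mem_of_tendsto hlim ?_
  filter_upwards [heV.filter_mono nhdsWithin_le_nhds] with t ht
  refine V'.smul_mem _ (V'.sub_mem (by simpa using ht) ?_)
  have := heV.self_of_nhds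
  simpa using this

end Submersion

/-! ### The constant rank theorem, as equations for the image -/

section ConstantRank

variable {A B : Type*} [NormedAddCommGroup A] [NormedSpace ℝ A] [FiniteDimensional ℝ A]
  [NormedAddCommGroup B] [NormedSpace ℝ B] [FiniteDimensional ℝ B]

/-- The rank of a linear map. -/
abbrev lrank (L : A →L[ℝ] B) : ℕ := finrank ℝ (LinearMap.range (L : A →ₗ[ℝ] B))

lemma exists_clm_surjective_ker (R : Submodule ℝ B) :
    ∃ l : B →L[ℝ] EuclideanSpace ℝ (Fin (finrank ℝ B - finrank ℝ R)),
      Function.Surjective l ∧ ∀ y, l y = 0 ↔ y ∈ R := by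
  have hd : finrank ℝ (B ⧸ R) = finrank ℝ (EuclideanSpace ℝ (Fin (finrank ℝ B - finrank ℝ R))) := by
    have := R.finrank_quotient_add_finrank
    rw [finrank_euclideanSpace, Fintype.card_fin]
    omega
  let e := LinearEquiv.ofFinrankEq _ _ hd
  refine ⟨LinearMap.toContinuousLinearMap (e.toLinearMap ∘ₗ R.mkQ), ?_, fun y => ?_⟩
  · exact e.surjective.comp R.mkQ_surjective
  · change e (R.mkQ y) = 0 ↔ _
    rw [LinearEquiv.map_eq_zero_iff, Submodule.mkQ_apply, Submodule.Quotient.mk_eq_zero]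

lemma exists_clm_projection (R : Submodule ℝ B) : ∃ p : B →L[ℝ] R, ∀ y : R, p y = y :=
  Submodule.ClosedComplemented.of_finiteDimensional R

lemma hasFDerivAt_of_smoothNear {f : A → B} {x : A} (h : SmoothNear A B f x) :
    HasFDerivAt f (tmap A B f x) x := by
  rw [tmap_eq_fderiv]
  exact (h.contDiffAt.differentiableAt (by simp)).hasFDerivAt

/-- A map of constant rank has its image locally given by equations. -/
lemma exists_equations_vector {o : A → B} {a : A} (ho : SmoothNear A B o a)
    (hrank : ∀ᶠ h in 𝓝 a, lrank (tmap A B o h) = lrank (tmap A B o a))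
    {O : Set A} (hO : O ∈ 𝓝 a) :
    ∃ c : B → EuclideanSpace ℝ (Fin (finrank ℝ B - lrank (tmap A B o a))),
      SmoothNear B (EuclideanSpace ℝ (Fin (finrank ℝ B - lrank (tmap A B o a)))) c (o a) ∧
      Function.Surjective
        (tmap B (EuclideanSpace ℝ (Fin (finrank ℝ B - lrank (tmap A B o a)))) c (o a)) ∧
      (∀ᶠ h in 𝓝 a, c (o h) = 0) ∧ ∀ᶠ y in 𝓝 (o a), c y = 0 → ∃ h ∈ O, o h = y := by
  set L := tmap A B o a with hL
  set R : Submodule ℝ B := LinearMap.range (L : A →ₗ[ℝ] B) with hRdef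
  set K : Submodule ℝ A := LinearMap.ker (L : A →ₗ[ℝ] B) with hKdef
  obtain ⟨l, hl, hlR⟩ := exists_clm_surjective_ker R
  obtain ⟨p, hp⟩ := exists_clm_projection R
  obtain ⟨q, hq⟩ := exists_clm_projection K
  let W := EuclideanSpace ℝ (Fin (finrank ℝ B - finrank ℝ R))
  -- Coordinates adapted to `o`: the image component of the value, and a coordinate along the kernel
  -- of `L`. The derivative at `a` is injective because `p` is the identity on `R` and `q` is the
  -- identity on `K`.
  let φ : A → R × K := fun h => (p (o h), q h)
  have hpo : SmoothNear A R (p ∘ o) a := (smoothNear_of_contDiff p.contDiff _).comp ho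
  have hφ : SmoothNear A (R × K) φ a := by
    rw [smoothNear_iff_contDiffAt] at hpo ⊢
    filter_upwards [hpo] with y hy
    exact hy.prodMk q.contDiff.contDiffAt
  have htφ : tmap A (R × K) φ a = (p.comp L).prod q := by
    rw [tmap_eq_fderiv]
    exact ((p.hasFDerivAt.comp a (hasFDerivAt_of_smoothNear ho)).prodMk q.hasFDerivAt).fderiv
  have hinj : Function.Injective ((p.comp L).prod q) := by
    rw [injective_iff_map_eq_zero]
    intro v hv
    have h1 : p (L v) = 0 := congrArg Prod.fst hv
    have h2 : q v = 0 := congrArg Prod.snd hv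
    have h3 : p (L v) = ⟨L v, ⟨v, rfl⟩⟩ := hp ⟨L v, ⟨v, rfl⟩⟩
    have h4 : L v = 0 := by
      rw [h3] at h1; exact congrArg Subtype.val h1
    have h5 : q v = ⟨v, h4⟩ := hq ⟨v, h4⟩
    rw [h5] at h2; exact congrArg Subtype.val h2
  have hdim : finrank ℝ A = finrank ℝ (R × K) := by
    rw [finrank_prod]
    exact (LinearMap.finrank_range_add_finrank_ker (L : A →ₗ[ℝ] B)).symm
  have hbij : Function.Bijective (tmap A (R × K) φ a) := by
    rw [htφ]
    exact ⟨hinj, (LinearMap.injective_iff_surjective_of_finrank_eq_finrank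
      (f := (((p.comp L).prod q : A →L[ℝ] R × K) : A →ₗ[ℝ] R × K)) hdim).1 hinj⟩
  obtain ⟨r, hr, hra, hr1, hr2⟩ := exists_localInverse hφ hbij
  have hor : SmoothNear (R × K) B (o ∘ r) (φ a) := SmoothNear.comp (by rwa [hra]) hr
  have hrt : Tendsto r (𝓝 (φ a)) (𝓝 a) := by
    have := hr.continuousAt; rwa [ContinuousAt, hra] at this
  have hpor : ∀ᶠ s in 𝓝 (φ a), p (o (r s)) = s.1 := by
    filter_upwards [hr2] with s hs using congrArg Prod.fst hs
  -- the second component does not depend on the variable in `K`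
  have hvan : ∀ᶠ s in 𝓝 (φ a), ∀ z : K, tmap (R × K) B (o ∘ r) s (0, z) = 0 := by
    filter_upwards [hor.eventually, hr.eventually, hrt.eventually ho.eventually,
      hrt.eventually hrank, hpor.eventually_nhds] with s h1 h2 h3 h4 h5 z
    set D := tmap (R × K) B (o ∘ r) s with hD
    have hpD : ∀ w, p (D w) = w.1 := by
      have h6 : tmap (R × K) R (p ∘ (o ∘ r)) s = tmap (R × K) R (ContinuousLinearMap.fst ℝ R K) s :=
        tmap_congr h5
      rw [SmoothNear.tmap_comp (smoothNear_of_contDiff p.contDiff _) h1, tmap_clm, tmap_clm] at h6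
      exact fun w => DFunLike.congr_fun h6 w
    have hDr : LinearMap.range (D : R × K →ₗ[ℝ] B) ≤
        LinearMap.range (tmap A B o (r s) : A →ₗ[ℝ] B) := by
      rintro _ ⟨w, rfl⟩
      refine ⟨tmap (R × K) A r s w, ?_⟩
      change _ = D w
      rw [hD, SmoothNear.tmap_comp h3 h2]
      rfl
    -- As `p ∘ D` is the first projection, `p` maps the range of `D` onto `R`. By constancy of the
    -- rank this range is no larger than `R`, so `p` is injective on it; and `p` kills `D (0, z)`.
    let pD : LinearMap.range (D : R × K →ₗ[ℝ] B) →ₗ[ℝ] R :=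
      (p : B →ₗ[ℝ] R) ∘ₗ (LinearMap.range (D : R × K →ₗ[ℝ] B)).subtype
    have hsurj : Function.Surjective pD := fun t => ⟨⟨D (t, 0), ⟨(t, 0), rfl⟩⟩, hpD (t, 0)⟩
    have hle : finrank ℝ (LinearMap.range (D : R × K →ₗ[ℝ] B)) ≤ finrank ℝ R := by
      refine (Submodule.finrank_mono hDr).trans ?_
      exact h4.le
    have hge : finrank ℝ R ≤ finrank ℝ (LinearMap.range (D : R × K →ₗ[ℝ] B)) :=
      LinearMap.finrank_le_finrank_of_surjective hsurj
    have hinj' : Function.Injective pD :=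
      (LinearMap.injective_iff_surjective_of_finrank_eq_finrank (le_antisymm hle hge)).2 hsurj
    have h7 : (⟨D (0, z), ⟨(0, z), rfl⟩⟩ : LinearMap.range (D : R × K →ₗ[ℝ] B)) = 0 := by
      apply hinj'
      rw [map_zero]
      exact hpD (0, z)
    exact congrArg Subtype.val h7
  set z₀ : K := (φ a).2 with hz₀
  have hconst : ∀ᶠ s in 𝓝 (φ a), o (r (s.1, s.2)) = o (r (s.1, z₀)) := by
    obtain ⟨ε, hε, hball⟩ := Metric.eventually_nhds_iff_ball.1 (hor.eventually.and hvan)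
    filter_upwards [Metric.ball_mem_nhds (φ a) hε] with s hs
    rw [← ball_prod_same] at hs
    have hmem : ∀ z ∈ Metric.ball z₀ ε, (s.1, z) ∈ Metric.ball (φ a) ε := fun z hz => by
      rw [← ball_prod_same]; exact ⟨hs.1, hz⟩
    have hder : ∀ z ∈ Metric.ball z₀ ε, HasFDerivAt (fun z => o (r (s.1, z))) (0 : K →L[ℝ] B) z := by
      intro z hz
      have h1 := hball _ (hmem z hz)
      have h2 : HasFDerivAt (fun z : K => (s.1, z)) (ContinuousLinearMap.inr ℝ R K) z :=
        hasFDerivAt_prodMk_right s.1 z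
      have h3 := (hasFDerivAt_of_smoothNear h1.1).comp z h2
      have h4 : (tmap (R × K) B (o ∘ r) (s.1, z)).comp (ContinuousLinearMap.inr ℝ R K) = 0 :=
        ContinuousLinearMap.ext h1.2
      rwa [h4] at h3
    refine (convex_ball z₀ ε).is_const_of_fderivWithin_eq_zero (𝕜 := ℝ)
      (f := fun z => o (r (s.1, z)))
      (fun z hz => (hder z hz).differentiableAt.differentiableWithinAt) (fun z hz => ?_) hs.2
      (Metric.mem_ball_self hε)
    rw [fderivWithin_of_isOpen Metric.isOpen_ball hz]
    exact (hder z hz).fderiv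
  let k : B → R × K := fun y => (p y, z₀)
  have hk : ContDiff ℝ ∞ k := p.contDiff.prodMk contDiff_const
  have hka : k (o a) = φ a := rfl
  have hork : SmoothNear B B (o ∘ r ∘ k) (o a) :=
    SmoothNear.comp (M₁ := B) (M₂ := R × K) (M₃ := B) (g := o ∘ r) hor (smoothNear_of_contDiff hk _)
  have htk : tmap B (R × K) k (o a) = p.prod 0 := by
    rw [tmap_eq_fderiv]
    exact (p.hasFDerivAt.prodMk (hasFDerivAt_const z₀ (o a))).fderiv
  have hlork : SmoothNear B W (l ∘ (o ∘ r ∘ k)) (o a) :=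
    (smoothNear_of_contDiff l.contDiff _).comp hork
  -- Near `o a` the image consists of the `y` with `y = o (r (k y))`. Both sides always have the
  -- same image under `p`, and `p` is the identity on `R`, the kernel of `l`; so only the
  -- `l`-component of the equation is needed.
  let c : B → W := fun y => l y - (l ∘ (o ∘ r ∘ k)) y
  have hc : SmoothNear B W c (o a) := by
    filter_upwards [hlork] with y hy
    exact (smoothNear_of_contDiff l.contDiff y).contMDiffAt.sub hy
  have htc : ∀ v, p v = 0 → tmap B W c (o a) v = l v := by
    intro v hv
    have h1 : tmap B W c (o a) = tmap B W l (o a) - tmap B W (l ∘ (o ∘ r ∘ k)) (o a) := by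
      simp only [tmap_eq_fderiv]
      exact fderiv_sub l.differentiableAt (hlork.contDiffAt.differentiableAt (by simp))
    have h2 : tmap B W (l ∘ (o ∘ r ∘ k)) (o a) v = 0 := by
      rw [SmoothNear.tmap_comp (smoothNear_of_contDiff l.contDiff _) hork]
      have h3 : tmap B B (o ∘ r ∘ k) (o a) =
          (tmap (R × K) B (o ∘ r) (k (o a))).comp (tmap B (R × K) k (o a)) :=
        SmoothNear.tmap_comp (M₁ := B) (M₂ := R × K) (M₃ := B) (g := o ∘ r) hor
          (smoothNear_of_contDiff hk _)
      rw [h3, htk]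
      have : (p.prod (0 : B →L[ℝ] K)) v = 0 := by simp [hv]
      simp [this]
    rw [h1, sub_apply, h2, tmap_clm, sub_zero]
  refine ⟨c, hc, fun n => ?_, ?_, ?_⟩
  · obtain ⟨y, hy⟩ := hl n
    -- On the kernel of `p` the correction term in `c` has zero derivative, so `c` has derivative
    -- `l` there.
    refine ⟨y - p y, ?_⟩
    rw [htc _ (by rw [map_sub, hp, sub_self]), map_sub, (hlR _).2 (p y).2, sub_zero, hy]
  · filter_upwards [hφ.continuousAt.tendsto.eventually hconst, hr1] with h h1 h2
    have h3 : o (r (p (o h), z₀)) = o h := by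
      have : (((φ h).1, (φ h).2) : R × K) = φ h := rfl
      rw [this, h2] at h1
      exact h1.symm
    change l (o h) - l (o (r (p (o h), z₀))) = 0
    rw [h3, sub_self]
  · have hkt : Tendsto k (𝓝 (o a)) (𝓝 (φ a)) := hk.continuous.tendsto (o a)
    filter_upwards [hkt.eventually hpor, hkt.eventually (hrt.eventually hO)] with y h1 hyO hy
    refine ⟨r (k y), hyO, ?_⟩
    have h2 : l (y - o (r (k y))) = 0 := by rw [map_sub]; exact hy
    have h3 := hp ⟨_, (hlR _).1 h2⟩
    have h4 : p (y - o (r (k y))) = 0 := by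
      rw [map_sub, h1, sub_self]
    rw [h4] at h3
    exact (sub_eq_zero.1 (congrArg Subtype.val h3).symm).symm

variable {M₁ M₂ : Type*} [TopologicalSpace M₁] [ChartedSpace A M₁] [IsManifold 𝓘(ℝ, A) ∞ M₁]
  [TopologicalSpace M₂] [ChartedSpace B M₂] [IsManifold 𝓘(ℝ, B) ∞ M₂]

lemma tmap_extChartAt_bijective (x : M₁) :
    ∀ᶠ y in 𝓝 x, Function.Bijective (tmap A A (extChartAt 𝓘(ℝ, A) x) y) := by
  have hφ := smoothNear_extChartAt (E₁ := A) x
  have hφs := smoothNear_extChartAt_symm (E₁ := A) x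
  filter_upwards [hφ.eventually, hφ.continuousAt.eventually hφs.eventually,
    (extChartAt_symm_extChartAt_eventually (E₁ := A) x).eventually_nhds] with y h1 h2 h3
  have h4 := tmap_comp_eq_id h1 h2 h3
  have hinj : Function.Injective (tmap A A (extChartAt 𝓘(ℝ, A) x) y) :=
    Function.LeftInverse.injective (g := tmap A A (extChartAt 𝓘(ℝ, A) x).symm
      (extChartAt 𝓘(ℝ, A) x y)) fun v => DFunLike.congr_fun h4 v
  exact ⟨hinj, LinearMap.injective_iff_surjective.1 hinj⟩

lemma tmap_extChartAt_symm_bijective (x : M₁) :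
    ∀ᶠ y in 𝓝 (extChartAt 𝓘(ℝ, A) x x),
      Function.Bijective (tmap A A (extChartAt 𝓘(ℝ, A) x).symm y) := by
  have hφ := smoothNear_extChartAt (E₁ := A) x
  have hφs := smoothNear_extChartAt_symm (E₁ := A) x
  have ht := tendsto_extChartAt_symm (E₁ := A) x
  filter_upwards [hφs.eventually, ht.eventually hφ.eventually,
    (extChartAt_extChartAt_symm_eventually (E₁ := A) x).eventually_nhds] with y h1 h2 h3
  have h4 := tmap_comp_eq_id h1 h2 h3
  have hinj : Function.Injective (tmap A A (extChartAt 𝓘(ℝ, A) x).symm y) :=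
    Function.LeftInverse.injective fun v => DFunLike.congr_fun h4 v
  exact ⟨hinj, LinearMap.injective_iff_surjective.1 hinj⟩

lemma lrank_comp_bijective {A' B' : Type*} [NormedAddCommGroup A'] [NormedSpace ℝ A']
    [NormedAddCommGroup B'] [NormedSpace ℝ B'] {f : A' →L[ℝ] A} {g : B →L[ℝ] B'}
    (hf : Function.Surjective f) (hg : Function.Injective g) (L : A →L[ℝ] B) :
    lrank (g.comp (L.comp f)) = lrank L := by
  unfold lrank
  have : LinearMap.range ((g.comp (L.comp f) : A' →L[ℝ] B') : A' →ₗ[ℝ] B') =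
      (LinearMap.range (L : A →ₗ[ℝ] B)).map (g : B →ₗ[ℝ] B') := by
    ext y
    simp only [LinearMap.mem_range, Submodule.mem_map]
    constructor
    · rintro ⟨x, rfl⟩
      exact ⟨_, ⟨f x, rfl⟩, rfl⟩
    · rintro ⟨_, ⟨x, rfl⟩, rfl⟩
      obtain ⟨x, rfl⟩ := hf x
      exact ⟨x, rfl⟩
  rw [this]
  exact LinearEquiv.finrank_eq (Submodule.equivMapOfInjective (g : B →ₗ[ℝ] B') hg _).symm

/-- A map of constant rank between manifolds has its image locally given by equations. -/
theorem exists_equations {o : M₁ → M₂} {a : M₁} (ho : SmoothNear A B o a)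
    (hrank : ∀ᶠ h in 𝓝 a, lrank (tmap A B o h) = lrank (tmap A B o a)) :
    ∃ c : M₂ → EuclideanSpace ℝ (Fin (finrank ℝ B - lrank (tmap A B o a))),
      SmoothNear B (EuclideanSpace ℝ (Fin (finrank ℝ B - lrank (tmap A B o a)))) c (o a) ∧
      Function.Surjective
        (tmap B (EuclideanSpace ℝ (Fin (finrank ℝ B - lrank (tmap A B o a)))) c (o a)) ∧
      (∀ᶠ h in 𝓝 a, c (o h) = 0) ∧ ∀ᶠ y in 𝓝 (o a), c y = 0 → ∃ h, o h = y := by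
  set φ := extChartAt 𝓘(ℝ, A) a with hφdef
  set ψ := extChartAt 𝓘(ℝ, B) (o a) with hψdef
  have hφ : SmoothNear A A φ a := smoothNear_extChartAt a
  have hψ : SmoothNear B B ψ (o a) := smoothNear_extChartAt (o a)
  have hφs : SmoothNear A A φ.symm (φ a) := smoothNear_extChartAt_symm a
  have hφa : φ.symm (φ a) = a := extChartAt_to_inv a
  have hφt : Tendsto φ.symm (𝓝 (φ a)) (𝓝 a) := tendsto_extChartAt_symm a
  have h1 : SmoothNear A B (o ∘ φ.symm) (φ a) := ho.comp_extChartAt_symm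
  have h2 : SmoothNear A B (ψ ∘ (o ∘ φ.symm)) (φ a) :=
    SmoothNear.comp (by simpa [hφa] using hψ) h1
  have hrk : ∀ᶠ h in 𝓝 (φ a), lrank (tmap A B (ψ ∘ (o ∘ φ.symm)) h) =
      lrank (tmap A B o (φ.symm h)) := by
    have hot : Tendsto (fun h => o (φ.symm h)) (𝓝 (φ a)) (𝓝 (o a)) :=
      ho.continuousAt.tendsto.comp hφt
    filter_upwards [hφs.eventually, hφt.eventually ho.eventually, hot.eventually hψ.eventually,
      hot.eventually (tmap_extChartAt_bijective (A := B) (o a)),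
      tmap_extChartAt_symm_bijective (A := A) a]
      with h k1 k2 k3 k4 k5
    rw [SmoothNear.tmap_comp (M₂ := M₂) (f := o ∘ φ.symm) k3 (k2.comp k1),
      SmoothNear.tmap_comp (M₂ := M₁) k2 k1]
    exact lrank_comp_bijective k5.2 k4.1 _
  have hrka : lrank (tmap A B (ψ ∘ (o ∘ φ.symm)) (φ a)) = lrank (tmap A B o a) := by
    rw [hrk.self_of_nhds, hφa]
  have hval : (ψ ∘ (o ∘ φ.symm)) (φ a) = ψ (o a) := by simp [hφa]
  -- The neighbourhood `O` keeps the values of `o` inside the domain of the chart `ψ`, where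
  -- equality of coordinates implies equality of points.
  have key := exists_equations_vector h2 (by
    filter_upwards [hrk, hφt.eventually hrank] with h k1 k2
    rw [k1, hrka, k2]) (O := φ.symm ⁻¹' (o ⁻¹' (extChartAt 𝓘(ℝ, B) (o a)).source))
      ((ho.continuousAt.tendsto.comp hφt) (extChartAt_source_mem_nhds (I := 𝓘(ℝ, B)) (o a)))
  rw [hrka, hval] at key
  obtain ⟨c, hc, hcs, hc1, hc2⟩ := key
  refine ⟨c ∘ ψ, hc.comp hψ, ?_, ?_, ?_⟩
  · rw [SmoothNear.tmap_comp hc hψ, tmap_extChartAt_self]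
    simpa using hcs
  · filter_upwards [hφ.continuousAt.tendsto.eventually hc1,
      extChartAt_symm_extChartAt_eventually (E₁ := A) a] with h k1 k2
    simp only [Function.comp_apply] at k1 ⊢
    rwa [k2] at k1
  · filter_upwards [hψ.continuousAt.tendsto.eventually hc2,
      extChartAt_source_mem_nhds (I := 𝓘(ℝ, B)) (o a)] with y k1 k2 k3
    obtain ⟨h, k5, k4⟩ := k1 k3
    exact ⟨φ.symm h, ψ.injOn k5 k2 k4⟩

end ConstantRank

/-! ### The Leibniz rule for a smooth map of two variables -/

section Binary

variable {E E₁ E₂ E₃ : Type*} [NormedAddCommGroup E] [NormedSpace ℝ E]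
  [NormedAddCommGroup E₁] [NormedSpace ℝ E₁] [NormedAddCommGroup E₂] [NormedSpace ℝ E₂]
  [NormedAddCommGroup E₃] [NormedSpace ℝ E₃]
  {M M₁ M₂ M₃ : Type*} [TopologicalSpace M] [ChartedSpace E M]
  [TopologicalSpace M₁] [ChartedSpace E₁ M₁] [TopologicalSpace M₂] [ChartedSpace E₂ M₂]
  [TopologicalSpace M₃] [ChartedSpace E₃ M₃]

lemma tmap_binary {μ : M₁ × M₂ → M₃}
    (hμ : ContMDiff (𝓘(ℝ, E₁).prod 𝓘(ℝ, E₂)) 𝓘(ℝ, E₃) ∞ μ) {f : M → M₁} {g : M → M₂} {x : M}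
    (hf : SmoothNear E E₁ f x) (hg : SmoothNear E E₂ g x) (v : E) :
    tmap E E₃ (fun y => μ (f y, g y)) x v =
      tmap E₁ E₃ (fun a => μ (a, g x)) (f x) (tmap E E₁ f x v) +
      tmap E₂ E₃ (fun b => μ (f x, b)) (g x) (tmap E E₂ g x v) := by
  have hμd : MDifferentiableAt (𝓘(ℝ, E₁).prod 𝓘(ℝ, E₂)) 𝓘(ℝ, E₃) μ (f x, g x) :=
    (hμ _).mdifferentiableAt (by simp)
  have h1 := mfderiv_comp (I := 𝓘(ℝ, E)) (I' := 𝓘(ℝ, E₁).prod 𝓘(ℝ, E₂)) (I'' := 𝓘(ℝ, E₃))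
    (g := μ) (f := fun y => (f y, g y)) x hμd
    (hf.mdifferentiableAt.prodMk hg.mdifferentiableAt)
  have h2 := mfderiv_prodMk hf.mdifferentiableAt hg.mdifferentiableAt
  have h3 : tmap E E₃ (fun y => μ (f y, g y)) x v =
      (mfderiv (𝓘(ℝ, E₁).prod 𝓘(ℝ, E₂)) 𝓘(ℝ, E₃) μ (f x, g x))
        (mfderiv 𝓘(ℝ, E) (𝓘(ℝ, E₁).prod 𝓘(ℝ, E₂)) (fun y => (f y, g y)) x v) :=
    DFunLike.congr_fun h1 v
  rw [h3, h2]
  exact mfderiv_prod_eq_add_apply (I := 𝓘(ℝ, E₁)) (I' := 𝓘(ℝ, E₂)) (I'' := 𝓘(ℝ, E₃))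
    (p := (f x, g x)) (v := (tmap E E₁ f x v, tmap E E₂ g x v)) hμd

end Binary

/-! ### Translations, conjugacy classes and infinitesimal actions of a Lie group -/

section Action

variable {F : Type*} [NormedAddCommGroup F] [NormedSpace ℝ F] [FiniteDimensional ℝ F]
  {G : Type*} [TopologicalSpace G] [ChartedSpace F G] [Group G] [LieGroup 𝓘(ℝ, F) ∞ G]

lemma smoothNear_mul_left (g x : G) : SmoothNear F F (fun y : G => g * y) x :=
  smoothNear_of_contMDiff contMDiff_mul_left x

lemma smoothNear_mul_right (g x : G) : SmoothNear F F (fun y : G => y * g) x :=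
  smoothNear_of_contMDiff contMDiff_mul_right x

lemma bijective_of_comp_id {E₁ E₂ : Type*} [NormedAddCommGroup E₁] [NormedSpace ℝ E₁]
    [NormedAddCommGroup E₂] [NormedSpace ℝ E₂] {A : E₁ →L[ℝ] E₂} {B : E₂ →L[ℝ] E₁}
    (h1 : B.comp A = ContinuousLinearMap.id ℝ E₁) (h2 : A.comp B = ContinuousLinearMap.id ℝ E₂) :
    Function.Bijective A :=
  ⟨Function.LeftInverse.injective fun v => DFunLike.congr_fun h1 v,
    Function.RightInverse.surjective fun v => DFunLike.congr_fun h2 v⟩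

lemma tmap_bijective_of_inverse {E₁ E₂ : Type*} [NormedAddCommGroup E₁] [NormedSpace ℝ E₁]
    [NormedAddCommGroup E₂] [NormedSpace ℝ E₂] {M₁ M₂ : Type*} [TopologicalSpace M₁]
    [ChartedSpace E₁ M₁] [TopologicalSpace M₂] [ChartedSpace E₂ M₂] {f : M₁ → M₂} {r : M₂ → M₁}
    {x : M₁} (hf : SmoothNear E₁ E₂ f x) (hr : SmoothNear E₂ E₁ r (f x))
    (h1 : ∀ᶠ y in 𝓝 x, r (f y) = y) (h2 : ∀ᶠ z in 𝓝 (f x), f (r z) = z) :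
    Function.Bijective (tmap E₁ E₂ f x) := by
  have hrx : r (f x) = x := h1.self_of_nhds
  have h3 := tmap_comp_eq_id hf hr h1
  have h4 := tmap_comp_eq_id hr (by rwa [hrx]) h2
  rw [hrx] at h4
  exact bijective_of_comp_id h3 h4

lemma tmap_mul_left_bijective (g x : G) :
    Function.Bijective (tmap F F (fun y : G => g * y) x) :=
  tmap_bijective_of_inverse (smoothNear_mul_left g x) (smoothNear_mul_left g⁻¹ (g * x))
    (Eventually.of_forall fun y => inv_mul_cancel_left g y)
    (Eventually.of_forall fun y => mul_inv_cancel_left g y)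

lemma tmap_mul_right_bijective (g x : G) :
    Function.Bijective (tmap F F (fun y : G => y * g) x) :=
  tmap_bijective_of_inverse (smoothNear_mul_right g x) (smoothNear_mul_right g⁻¹ (x * g))
    (Eventually.of_forall fun y => mul_inv_cancel_right y g)
    (Eventually.of_forall fun y => inv_mul_cancel_right y g)

/-! ### Conjugacy classes -/

lemma contMDiff_conj (g : G) : ContMDiff 𝓘(ℝ, F) 𝓘(ℝ, F) ∞ (fun x : G => g * x * g⁻¹) :=
  (contMDiff_const.mul contMDiff_id).mul contMDiff_const

lemma contMDiff_conj_orbit (x : G) : ContMDiff 𝓘(ℝ, F) 𝓘(ℝ, F) ∞ (fun g : G => g * x * g⁻¹) :=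
  (contMDiff_id.mul contMDiff_const).mul (contMDiff_id.inv)

lemma tmap_conj_bijective (g x : G) :
    Function.Bijective (tmap F F (fun y : G => g * y * g⁻¹) x) :=
  tmap_bijective_of_inverse (r := fun y : G => g⁻¹ * y * g)
    (smoothNear_of_contMDiff (contMDiff_conj g) x)
    (by simpa using smoothNear_of_contMDiff (contMDiff_conj g⁻¹) (g * x * g⁻¹))
    (Eventually.of_forall fun y => by group) (Eventually.of_forall fun y => by group)

/-- The derivative of `g ↦ g x g⁻¹` at the identity is `ξ ↦ ξ^R - ξ^L`. -/
lemma tmap_conj_orbit_one (x : G) (ξ : F) :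
    tmap F F (fun g : G => g * x * g⁻¹) 1 ξ + tmap F F (fun y : G => x * y) 1 ξ =
      tmap F F (fun y : G => y * x) 1 ξ := by
  -- Differentiating `(g x g⁻¹) g = g x` at `g = 1` avoids the derivative of the inversion.
  have h := tmap_binary (contMDiff_mul 𝓘(ℝ, F) ∞ (G := G))
    (smoothNear_of_contMDiff (contMDiff_conj_orbit x) (1 : G)) (smoothNear_id (E₁ := F) (1 : G)) ξ
  have e1 : (fun y : G => (y * x * y⁻¹) * y) = fun y => y * x := by
    funext y; group
  rw [e1] at h
  rw [h]
  have e2 : (fun a : G => a * 1) = fun a => a := by funext a; simp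
  rw [e2, tmap_id, tmap_id]
  simp

/-- The orbit map intertwines the left translation by `h` with the conjugation by `h`, and both are
diffeomorphisms. -/
lemma lrank_conj_orbit (x h : G) :
    lrank (tmap F F (fun g : G => g * x * g⁻¹) h) =
      lrank (tmap F F (fun g : G => g * x * g⁻¹) 1) := by
  have e : (fun g : G => g * x * g⁻¹) =
      (fun y : G => h * y * h⁻¹) ∘ ((fun g : G => g * x * g⁻¹) ∘ fun g : G => h⁻¹ * g) := by
    funext g; simp only [Function.comp_apply]; group
  have h1 := smoothNear_mul_left (F := F) h⁻¹ h
  have h2 : SmoothNear F F (fun g : G => g * x * g⁻¹) (h⁻¹ * h) :=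
    smoothNear_of_contMDiff (contMDiff_conj_orbit x) _
  conv_lhs => rw [e]
  rw [SmoothNear.tmap_comp (smoothNear_of_contMDiff (contMDiff_conj h) _)
    (SmoothNear.comp (M₂ := G) h2 h1), SmoothNear.tmap_comp (M₂ := G) h2 h1,
    lrank_comp_bijective (tmap_mul_left_bijective _ _).2 (tmap_conj_bijective _ _).1]
  simp

/-- Conjugation by `k` carries the orbit map of `x` to that of its conjugate. It follows that the
number of equations is the same at all points of a conjugacy class. -/
lemma lrank_conj_orbit_conj (x k : G) :
    lrank (tmap F F (fun g : G => g * (k * x * k⁻¹) * g⁻¹) 1) =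
      lrank (tmap F F (fun g : G => g * x * g⁻¹) 1) := by
  have e : (fun g : G => g * (k * x * k⁻¹) * g⁻¹) =
      (fun y : G => k * y * k⁻¹) ∘ ((fun g : G => g * x * g⁻¹) ∘ fun g : G => k⁻¹ * g * k⁻¹⁻¹) := by
    funext g; simp only [Function.comp_apply]; group
  have h1 : SmoothNear F F (fun g : G => k⁻¹ * g * k⁻¹⁻¹) 1 :=
    smoothNear_of_contMDiff (contMDiff_conj k⁻¹) _
  have h2 : SmoothNear F F (fun g : G => g * x * g⁻¹) (k⁻¹ * 1 * k⁻¹⁻¹) :=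
    smoothNear_of_contMDiff (contMDiff_conj_orbit x) _
  rw [e, SmoothNear.tmap_comp (smoothNear_of_contMDiff (contMDiff_conj k) _)
    (SmoothNear.comp (M₂ := G) (f := fun g : G => k⁻¹ * g * k⁻¹⁻¹) h2 h1),
    SmoothNear.tmap_comp (M₂ := G) (f := fun g : G => k⁻¹ * g * k⁻¹⁻¹) h2 h1,
    lrank_comp_bijective (tmap_conj_bijective _ _).2 (tmap_conj_bijective _ _).1]
  simp

/-- A conjugacy class of a compact Lie group is a submanifold. -/
theorem exists_conj_equations [CompactSpace G] [T2Space G] (C : ConjClasses G) :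
    ∃ d : ℕ, ∀ x ∈ C.carrier, ∃ c : G → EuclideanSpace ℝ (Fin d),
      SmoothNear F (EuclideanSpace ℝ (Fin d)) c x ∧
      Function.Surjective (tmap F (EuclideanSpace ℝ (Fin d)) c x) ∧
      ∀ᶠ y in 𝓝 x, (y ∈ C.carrier ↔ c y = 0) := by
  obtain ⟨x₀, rfl⟩ := ConjClasses.exists_rep C
  refine ⟨finrank ℝ F - lrank (tmap F F (fun g : G => g * x₀ * g⁻¹) 1), fun x hx => ?_⟩
  have hx' : IsConj x₀ x := by
    rw [ConjClasses.mem_carrier_iff_mk_eq] at hx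
    exact ConjClasses.mk_eq_mk_iff_isConj.1 hx.symm
  obtain ⟨k, rfl⟩ := isConj_iff.1 hx'
  set x := k * x₀ * k⁻¹ with hxdef
  have hxC : ∀ y, y ∈ (ConjClasses.mk x₀).carrier ↔ ∃ g, g * x * g⁻¹ = y := fun y => by
    rw [ConjClasses.mem_carrier_iff_mk_eq] at hx ⊢
    rw [← hx, ConjClasses.mk_eq_mk_iff_isConj, isConj_comm, isConj_iff]
  have ho := smoothNear_of_contMDiff (contMDiff_conj_orbit (F := F) x) 1
  have key := exists_equations ho (Eventually.of_forall (lrank_conj_orbit x))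
  have e1 : (1 : G) * x * 1⁻¹ = x := by simp
  rw [e1, lrank_conj_orbit_conj] at key
  obtain ⟨c, hc, hcs, h1, h2⟩ := key
  refine ⟨c, hc, hcs, ?_⟩
  have : IsTopologicalGroup G := topologicalGroup_of_lieGroup 𝓘(ℝ, F) ∞
  -- The constant rank theorem only controls the conjugates of `x` by elements near 1; compactness
  -- of `G` shows that no other part of the class comes near `x`. An element near a `g₀` that
  -- commutes with `x` can be replaced by its product with `g₀⁻¹`, which is near 1; an element near
  -- any other `g₀` moves `x` away from itself.
  have h3 : ∀ᶠ y in 𝓝 x, ∀ g ∈ (Set.univ : Set G), g * x * g⁻¹ = y → c y = 0 := by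
    refine isCompact_univ.eventually_forall_of_forall_eventually fun g₀ _ => ?_
    by_cases hg : g₀ * x * g₀⁻¹ = x
    · have ht : Tendsto (fun z : G × G => z.2 * g₀⁻¹) (𝓝 (x, g₀)) (𝓝 1) := by
        have : Continuous fun z : G × G => z.2 * g₀⁻¹ := by fun_prop
        simpa using this.tendsto (x, g₀)
      filter_upwards [ht.eventually h1] with z hz hzy
      rw [← hzy]
      convert hz using 2
      have : x = g₀⁻¹ * x * g₀ := by
        nth_rewrite 2 [← hg]; group
      nth_rewrite 1 [this]
      group
    · have hcont : Continuous fun z : G × G => z.2 * x * z.2⁻¹ := by fun_prop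
      have : ∀ᶠ z : G × G in 𝓝 (x, g₀), z.2 * x * z.2⁻¹ ≠ z.1 :=
        (isClosed_eq hcont continuous_fst).isOpen_compl.mem_nhds hg
      filter_upwards [this] with z hz hz'
      exact absurd hz' hz
  filter_upwards [h2, h3] with y k1 k2
  rw [hxC]
  exact ⟨fun ⟨g, hg⟩ => k2 g trivial hg, k1⟩

/-! ### Smooth actions -/

variable {E : Type*} [NormedAddCommGroup E] [NormedSpace ℝ E] [FiniteDimensional ℝ E]
  {M : Type*} [TopologicalSpace M] [ChartedSpace E M] [IsManifold 𝓘(ℝ, E) ∞ M]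
  [MulAction G M] [ContMDiffSMul 𝓘(ℝ, F) 𝓘(ℝ, E) ∞ G M]

lemma contMDiff_orbitMap (F E : Type*) [NormedAddCommGroup F] [NormedSpace ℝ F]
    {G : Type*} [TopologicalSpace G] [ChartedSpace F G] [Group G]
    [NormedAddCommGroup E] [NormedSpace ℝ E]
    {M : Type*} [TopologicalSpace M] [ChartedSpace E M]
    [MulAction G M] [ContMDiffSMul 𝓘(ℝ, F) 𝓘(ℝ, E) ∞ G M] (m : M) :
    ContMDiff 𝓘(ℝ, F) 𝓘(ℝ, E) ∞ (fun g : G => g • m) :=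
  ContMDiff.smul contMDiff_id contMDiff_const

lemma contMDiff_smul_const (F E : Type*) [NormedAddCommGroup F] [NormedSpace ℝ F]
    {G : Type*} [TopologicalSpace G] [ChartedSpace F G] [Group G]
    [NormedAddCommGroup E] [NormedSpace ℝ E]
    {M : Type*} [TopologicalSpace M] [ChartedSpace E M]
    [MulAction G M] [ContMDiffSMul 𝓘(ℝ, F) 𝓘(ℝ, E) ∞ G M] (g : G) :
    ContMDiff 𝓘(ℝ, E) 𝓘(ℝ, E) ∞ (fun m : M => g • m) :=
  ContMDiffSMul.contMDiff_const_smul (I := 𝓘(ℝ, F)) g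

/-- The infinitesimal action at `m`. -/
def orb (F E : Type*) [NormedAddCommGroup F] [NormedSpace ℝ F]
    (G : Type*) [TopologicalSpace G] [ChartedSpace F G] [Group G]
    [NormedAddCommGroup E] [NormedSpace ℝ E]
    {M : Type*} [TopologicalSpace M] [ChartedSpace E M] [MulAction G M] (m : M) : F →L[ℝ] E :=
  tmap F E (fun g : G => g • m) 1

/-- The derivative of the orbit map at `g`, in terms of left-invariant vector fields. -/
lemma tmap_orbit_mul_left (g : G) (m : M) (ξ : F) :
    tmap F E (fun h : G => h • m) g (tmap F F (fun y : G => g * y) 1 ξ) =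
      tmap E E (fun x : M => g • x) m (orb F E G m ξ) := by
  have h1 := SmoothNear.tmap_comp (E₁ := F) (E₂ := F) (E₃ := E) (g := fun h : G => h • m)
    (f := fun y : G => g * y) (x := 1)
    (smoothNear_of_contMDiff (contMDiff_orbitMap F E m) _) (smoothNear_mul_left g 1)
  have h2 := SmoothNear.tmap_comp (E₁ := F) (E₂ := E) (E₃ := E) (g := fun x : M => g • x)
    (f := fun y : G => y • m) (x := 1)
    (smoothNear_of_contMDiff (contMDiff_smul_const F E g) _)
    (smoothNear_of_contMDiff (contMDiff_orbitMap F E m) _)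
  have e : (fun h : G => h • m) ∘ (fun y : G => g * y) =
      (fun x : M => g • x) ∘ fun y : G => y • m := by
    funext y; simp [mul_smul]
  rw [e, h2] at h1
  have := DFunLike.congr_fun h1 ξ
  simp only [ContinuousLinearMap.comp_apply, mul_one, one_smul] at this
  exact this.symm

/-- Orbits of locally constant functions: the derivative vanishes in the orbit directions. -/
lemma tmap_orb_eq_zero {E₂ : Type*} [NormedAddCommGroup E₂] [NormedSpace ℝ E₂]
    {X : Type*} [TopologicalSpace X] [ChartedSpace E₂ X] {f : M → X} {m : M}
    (hf : SmoothNear E E₂ f m) (h : ∀ᶠ g in 𝓝 (1 : G), f (g • m) = f m) (ξ : F) :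
    tmap E E₂ f m (orb F E G m ξ) = 0 := by
  have hf1 : SmoothNear E E₂ f ((1 : G) • m) := by rwa [one_smul]
  have h1 := SmoothNear.tmap_comp (E₁ := F) (E₂ := E) (E₃ := E₂) (g := f)
    (f := fun y : G => y • m) (x := 1) hf1 (smoothNear_of_contMDiff (contMDiff_orbitMap F E m) _)
  have h2 : tmap F E₂ (f ∘ fun y : G => y • m) 1 = 0 :=
    tmap_eq_zero_of_eventuallyEq (c := f m) h
  rw [one_smul, h2] at h1
  exact (DFunLike.congr_fun h1 ξ).symm

/-- The action is infinitesimally free at the points with finite stabilizer. -/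
theorem orb_injective [T2Space G] {m : M} (hm : Finite (MulAction.stabilizer G m)) :
    Function.Injective (orb F E G m) := by
  have : CompleteSpace F := FiniteDimensional.complete ℝ F
  rw [injective_iff_map_eq_zero]
  intro ξ hξ
  have : LieGroup 𝓘(ℝ, F) (minSmoothness ℝ 3) G := by
    rw [minSmoothness_of_isRCLikeNormedField]; infer_instance
  -- An integral curve of the left-invariant field plays the role of `exp(tξ)`. The velocity of `γ t
  -- • m` is the image of `orb F E G m ξ = 0` under the action of `γ t`, so it vanishes.
  let ξ' : GroupLieAlgebra 𝓘(ℝ, F) G := ξ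
  have hv : ContMDiffAt 𝓘(ℝ, F) 𝓘(ℝ, F).tangent 1
      (fun g : G => (⟨g, mulInvariantVectorField ξ' g⟩ : TangentBundle 𝓘(ℝ, F) G)) 1 :=
    (contMDiffAt_mulInvariantVectorField ξ').of_le (by
      rw [minSmoothness_of_isRCLikeNormedField]; exact one_le_two)
  have : IsManifold 𝓘(ℝ, F) 1 G := IsManifold.of_le (n := ∞) (by simp)
  obtain ⟨γ, hγ0, hγ⟩ := exists_isMIntegralCurveAt_of_contMDiffAt_boundaryless 0 hv
  have hγc : ContinuousAt γ 0 := hγ.self_of_nhds.continuousAt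
  have hγt : Tendsto γ (𝓝 0) (𝓝 1) := by rwa [ContinuousAt, hγ0] at hγc
  -- the curve stays in the stabilizer
  set φ := extChartAt 𝓘(ℝ, E) m
  have hom : Tendsto (fun t => γ t • m) (𝓝 0) (𝓝 m) := by
    have h := (contMDiff_orbitMap F E (G := G) m).continuous.tendsto 1
    simp only [one_smul] at h
    exact h.comp hγt
  have hder : ∀ᶠ t in 𝓝 (0 : ℝ), HasFDerivAt (fun t => φ (γ t • m)) (0 : ℝ →L[ℝ] E) t := by
    filter_upwards [hγ, hom.eventually (smoothNear_extChartAt (E₁ := E) m).eventually] with t h1 h2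
    have h3 : HasMFDerivAt 𝓘(ℝ, ℝ) 𝓘(ℝ, F) γ t (mfderiv 𝓘(ℝ, ℝ) 𝓘(ℝ, F) γ t) :=
      h1.mdifferentiableAt.hasMFDerivAt
    have h4 : tmap ℝ F γ t 1 = tmap F F (fun y : G => γ t * y) 1 ξ := by
      have := h1.mfderiv
      have h5 : tmap ℝ F γ t 1 = (1 : ℝ) • tmap F F (fun y : G => γ t * y) 1 ξ :=
        DFunLike.congr_fun this 1
      rw [h5, one_smul]
    have ho : MDifferentiableAt 𝓘(ℝ, F) 𝓘(ℝ, E) (fun g : G => g • m) (γ t) :=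
      (contMDiff_orbitMap F E m _).mdifferentiableAt (by simp)
    have h6 : MDifferentiableAt 𝓘(ℝ, ℝ) 𝓘(ℝ, E) (fun t => γ t • m) t :=
      ho.comp t h1.mdifferentiableAt
    have h7 : tmap ℝ E (fun t => γ t • m) t 1 = 0 := by
      have h8 : tmap ℝ E (fun t => γ t • m) t =
          (tmap F E (fun g : G => g • m) (γ t)).comp (tmap ℝ F γ t) :=
        tmap_comp ho h1.mdifferentiableAt
      rw [h8, ContinuousLinearMap.comp_apply, h4, tmap_orbit_mul_left, hξ, map_zero]
    have h9 : tmap ℝ E (fun t => φ (γ t • m)) t = 0 := by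
      have h10 : tmap ℝ E (fun t => φ (γ t • m)) t = (tmap E E φ (γ t • m)).comp
          (tmap ℝ E (fun t => γ t • m) t) := tmap_comp h2.mdifferentiableAt h6
      ext
      rw [h10, ContinuousLinearMap.comp_apply, h7, map_zero]
      rfl
    have h11 : MDifferentiableAt 𝓘(ℝ, ℝ) 𝓘(ℝ, E) (fun t => φ (γ t • m)) t :=
      h2.mdifferentiableAt.comp t h6
    rw [← h9, tmap_eq_fderiv]
    exact (mdifferentiableAt_iff_differentiableAt.1 h11).hasFDerivAt
  have hstab : ∀ᶠ t in 𝓝 (0 : ℝ), γ t • m = m := by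
    obtain ⟨ε, hε, hball⟩ := Metric.eventually_nhds_iff_ball.1 hder
    filter_upwards [Metric.ball_mem_nhds (0 : ℝ) hε,
      hom.eventually (extChartAt_source_mem_nhds (I := 𝓘(ℝ, E)) m)] with t ht hts
    have h1 := (convex_ball (0 : ℝ) ε).is_const_of_fderivWithin_eq_zero (𝕜 := ℝ)
      (f := fun t => φ (γ t • m))
      (fun z hz => (hball z hz).differentiableAt.differentiableWithinAt)
      (fun z hz => by
        rw [fderivWithin_of_isOpen Metric.isOpen_ball hz]; exact (hball z hz).fderiv)
      ht (Metric.mem_ball_self hε)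
    simp only [hγ0, one_smul] at h1
    exact φ.injOn hts (mem_extChartAt_source m) h1
  -- In the finite stabilizer the point 1 is isolated.
  have hone : ∀ᶠ t in 𝓝 (0 : ℝ), γ t = 1 := by
    have hfin : ((MulAction.stabilizer G m : Set G) \ {1}).Finite := (Set.toFinite _).subset
      Set.sdiff_subset
    have : ((MulAction.stabilizer G m : Set G) \ {1})ᶜ ∈ 𝓝 (1 : G) :=
      hfin.isClosed.isOpen_compl.mem_nhds (by simp)
    filter_upwards [hstab, hγt.eventually this] with t h1 h2
    by_contra h3
    exact h2 ⟨h1, h3⟩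
  have h1 := hγ.self_of_nhds
  have h2 : tmap ℝ F γ 0 = 0 := tmap_eq_zero_of_eventuallyEq hone
  have h3 : tmap ℝ F γ 0 1 = (1 : ℝ) • tmap F F (fun y : G => γ 0 * y) 1 ξ :=
    DFunLike.congr_fun h1.mfderiv 1
  rw [h2, hγ0, one_smul] at h3
  simp only [one_mul] at h3
  rw [tmap_id] at h3
  exact h3.symm

end Action

/-! ### Brackets of germs, the Jacobi identity for invariant functions, and the rank of the moment
map -/

section LocalBracket

variable {E : Type*} [NormedAddCommGroup E] [NormedSpace ℝ E] [FiniteDimensional ℝ E]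
  {M : Type*} [TopologicalSpace M] [ChartedSpace E M] [IsManifold 𝓘(ℝ, E) ∞ M]

/-- The form of a bivector field, on the dual of the model space. -/
def BivectorField.pair (P : BivectorField E M) (m : M) (α β : E →L[ℝ] ℝ) : ℝ := P.form m α β

lemma BivectorField.bracket_eq_pair (P : BivectorField E M) (f g : M → ℝ) (m : M) :
    P.bracket f g m = P.pair m (tmap E ℝ f m) (tmap E ℝ g m) := rfl

lemma BivectorField.pair_self (P : BivectorField E M) (m : M) (α : E →L[ℝ] ℝ) :
    P.pair m α α = 0 := P.alternating m α

lemma BivectorField.pair_swap (P : BivectorField E M) (m : M) (α β : E →L[ℝ] ℝ) :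
    P.pair m α β = -P.pair m β α :=
  (LinearMap.IsAlt.neg (B := P.form m) (P.alternating m) β α).symm

lemma BivectorField.pair_zero_left (P : BivectorField E M) (m : M) (β : E →L[ℝ] ℝ) :
    P.pair m 0 β = 0 := LinearMap.map_zero₂ (P.form m) _

lemma BivectorField.bracket_congr (P : BivectorField E M) {f f' g g' : M → ℝ} {m : M}
    (hf : f =ᶠ[𝓝 m] f') (hg : g =ᶠ[𝓝 m] g') : P.bracket f g =ᶠ[𝓝 m] P.bracket f' g' := by
  filter_upwards [eventually_eventually_nhds.2 hf, eventually_eventually_nhds.2 hg] with y h1 h2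
  rw [P.bracket_eq_pair, P.bracket_eq_pair, tmap_congr h1, tmap_congr h2]

lemma BivectorField.jacobiator_congr (P : BivectorField E M) {f f' g g' h h' : M → ℝ} {m : M}
    (hf : f =ᶠ[𝓝 m] f') (hg : g =ᶠ[𝓝 m] g') (hh : h =ᶠ[𝓝 m] h') :
    P.jacobiator f g h m = P.jacobiator f' g' h' m := by
  unfold BivectorField.jacobiator
  rw [(P.bracket_congr (P.bracket_congr hf hg) hh).eq_of_nhds,
    (P.bracket_congr (P.bracket_congr hg hh) hf).eq_of_nhds,
    (P.bracket_congr (P.bracket_congr hh hf) hg).eq_of_nhds]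

lemma BivectorField.smoothNear_bracket [T2Space M] (P : BivectorField E M) {f g : M → ℝ} {m : M}
    (hf : SmoothNear E ℝ f m) (hg : SmoothNear E ℝ g m) : SmoothNear E ℝ (P.bracket f g) m := by
  obtain ⟨f', hf', hff⟩ := exists_contMDiff_eventuallyEq hf
  obtain ⟨g', hg', hgg⟩ := exists_contMDiff_eventuallyEq hg
  exact (smoothNear_of_contMDiff (P.smooth f' g' hf' hg') m).congr
    (P.bracket_congr hff.symm hgg.symm)

variable {F : Type*} [NormedAddCommGroup F] [NormedSpace ℝ F] [FiniteDimensional ℝ F]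
  {G : Type*} [TopologicalSpace G] [ChartedSpace F G] [Group G]

/-- Orthonormal bases exist. -/
lemma InvariantInnerProduct.exists_isOrthonormal (κ : InvariantInnerProduct F G) :
    ∃ e : LieBasis F G, κ.IsOrthonormal e := by
  have : FiniteDimensional ℝ (GroupLieAlgebra 𝓘(ℝ, F) G) := inferInstanceAs (FiniteDimensional ℝ F)
  obtain ⟨v, hv⟩ := LinearMap.BilinForm.exists_orthogonal_basis (B := κ.form)
    ⟨fun x y => κ.symm x y⟩
  have hpos : ∀ i, 0 < κ.form (v i) (v i) := fun i => κ.pos _ (v.ne_zero i)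
  have hs : ∀ i, (Real.sqrt (κ.form (v i) (v i)))⁻¹ ≠ 0 := fun i =>
    inv_ne_zero (Real.sqrt_pos.2 (hpos i)).ne'
  suffices h : ∀ a b : Fin (finrank ℝ (GroupLieAlgebra 𝓘(ℝ, F) G)),
      κ.form (v.isUnitSMul (fun i => (hs i).isUnit) a) (v.isUnitSMul (fun i => (hs i).isUnit) b) =
        if a = b then 1 else 0 from ⟨v.isUnitSMul (fun i => (hs i).isUnit), h⟩
  intro a b
  rw [Basis.isUnitSMul_apply, Basis.isUnitSMul_apply]
  simp only [map_smul, LinearMap.smul_apply, smul_eq_mul]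
  split_ifs with h
  · subst h
    have h1 := Real.mul_self_sqrt (hpos a).le
    have h2 := (Real.sqrt_pos.2 (hpos a)).ne'
    field_simp
    rw [sq]; exact h1.symm
  · have : κ.form (v a) (v b) = 0 := hv h
    simp [this]

variable [LieGroup 𝓘(ℝ, F) ∞ G] [MulAction G M] [ContMDiffSMul 𝓘(ℝ, F) 𝓘(ℝ, E) ∞ G M]

/-- The Jacobi identity for functions whose derivative vanishes in the orbit directions. -/
lemma IsHamiltonianQuasiPoisson.jacobiator_eq_zero [T2Space M] {κ : InvariantInnerProduct F G}
    {P : BivectorField E M} {Φ : M → G} (hΦ : IsHamiltonianQuasiPoisson κ P Φ) {f g h : M → ℝ}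
    {m : M} (hf : SmoothNear E ℝ f m) (hg : SmoothNear E ℝ g m) (hh : SmoothNear E ℝ h m)
    (hf0 : ∀ ξ : F, tmap E ℝ f m (orb F E G m ξ) = 0)
    (hg0 : ∀ ξ : F, tmap E ℝ g m (orb F E G m ξ) = 0)
    (hh0 : ∀ ξ : F, tmap E ℝ h m (orb F E G m ξ) = 0) :
    P.jacobiator f g h m = 0 := by
  obtain ⟨f', hf', hff⟩ := exists_contMDiff_eventuallyEq hf
  obtain ⟨g', hg', hgg⟩ := exists_contMDiff_eventuallyEq hg
  obtain ⟨h', hh', hhh⟩ := exists_contMDiff_eventuallyEq hh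
  obtain ⟨e, he⟩ := κ.exists_isOrthonormal
  have key := hΦ.schouten_eq e he f' g' h' hf' hg' hh' m
  have gen : ∀ {u u' : M → ℝ}, u' =ᶠ[𝓝 m] u → (∀ ξ : F, tmap E ℝ u m (orb F E G m ξ) = 0) →
      ∀ a, generatingDeriv (E := E) e a u' m = 0 := by
    intro u u' h1 h2 a
    obtain ⟨ξ, hξ⟩ : ∃ ξ : F, ξ = e a := ⟨_, rfl⟩
    have h3 : generatingDeriv (E := E) e a u' m = tmap E ℝ u' m (-(orb F E G m ξ)) := by
      rw [hξ]; rfl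
    rw [h3, tmap_congr h1, map_neg, h2, neg_zero]
  -- All the entries of the determinants are derivatives in orbit directions, which vanish.
  have hc : cartanTrivector E κ e f' g' h' m = 0 := by
    unfold cartanTrivector
    simp only [gen hff hf0, gen hgg hg0, gen hhh hh0]
    simp [Matrix.det_fin_three]
  rw [hc, BivectorField.schouten] at key
  rw [← P.jacobiator_congr hff hgg hhh]
  linarith

/-- Invariance of the bivector field. -/
lemma IsHamiltonianQuasiPoisson.pair_smul {κ : InvariantInnerProduct F G}
    {P : BivectorField E M} {Φ : M → G} (hΦ : IsHamiltonianQuasiPoisson κ P Φ) (g : G) (m : M)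
    (α β : E →L[ℝ] ℝ) :
    P.pair m (α.comp (tmap E E (fun x : M => g • x) m))
      (β.comp (tmap E E (fun x : M => g • x) m)) = P.pair (g • m) α β :=
  hΦ.invariant g m α β

/-- The Hamiltonian vector field of a pulled back function is tangent to the orbits. -/
lemma IsHamiltonianQuasiPoisson.exists_moment [T2Space G] {κ : InvariantInnerProduct F G}
    {P : BivectorField E M} {Φ : M → G} (hΦ : IsHamiltonianQuasiPoisson κ P Φ) {f : G → ℝ} {m : M}
    (hf : SmoothNear F ℝ f (Φ m)) :
    ∃ ξ : F, (∀ β : E →L[ℝ] ℝ, P.pair m ((tmap F ℝ f (Φ m)).comp (tmap E F Φ m)) β =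
        β (orb F E G m ξ)) ∧
      (ξ = 0 → ∀ η : F, tmap F ℝ f (Φ m)
        (tmap F F (fun y : G => Φ m * y) 1 η + tmap F F (fun y : G => y * Φ m) 1 η) = 0) := by
  obtain ⟨f', hf', hff⟩ := exists_contMDiff_eventuallyEq hf
  obtain ⟨e, he⟩ := κ.exists_isOrthonormal
  have key := hΦ.moment e he f' hf' m
  have hc : tmap E ℝ (f' ∘ Φ) m = (tmap F ℝ f (Φ m)).comp (tmap E F Φ m) := by
    rw [SmoothNear.tmap_comp (smoothNear_of_contMDiff hf' _)
      (smoothNear_of_contMDiff hΦ.smooth_moment m), tmap_congr hff]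
  obtain ⟨ζ, hζ⟩ : ∃ ζ : F, ζ = diffOp e f' (Φ m) := ⟨_, rfl⟩
  -- The sign is that of `generatingField`, which is minus the infinitesimal action `orb`.
  refine ⟨-ζ, fun β => ?_, fun h0 η => ?_⟩
  · have h1 : β (-(orb F E G m ζ)) = P.pair m (tmap E ℝ (f' ∘ Φ) m) β := by
      rw [hζ]; exact key β
    rw [← hc, map_neg]
    exact h1.symm
  · have h1 : diffOp e f' (Φ m) = 0 := hζ.symm.trans (neg_eq_zero.1 h0)
    unfold diffOp at h1
    -- The coordinates of `diffOp` in the basis `e` are the derivatives of the function along half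
    -- of `e_a^L + e_a^R`, so if the vector vanishes, all of them do.
    have h2 := Fintype.linearIndependent_iff.1 e.linearIndependent _ h1
    let ℓ : F →L[ℝ] ℝ := (tmap F ℝ f' (Φ m)).comp
      (tmap F F (fun y : G => Φ m * y) 1 + tmap F F (fun y : G => y * Φ m) 1)
    have h3 : (ℓ : F →ₗ[ℝ] ℝ) = 0 := by
      refine Basis.ext (b := (e : Basis _ ℝ F)) fun a => ?_
      have h4 : (1 / 2 : ℝ) * ℓ (e a) = 0 := h2 a
      have h5 : ℓ (e a) = 0 := by linarith
      exact h5
    rw [← tmap_congr hff]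
    exact LinearMap.congr_fun h3 η

/-- The moment map is equivariant, infinitesimally. -/
lemma IsHamiltonianQuasiPoisson.tmap_moment_orb {κ : InvariantInnerProduct F G}
    {P : BivectorField E M} {Φ : M → G} (hΦ : IsHamiltonianQuasiPoisson κ P Φ) (m : M) (ξ : F) :
    tmap E F Φ m (orb F E G m ξ) = tmap F F (fun g : G => g * Φ m * g⁻¹) 1 ξ := by
  have h1 : SmoothNear E F Φ ((1 : G) • m) := smoothNear_of_contMDiff hΦ.smooth_moment _
  have h2 := SmoothNear.tmap_comp (E₁ := F) (f := fun g : G => g • m) (x := 1) h1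
    (smoothNear_of_contMDiff (contMDiff_orbitMap F E m) _)
  have e : Φ ∘ (fun g : G => g • m) = fun g : G => g * Φ m * g⁻¹ := by
    funext g; exact hΦ.equivariant g m
  rw [e, one_smul] at h2
  exact (DFunLike.congr_fun h2 ξ).symm

/-- The moment map is a submersion at the points with finite stabilizer. -/
theorem IsHamiltonianQuasiPoisson.tmap_moment_surjective [T2Space G]
    {κ : InvariantInnerProduct F G} {P : BivectorField E M} {Φ : M → G}
    (hΦ : IsHamiltonianQuasiPoisson κ P Φ) {m : M} (hm : Finite (MulAction.stabilizer G m)) :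
    Function.Surjective (tmap E F Φ m) := by
  by_contra hns
  have hlt : LinearMap.range (tmap E F Φ m : E →ₗ[ℝ] F) < ⊤ := by
    rw [lt_top_iff_ne_top, ne_eq, LinearMap.range_eq_top]; exact hns
  obtain ⟨θ', hθ0, hθ⟩ := Submodule.exists_le_ker_of_lt_top _ hlt
  let θ : F →L[ℝ] ℝ := LinearMap.toContinuousLinearMap θ'
  have hθΦ : ∀ v, θ (tmap E F Φ m v) = 0 := fun v => hθ ⟨v, rfl⟩
  -- A germ with differential `θ` at `Φ m`. Its pullback by `Φ` has zero differential at `m`, so its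
  -- Hamiltonian vector vanishes there.
  let f : G → ℝ := θ ∘ extChartAt 𝓘(ℝ, F) (Φ m)
  have hf : SmoothNear F ℝ f (Φ m) :=
    (smoothNear_of_contDiff θ.contDiff _).comp (smoothNear_extChartAt _)
  have hdf : tmap F ℝ f (Φ m) = θ := by
    rw [SmoothNear.tmap_comp (smoothNear_of_contDiff θ.contDiff _) (smoothNear_extChartAt _),
      tmap_extChartAt_self, tmap_clm]
    simp
  obtain ⟨ξ, h1, h2⟩ := hΦ.exists_moment hf
  have hz : (tmap F ℝ f (Φ m)).comp (tmap E F Φ m) = 0 := by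
    ext v; rw [hdf]; exact hθΦ v
  rw [hz] at h1
  have horb : orb F E G m ξ = 0 := by
    by_contra hne
    obtain ⟨β, hβ⟩ := SeparatingDual.exists_ne_zero (R := ℝ) hne
    exact hβ (by rw [← h1, P.pair_zero_left])
  have hξ : ξ = 0 := by
    apply orb_injective (F := F) (E := E) hm
    rw [horb, map_zero]
  have h3 := h2 hξ
  apply hθ0
  ext η
  obtain ⟨ζ, rfl⟩ := (tmap_mul_right_bijective (F := F) (Φ m) 1).2 η
  -- `h4` says that `θ` kills `ζ^L + ζ^R` at `Φ m`, and `h5` that it kills `ζ^R - ζ^L`. Hence it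
  -- kills `ζ^R`, which runs through the whole tangent space.
  have h4 := h3 ζ
  have h5 := hθΦ (orb F E G m ζ)
  rw [hΦ.tmap_moment_orb] at h5
  rw [hdf, ← tmap_conj_orbit_one] at h4
  rw [← tmap_conj_orbit_one]
  change θ _ = 0
  simp only [map_add] at h4 ⊢
  linarith

end LocalBracket

/-! ### Sums of smooth germs -/

section Sums

variable {E₁ E₂ : Type*} [NormedAddCommGroup E₁] [NormedSpace ℝ E₁]
  [NormedAddCommGroup E₂] [NormedSpace ℝ E₂] {M : Type*} [TopologicalSpace M] [ChartedSpace E₁ M]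

lemma SmoothNear.add {f g : M → E₂} {x : M} (hf : SmoothNear E₁ E₂ f x)
    (hg : SmoothNear E₁ E₂ g x) : SmoothNear E₁ E₂ (f + g) x := by
  filter_upwards [hf, hg] with y h1 h2 using h1.add h2

lemma SmoothNear.tmap_add {f g : M → E₂} {x : M} (hf : SmoothNear E₁ E₂ f x)
    (hg : SmoothNear E₁ E₂ g x) : tmap E₁ E₂ (f + g) x = tmap E₁ E₂ f x + tmap E₁ E₂ g x :=
  mfderiv_add hf.mdifferentiableAt hg.mdifferentiableAt

lemma smoothNear_sum {ι : Type*} (s : Finset ι) {f : ι → M → E₂} {x : M}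
    (hf : ∀ i, SmoothNear E₁ E₂ (f i) x) :
    SmoothNear E₁ E₂ (∑ i ∈ s, f i) x ∧
      tmap E₁ E₂ (∑ i ∈ s, f i) x = ∑ i ∈ s, tmap E₁ E₂ (f i) x := by
  classical
  induction s using Finset.induction_on with
  | empty =>
    simp only [Finset.sum_empty]
    exact ⟨smoothNear_const (0 : E₂) x, tmap_const (0 : E₂) x⟩
  | insert a s ha ih =>
    rw [Finset.sum_insert ha, Finset.sum_insert ha]
    exact ⟨(hf a).add ih.1, by rw [(hf a).tmap_add ih.1, ih.2]⟩

end Sums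

/-! ### Averaging over a finite stabilizer -/

section Linearization

variable {F : Type*} [NormedAddCommGroup F] [NormedSpace ℝ F]
  {G : Type*} [TopologicalSpace G] [ChartedSpace F G] [Group G]
  {E : Type*} [NormedAddCommGroup E] [NormedSpace ℝ E] [FiniteDimensional ℝ E]
  {M : Type*} [TopologicalSpace M] [ChartedSpace E M] [IsManifold 𝓘(ℝ, E) ∞ M]
  [MulAction G M] [ContMDiffSMul 𝓘(ℝ, F) 𝓘(ℝ, E) ∞ G M]

/-- The isotropy representation at `m`. -/
def isotropy (F E : Type*) [NormedAddCommGroup F] [NormedSpace ℝ F]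
    {G : Type*} [TopologicalSpace G] [ChartedSpace F G] [Group G]
    [NormedAddCommGroup E] [NormedSpace ℝ E]
    {M : Type*} [TopologicalSpace M] [ChartedSpace E M]
    [MulAction G M] [ContMDiffSMul 𝓘(ℝ, F) 𝓘(ℝ, E) ∞ G M] (m : M) :
    MulAction.stabilizer G m →* (E →L[ℝ] E) where
  toFun γ := tmap E E (fun x : M => (γ : G) • x) m
  map_one' := by
    simp only [OneMemClass.coe_one, one_smul]
    exact tmap_id m
  map_mul' γ δ := by
    have hδ : (δ : G) • m = m := δ.2
    have e : (fun x : M => ((γ * δ : MulAction.stabilizer G m) : G) • x) =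
        (fun x : M => (γ : G) • x) ∘ fun x : M => (δ : G) • x := by
      funext x; simp [mul_smul]
    rw [e, SmoothNear.tmap_comp (smoothNear_of_contMDiff (contMDiff_smul_const F E (γ : G)) _)
      (smoothNear_of_contMDiff (contMDiff_smul_const F E (δ : G)) m), hδ]
    rfl

lemma isotropy_apply (m : M) (γ : MulAction.stabilizer G m) :
    isotropy F E m γ = tmap E E (fun x : M => (γ : G) • x) m := rfl

lemma isotropy_inv_mul (m : M) (γ : MulAction.stabilizer G m) :
    (isotropy F E m γ⁻¹).comp (isotropy F E m γ) = ContinuousLinearMap.id ℝ E := by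
  have := map_mul (isotropy F E m) γ⁻¹ γ
  rw [inv_mul_cancel, map_one] at this
  exact this.symm

variable (F) in
/-- The action of a finite stabilizer is linearizable. -/
lemma exists_equivariant_chart {m : M} (hm : Finite (MulAction.stabilizer G m)) :
    ∃ Ψ : M → E, SmoothNear E E Ψ m ∧ Ψ m = 0 ∧ tmap E E Ψ m = ContinuousLinearMap.id ℝ E ∧
      ∀ (γ : MulAction.stabilizer G m) (x : M), Ψ ((γ : G) • x) = isotropy F E m γ (Ψ x) := by
  have := Fintype.ofFinite (MulAction.stabilizer G m)
  set c : ℝ := (Fintype.card (MulAction.stabilizer G m) : ℝ)⁻¹ with hc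
  let φ : M → E := (fun y => y - extChartAt 𝓘(ℝ, E) m m) ∘ extChartAt 𝓘(ℝ, E) m
  have hsub : ContDiff ℝ ∞ (fun y : E => y - extChartAt 𝓘(ℝ, E) m m) :=
    contDiff_id.sub contDiff_const
  have hφ : SmoothNear E E φ m := (smoothNear_of_contDiff hsub _).comp (smoothNear_extChartAt m)
  have hφm : φ m = 0 := sub_self _
  have htφ : tmap E E φ m = ContinuousLinearMap.id ℝ E := by
    rw [SmoothNear.tmap_comp (smoothNear_of_contDiff hsub _) (smoothNear_extChartAt m),
      tmap_extChartAt_self, tmap_eq_fderiv]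
    simp [fderiv_sub_const]
  -- A centred chart is averaged over the stabilizer, each translate being corrected by the inverse
  -- isotropy map. Each summand then has derivative `c` times the identity, and the average has
  -- derivative the identity.
  let h : MulAction.stabilizer G m → M → E := fun γ =>
    (c • isotropy F E m γ⁻¹) ∘ (φ ∘ fun x : M => (γ : G) • x)
  have hsm : ∀ γ : MulAction.stabilizer G m, (γ : G) • m = m := fun γ => γ.2
  have h0 : ∀ γ : MulAction.stabilizer G m, SmoothNear E E (fun x : M => (γ : G) • x) m := fun γ =>
    smoothNear_of_contMDiff (contMDiff_smul_const F E (γ : G)) m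
  have hφγ : ∀ γ : MulAction.stabilizer G m, SmoothNear E E φ ((γ : G) • m) := fun γ => by
    rwa [hsm]
  have h1 : ∀ γ, SmoothNear E E (h γ) m := fun γ =>
    (smoothNear_of_contDiff (c • isotropy F E m γ⁻¹).contDiff _).comp ((hφγ γ).comp (h0 γ))
  have h2 : ∀ γ, tmap E E (h γ) m = c • ContinuousLinearMap.id ℝ E := fun γ => by
    rw [SmoothNear.tmap_comp (smoothNear_of_contDiff (c • isotropy F E m γ⁻¹).contDiff _)
      ((hφγ γ).comp (h0 γ)), SmoothNear.tmap_comp (hφγ γ) (h0 γ), tmap_clm, hsm, htφ]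
    have h5 := isotropy_inv_mul (F := F) (E := E) m γ
    ext v
    exact congrArg (c • ·) (DFunLike.congr_fun h5 v)
  obtain ⟨h3, h4⟩ := smoothNear_sum Finset.univ h1
  refine ⟨_, h3, ?_, ?_, fun δ x => ?_⟩
  · simp [h, hsm, hφm]
  · rw [h4]
    simp only [h2, Finset.sum_const, Finset.card_univ]
    rw [← Nat.cast_smul_eq_nsmul ℝ, smul_smul, hc, mul_inv_cancel₀, one_smul]
    exact Nat.cast_ne_zero.2 Fintype.card_ne_zero
  · simp only [Finset.sum_apply, map_sum]
    refine Fintype.sum_equiv (Equiv.mulRight δ) _ _ fun γ => ?_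
    have e1 : isotropy F E m γ⁻¹ = (isotropy F E m δ) * (isotropy F E m (γ * δ)⁻¹) := by
      rw [← map_mul]; congr 1; group
    simp only [h, Function.comp_apply, Equiv.coe_mulRight]
    rw [smul_apply, smul_apply, map_smul, e1]
    simp [mul_smul]

variable [FiniteDimensional ℝ F] [LieGroup 𝓘(ℝ, F) ∞ G]

/-- The isotropy representation preserves the tangent space of the orbit. -/
lemma isotropy_orb (m : M) (γ : MulAction.stabilizer G m) (ξ : F) :
    ∃ η : F, isotropy F E m γ (orb F E G m ξ) = orb F E G m η := by
  have hm : (γ : G)⁻¹ • m = m := by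
    rw [inv_smul_eq_iff]; exact (γ.2).symm
  have e : (fun x : M => (γ : G) • x) ∘ (fun h : G => h • m) =
      (fun h : G => h • m) ∘ fun h : G => (γ : G) * h * (γ : G)⁻¹ := by
    funext h
    simp only [Function.comp_apply, mul_smul, hm]
  have h1 := SmoothNear.tmap_comp (E₁ := F) (E₂ := E) (E₃ := E) (g := fun x : M => (γ : G) • x)
    (f := fun h : G => h • m) (x := 1)
    (smoothNear_of_contMDiff (contMDiff_smul_const F E (γ : G)) _)
    (smoothNear_of_contMDiff (contMDiff_orbitMap F E m) _)
  have h2 := SmoothNear.tmap_comp (E₁ := F) (E₂ := F) (E₃ := E) (g := fun h : G => h • m)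
    (f := fun h : G => (γ : G) * h * (γ : G)⁻¹) (x := 1)
    (smoothNear_of_contMDiff (contMDiff_orbitMap F E m) _)
    (smoothNear_of_contMDiff (contMDiff_conj (γ : G)) _)
  rw [e, h2] at h1
  have e1 : (γ : G) * 1 * (γ : G)⁻¹ = 1 := by simp
  simp only [e1, one_smul] at h1
  exact ⟨_, (DFunLike.congr_fun h1 ξ).symm⟩

/-- A complement of the orbit directions that is invariant under the isotropy representation. -/
lemma exists_invariant_complement {m : M} (hm : Finite (MulAction.stabilizer G m))
    (hinj : Function.Injective (orb F E G m)) {E' : Type*} [NormedAddCommGroup E']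
    [NormedSpace ℝ E'] [FiniteDimensional ℝ E'] (hE' : finrank ℝ E' + finrank ℝ F = finrank ℝ E) :
    ∃ (j : E' →L[ℝ] E) (ρ : MulAction.stabilizer G m →* (E' →L[ℝ] E')),
      (∀ γ u, j (ρ γ u) = isotropy F E m γ (j u)) ∧
      Function.Bijective (fun p : F × E' => orb F E G m p.1 + j p.2) := by
  have := Fintype.ofFinite (MulAction.stabilizer G m)
  set T : Submodule ℝ E := LinearMap.range (orb F E G m : F →ₗ[ℝ] E) with hT
  set π := isotropy F E (G := G) m with hπ
  obtain ⟨p₀, hp₀⟩ := exists_clm_projection T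
  set c : ℝ := (Fintype.card (MulAction.stabilizer G m) : ℝ)⁻¹ with hc
  -- As in Maschke's theorem, the average of a projection onto the orbit directions is an
  -- equivariant projection, and its kernel is an invariant complement.
  let p : E →L[ℝ] E := ∑ γ : MulAction.stabilizer G m,
    c • ((π γ).comp ((T.subtypeL.comp p₀).comp (π γ⁻¹)))
  have hp : ∀ v, p v = ∑ γ : MulAction.stabilizer G m, c • π γ (p₀ (π γ⁻¹ v)) := fun v => by
    simp [p]
  have hTinv : ∀ γ, ∀ t ∈ T, π γ t ∈ T := by
    rintro γ _ ⟨ξ, rfl⟩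
    obtain ⟨η, hη⟩ := isotropy_orb (F := F) (E := E) m γ ξ
    exact ⟨η, hη.symm⟩
  have hππ : ∀ γ v, π γ (π γ⁻¹ v) = v := fun γ v => by
    have := map_mul π γ γ⁻¹
    rw [mul_inv_cancel, map_one] at this
    exact (DFunLike.congr_fun this v).symm
  have hpT : ∀ v, p v ∈ T := fun v => by
    rw [hp]
    exact T.sum_mem fun γ _ => T.smul_mem _ (hTinv γ _ (p₀ _).2)
  have hpid : ∀ t ∈ T, p t = t := fun t ht => by
    rw [hp]
    have : ∀ γ : MulAction.stabilizer G m, c • π γ (p₀ (π γ⁻¹ t)) = c • t := fun γ => by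
      rw [hp₀ ⟨_, hTinv γ⁻¹ t ht⟩, hππ]
    simp only [this, Finset.sum_const, Finset.card_univ]
    rw [← Nat.cast_smul_eq_nsmul ℝ, smul_smul, hc, mul_inv_cancel₀, one_smul]
    exact Nat.cast_ne_zero.2 Fintype.card_ne_zero
  have hcomm : ∀ δ v, p (π δ v) = π δ (p v) := fun δ v => by
    rw [hp, hp, map_sum]
    refine Fintype.sum_equiv (Equiv.mulLeft δ⁻¹) _ _ fun γ => ?_
    simp only [Equiv.coe_mulLeft, map_smul]
    have e1 : π γ = π δ * π (δ⁻¹ * γ) := by rw [← map_mul]; congr 1; group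
    have e2 : π (δ⁻¹ * γ)⁻¹ = π γ⁻¹ * π δ := by rw [← map_mul]; congr 1; group
    rw [e2, e1]
    rfl
  set N : Submodule ℝ E := LinearMap.ker (p : E →ₗ[ℝ] E) with hN
  have hNinv : ∀ γ, ∀ v ∈ N, π γ v ∈ N := fun γ v hv => by
    have hv' : p v = 0 := hv
    change p (π γ v) = 0
    rw [hcomm, hv', map_zero]
  have hrange : LinearMap.range (p : E →ₗ[ℝ] E) = T := by
    ext v
    exact ⟨fun ⟨w, hw⟩ => hw ▸ hpT w, fun hv => ⟨v, hpid v hv⟩⟩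
  have hTdim : finrank ℝ T = finrank ℝ F := LinearMap.finrank_range_of_inj hinj
  have hNdim : finrank ℝ E' = finrank ℝ N := by
    have h1 : finrank ℝ (LinearMap.range (p : E →ₗ[ℝ] E)) + finrank ℝ N = finrank ℝ E :=
      LinearMap.finrank_range_add_finrank_ker (p : E →ₗ[ℝ] E)
    rw [hrange, hTdim] at h1
    omega
  -- The complement is parametrized by a space that does not depend on `m`, so that all the slices
  -- have the same model.
  let e : E' ≃L[ℝ] N := (LinearEquiv.ofFinrankEq E' N hNdim).toContinuousLinearEquiv
  let j : E' →L[ℝ] E := N.subtypeL.comp (e : E' →L[ℝ] N)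
  have hj : Function.Injective j := Subtype.val_injective.comp e.injective
  have hjN : ∀ u, j u ∈ N := fun u => (e u).2
  let ρ₀ : MulAction.stabilizer G m → (E' →L[ℝ] E') := fun γ =>
    (e.symm : N →L[ℝ] E').comp (((π γ).comp j).codRestrict N fun u => hNinv γ _ (hjN u))
  have hρ₀ : ∀ γ u, j (ρ₀ γ u) = π γ (j u) := fun γ u => by
    change ((e (e.symm _) : N) : E) = _
    rw [e.apply_symm_apply]
    rfl
  refine ⟨j, { toFun := ρ₀, map_one' := ?_, map_mul' := fun γ δ => ?_ }, hρ₀, ?_⟩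
  · ext u
    apply hj
    rw [hρ₀, map_one]
    rfl
  · ext u
    apply hj
    rw [hρ₀, map_mul]
    change _ = j (ρ₀ γ (ρ₀ δ u))
    rw [hρ₀, hρ₀]
    rfl
  · let L : F × E' →ₗ[ℝ] E := ((orb F E G m).coprod j : F × E' →L[ℝ] E)
    have hL : Function.Injective L := by
      rw [injective_iff_map_eq_zero]
      rintro ⟨ξ, u⟩ h
      have h1 : orb F E G m ξ + j u = 0 := h
      have h2 : p (orb F E G m ξ + j u) = orb F E G m ξ := by
        have h3 : p (j u) = 0 := hjN u
        rw [map_add, h3, add_zero]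
        exact hpid _ ⟨ξ, rfl⟩
      rw [h1, map_zero] at h2
      have h4 : ξ = 0 := hinj (by rw [← h2, map_zero])
      rw [← h2, zero_add] at h1
      have h5 : u = 0 := hj (by rw [h1, map_zero])
      rw [h4, h5]; rfl
    have hdim : finrank ℝ (F × E') = finrank ℝ E := by rw [finrank_prod]; omega
    exact ⟨hL, (LinearMap.injective_iff_surjective_of_finrank_eq_finrank hdim).1 hL⟩

end Linearization

/-! ### Existence of slices -/

section Slices

/-- A slice at `m` for the action of `G` on `M`: a parametrized submanifold `σ : dom → M` that is
transversal to the orbits and invariant under the stabilizer of `m`, which acts linearly on the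
parameters. -/
structure Slice (E E' : Type*) [NormedAddCommGroup E] [NormedSpace ℝ E] [NormedAddCommGroup E']
    [NormedSpace ℝ E'] (G : Type*) [Group G] {M : Type*} [TopologicalSpace M] [ChartedSpace E M]
    [MulAction G M] (m : M) where
  dom : Opens E'
  isConnected_dom : IsConnected (dom : Set E')
  zero_mem : (0 : E') ∈ dom
  σ : E' → M
  σ_zero : σ 0 = m
  smooth : ∀ u ∈ dom, SmoothNear E' E σ u
  ρ : MulAction.stabilizer G m →* (E' →L[ℝ] E')
  ρ_mem : ∀ γ, ∀ u ∈ dom, ρ γ u ∈ dom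
  equivariant : ∀ γ, ∀ u ∈ dom, σ (ρ γ u) = (γ : G) • σ u
  exists_of_smul_eq : ∀ u ∈ dom, ∀ u' ∈ dom, ∀ g : G, g • σ u = σ u' →
    ∃ h : g ∈ MulAction.stabilizer G m, ρ ⟨g, h⟩ u = u'
  exists_lift : ∀ u ∈ dom, ∃ q : M → E', SmoothNear E E' q (σ u) ∧ (∀ᶠ v in 𝓝 u, q (σ v) = v) ∧
    ∀ᶠ w in 𝓝 (σ u), q w ∈ dom ∧ ∃ g : G, g • σ (q w) = w

variable {F : Type*} [NormedAddCommGroup F] [NormedSpace ℝ F] [FiniteDimensional ℝ F]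
  {G : Type*} [TopologicalSpace G] [ChartedSpace F G] [Group G] [LieGroup 𝓘(ℝ, F) ∞ G]
  [CompactSpace G] [T2Space G]
  {E : Type*} [NormedAddCommGroup E] [NormedSpace ℝ E] [FiniteDimensional ℝ E]
  {M : Type*} [TopologicalSpace M] [ChartedSpace E M] [IsManifold 𝓘(ℝ, E) ∞ M] [T2Space M]
  [MulAction G M] [ContMDiffSMul 𝓘(ℝ, F) 𝓘(ℝ, E) ∞ G M]

/-- The local product decomposition of `M` near a transversal. -/
lemma exists_product_inverse {E' : Type*} [NormedAddCommGroup E']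
    [NormedSpace ℝ E'] [FiniteDimensional ℝ E'] {σ : E' → M} {u : E'} {m : M} (hσm : σ u = m)
    (hσ : SmoothNear E' E σ u)
    (hb : Function.Bijective (fun p : F × E' => orb F E G m p.1 + tmap E' E σ u p.2)) :
    ∃ (κ : F → G) (f₀ : F) (r : M → F × E'), κ f₀ = 1 ∧ Tendsto κ (𝓝 f₀) (𝓝 1) ∧
      (∃ lam : G → F, Tendsto lam (𝓝 1) (𝓝 f₀) ∧ ∀ᶠ g in 𝓝 1, κ (lam g) = g) ∧
      SmoothNear E (F × E') r m ∧ r m = (f₀, u) ∧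
      (∀ᶠ p : F × E' in 𝓝 (f₀, u), r (κ p.1 • σ p.2) = p) ∧
      ∀ᶠ w in 𝓝 m, κ (r w).1 • σ (r w).2 = w := by
  set ψ := extChartAt 𝓘(ℝ, F) (1 : G) with hψ
  have hκ : SmoothNear F F ψ.symm (ψ 1) := smoothNear_extChartAt_symm 1
  have hκ1 : ψ.symm (ψ 1) = 1 := extChartAt_to_inv 1
  have hκt : tmap F F ψ.symm (ψ 1) = ContinuousLinearMap.id ℝ F := tmap_extChartAt_symm_self 1
  -- The map `(g, v) ↦ g • σ v`, with `g` near 1 written in a chart. Its derivative at `(1, u)` is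
  -- the map assumed bijective in `hb`.
  let θ : F × E' → M := fun p => ψ.symm p.1 • σ p.2
  have h1 : SmoothNear (F × E') F (ψ.symm ∘ Prod.fst) (ψ 1, u) :=
    SmoothNear.comp (by exact hκ) (smoothNear_of_contDiff contDiff_fst _)
  have h2 : SmoothNear (F × E') E (σ ∘ Prod.snd) (ψ 1, u) :=
    SmoothNear.comp (by exact hσ) (smoothNear_of_contDiff contDiff_snd _)
  have hθ : SmoothNear (F × E') E θ (ψ 1, u) := by
    filter_upwards [h1, h2] with p k1 k2
    exact ContMDiffAt.smul (I := 𝓘(ℝ, F)) k1 k2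
  have hθ1 : θ (ψ 1, u) = m := by simp only [θ, hκ1, one_smul, hσm]
  have hθt : ∀ p : F × E', tmap (F × E') E θ (ψ 1, u) p =
      orb F E G m p.1 + tmap E' E σ u p.2 := fun p => by
    have h3 := tmap_binary (contMDiff_smul (I := 𝓘(ℝ, F)) (I' := 𝓘(ℝ, E)) (n := ∞) (G := G)
      (M := M)) h1 h2 p
    have h4 : tmap (F × E') F (ψ.symm ∘ Prod.fst) (ψ 1, u) p = p.1 := by
      rw [SmoothNear.tmap_comp (by exact hκ) (smoothNear_of_contDiff contDiff_fst _)]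
      change tmap F F ψ.symm (ψ 1) (tmap (F × E') F (ContinuousLinearMap.fst ℝ F E') (ψ 1, u) p) = _
      rw [hκt, tmap_clm]; rfl
    have h5 : tmap (F × E') E (σ ∘ Prod.snd) (ψ 1, u) p = tmap E' E σ u p.2 := by
      rw [SmoothNear.tmap_comp (by exact hσ) (smoothNear_of_contDiff contDiff_snd _)]
      change tmap E' E σ u (tmap (F × E') E' (ContinuousLinearMap.snd ℝ F E') (ψ 1, u) p) = _
      rw [tmap_clm]; rfl
    rw [h4, h5] at h3
    simp only [Function.comp_apply, hκ1, one_smul, hσm] at h3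
    rw [tmap_id] at h3
    exact h3
  obtain ⟨r, hr, hr0, hr1, hr2⟩ := exists_localInverse hθ (by
    have : (tmap (F × E') E θ (ψ 1, u) : F × E' → E) =
      fun p : F × E' => orb F E G m p.1 + tmap E' E σ u p.2 := funext hθt
    rw [this]; exact hb)
  rw [hθ1] at hr hr0 hr2
  refine ⟨ψ.symm, ψ 1, r, hκ1, ?_, ⟨ψ, ?_, ?_⟩, hr, hr0, hr1, hr2⟩
  · exact tendsto_extChartAt_symm 1
  · exact continuousAt_extChartAt 1
  · exact extChartAt_symm_extChartAt_eventually 1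

/-- Slices exist at the points with finite stabilizer. -/
theorem exists_slice (F : Type*) [NormedAddCommGroup F] [NormedSpace ℝ F] [FiniteDimensional ℝ F]
    {G : Type*} [TopologicalSpace G] [ChartedSpace F G] [Group G] [LieGroup 𝓘(ℝ, F) ∞ G]
    [CompactSpace G] [T2Space G] [MulAction G M] [ContMDiffSMul 𝓘(ℝ, F) 𝓘(ℝ, E) ∞ G M]
    {E' : Type*} [NormedAddCommGroup E'] [NormedSpace ℝ E'] [FiniteDimensional ℝ E']
    (hE' : finrank ℝ E' + finrank ℝ F = finrank ℝ E) {m : M}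
    (hm : Finite (MulAction.stabilizer G m)) : Nonempty (Slice E E' G m) := by
  have : IsTopologicalGroup G := topologicalGroup_of_lieGroup 𝓘(ℝ, F) ∞
  have : ContinuousSMul G M := ContMDiffSMul.continuousSMul (I := 𝓘(ℝ, F)) (I' := 𝓘(ℝ, E)) ∞
  have hinj : Function.Injective (orb F E G m) := orb_injective hm
  obtain ⟨j, ρ, hjρ, hb⟩ := exists_invariant_complement hm hinj hE'
  obtain ⟨Ψ, hΨ, hΨ0, hΨt, hΨe⟩ := exists_equivariant_chart F (E := E) hm
  obtain ⟨s, hs, hs0, hs1, hs2⟩ := exists_localInverse hΨ (by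
    rw [hΨt]; exact Function.bijective_id)
  rw [hΨ0] at hs hs0 hs2
  have hst : tmap E E s 0 = ContinuousLinearMap.id ℝ E := by
    have h1 := tmap_comp_eq_id hΨ (by rwa [hΨ0]) hs1
    rw [hΨt, hΨ0] at h1
    simpa using h1
  -- The invariant complement, carried to `M` by the inverse of the equivariant chart.
  let σ : E' → M := s ∘ j
  have hσ : SmoothNear E' E σ 0 :=
    SmoothNear.comp (by rwa [map_zero]) (smoothNear_of_contDiff j.contDiff 0)
  have hσ0 : σ 0 = m := by simp [σ, hs0]
  have hσt : tmap E' E σ 0 = j := by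
    rw [SmoothNear.tmap_comp (by rwa [map_zero]) (smoothNear_of_contDiff j.contDiff 0), map_zero,
      hst, tmap_clm]
    rfl
  have hσc : Tendsto σ (𝓝 0) (𝓝 m) := by
    have := hσ.continuousAt; rwa [ContinuousAt, hσ0] at this
  have hst' : Tendsto s (𝓝 0) (𝓝 m) := by
    have := hs.continuousAt; rwa [ContinuousAt, hs0] at this
  have hρc : ∀ γ, Tendsto (ρ γ) (𝓝 0) (𝓝 0) := fun γ => by
    have := (ρ γ).continuous.tendsto 0; rwa [map_zero] at this
  have hjc : Tendsto j (𝓝 0) (𝓝 0) := by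
    have := j.continuous.tendsto 0; rwa [map_zero] at this
  -- equivariance
  have heq : ∀ᶠ u in 𝓝 (0 : E'), ∀ γ, σ (ρ γ u) = (γ : G) • σ u := by
    rw [eventually_all]
    intro γ
    have hγ : Tendsto (fun v => (γ : G) • s v) (𝓝 0) (𝓝 m) := by
      have h1 := (continuous_const_smul (γ : G)).tendsto m |>.comp hst'
      rwa [show (γ : G) • m = m from γ.2] at h1
    have h2 : ∀ᶠ v in 𝓝 (0 : E), s (isotropy F E m γ v) = (γ : G) • s v := by
      filter_upwards [hs2, hγ.eventually hs1] with v k1 k2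
      rw [← k2, hΨe, k1]
    filter_upwards [hjc.eventually h2] with u hu
    simp only [σ, Function.comp_apply, hjρ, hu]
  obtain ⟨κ, f₀, r, hκ0, hκc, ⟨lam, hlc, hl⟩, hr, hrm, hr1, hr2⟩ :=
    exists_product_inverse (F := F) (G := G) hσ0 hσ (by rw [hσt]; exact hb)
  have hrc : Tendsto r (𝓝 m) (𝓝 (f₀, 0)) := by
    have := hr.continuousAt; rwa [ContinuousAt, hrm] at this
  let q : M → E' := Prod.snd ∘ r
  have hq : SmoothNear E E' q m := SmoothNear.comp (smoothNear_of_contDiff contDiff_snd _) hr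
  have hrσ : ∀ᶠ u in 𝓝 (0 : E'), r (σ u) = (f₀, u) := by
    have h1 : Tendsto (fun u : E' => (f₀, u)) (𝓝 0) (𝓝 (f₀, 0)) :=
      (Continuous.prodMk_right f₀).tendsto 0
    filter_upwards [h1.eventually hr1] with u hu
    simpa only [hκ0, one_smul] using hu
  have hlift : ∀ᶠ w in 𝓝 m, ∃ g : G, g • σ (q w) = w := hr2.mono fun w hw => ⟨_, hw⟩
  -- separation of the orbits
  have hsep : ∀ᶠ z : E' × E' in 𝓝 (0, 0), ∀ g ∈ (Set.univ : Set G),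
      g • σ z.1 = σ z.2 → g ∈ MulAction.stabilizer G m := by
    refine isCompact_univ.eventually_forall_of_forall_eventually fun g₀ _ => ?_
    have ht1 : Tendsto (fun z : (E' × E') × G => z.1.1) (𝓝 ((0, 0), g₀)) (𝓝 0) :=
      (continuous_fst.comp continuous_fst).tendsto _
    have ht2 : Tendsto (fun z : (E' × E') × G => z.1.2) (𝓝 ((0, 0), g₀)) (𝓝 0) :=
      (continuous_snd.comp continuous_fst).tendsto _
    have ht3 : Tendsto (fun z : (E' × E') × G => z.2) (𝓝 ((0, 0), g₀)) (𝓝 g₀) :=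
      continuous_snd.tendsto _
    by_cases hg : g₀ • m = m
    -- For `g` near `g₀`, the element `g₀⁻¹ g` is near 1 and maps a point of the slice to a point of
    -- the slice. By the uniqueness of the product decomposition near `m` it equals 1, so `g = g₀`.
    · let γ : MulAction.stabilizer G m := ⟨g₀⁻¹, inv_mem (show g₀ ∈ MulAction.stabilizer G m from hg)⟩
      have ht4 : Tendsto (fun z : (E' × E') × G => (lam (g₀⁻¹ * z.2), z.1.1)) (𝓝 ((0, 0), g₀))
          (𝓝 (f₀, 0)) := by
        refine Tendsto.prodMk_nhds (hlc.comp ?_) ht1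
        have := (continuous_const_mul g₀⁻¹).tendsto g₀ |>.comp ht3
        rwa [inv_mul_cancel] at this
      have ht5 : Tendsto (fun z : (E' × E') × G => g₀⁻¹ * z.2) (𝓝 ((0, 0), g₀)) (𝓝 1) := by
        have := (continuous_const_mul g₀⁻¹).tendsto g₀ |>.comp ht3
        rwa [inv_mul_cancel] at this
      filter_upwards [ht4.eventually hr1, ht5.eventually hl, (ht2.eventually heq),
        ((hρc γ).comp ht2).eventually hrσ] with z k1 k2 k3 k4 hz
      have h1 : (g₀⁻¹ * z.2) • σ z.1.1 = σ (ρ γ z.1.2) := by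
        rw [k3 γ, mul_smul, hz]
      simp only [Function.comp_apply] at k4
      rw [k2, h1, k4] at k1
      have h2 : f₀ = lam (g₀⁻¹ * z.2) := congrArg Prod.fst k1
      rw [← h2, hκ0] at k2
      have : z.2 = g₀ := (inv_mul_eq_one.1 k2.symm).symm
      rw [this]; exact hg
    -- Here `g₀ • m ≠ m`, and since `M` is Hausdorff no element near `g₀` maps a point of the slice
    -- near `m` to another such point.
    · have ht4 : Tendsto (fun z : (E' × E') × G => z.2 • σ z.1.1) (𝓝 ((0, 0), g₀)) (𝓝 (g₀ • m)) :=
        ht3.smul (hσc.comp ht1)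
      have ht5 : Tendsto (fun z : (E' × E') × G => σ z.1.2) (𝓝 ((0, 0), g₀)) (𝓝 m) := hσc.comp ht2
      have := ht4.prodMk_nhds ht5 |>.eventually
        ((isClosed_diagonal (X := M)).isOpen_compl.mem_nhds (show (g₀ • m, m) ∉ Set.diagonal M from hg))
      filter_upwards [this] with z hz hz'
      exact absurd hz' hz
  have hgood : ∀ᶠ u in 𝓝 (0 : E'), SmoothNear E' E σ u ∧ (∀ γ, σ (ρ γ u) = (γ : G) • σ u) ∧
      (∀ᶠ v in 𝓝 u, q (σ v) = v) ∧ SmoothNear E E' q (σ u) ∧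
        ∀ᶠ w in 𝓝 (σ u), ∃ g : G, g • σ (q w) = w := by
    filter_upwards [hσ.eventually, heq, hrσ.eventually_nhds, hσc.eventually hq.eventually,
      hσc.eventually hlift.eventually_nhds] with u k1 k2 k3 k4 k5
    exact ⟨k1, k2, k3.mono fun v hv => congrArg Prod.snd hv, k4, k5⟩
  obtain ⟨ε₁, hε₁, hball₁⟩ := Metric.eventually_nhds_iff_ball.1 hgood
  obtain ⟨ε₂, hε₂, hball₂⟩ := Metric.eventually_nhds_iff_ball.1 hsep
  set ε := min ε₁ ε₂ with hε
  have hεpos : 0 < ε := lt_min hε₁ hε₂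
  -- The intersection makes the domain invariant under the stabilizer. It remains convex, hence
  -- connected.
  let D : Opens E' := ⟨⋂ γ, ρ γ ⁻¹' Metric.ball 0 ε,
    isOpen_iInter_of_finite fun γ => Metric.isOpen_ball.preimage (ρ γ).continuous⟩
  have hD : ∀ u, u ∈ D ↔ ∀ γ, ρ γ u ∈ Metric.ball 0 ε := fun u => Set.mem_iInter
  have hDball : ∀ u ∈ D, u ∈ Metric.ball 0 ε := fun u hu => by
    have := (hD u).1 hu 1
    rw [map_one] at this
    exact this
  have h0D : (0 : E') ∈ D := (hD 0).2 fun γ => by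
    rw [map_zero]; exact Metric.mem_ball_self hεpos
  have hDρ : ∀ γ, ∀ u ∈ D, ρ γ u ∈ D := fun γ u hu => (hD _).2 fun δ => by
    have := (hD u).1 hu (δ * γ)
    rw [map_mul] at this
    exact this
  have hDconv : Convex ℝ (D : Set E') :=
    convex_iInter fun γ => (convex_ball 0 ε).linear_preimage (ρ γ : E' →ₗ[ℝ] E')
  have hgoodD : ∀ u ∈ D, _ := fun u hu => hball₁ u (Metric.ball_subset_ball (min_le_left _ _)
    (hDball u hu))
  refine ⟨⟨D, hDconv.isConnected ⟨0, h0D⟩, h0D, σ, hσ0, fun u hu => (hgoodD u hu).1, ρ, hDρ,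
    fun γ u hu => (hgoodD u hu).2.1 γ, ?_, ?_⟩⟩
  · intro u hu u' hu' g hg
    have h1 : g ∈ MulAction.stabilizer G m := by
      refine hball₂ (u, u') ?_ g trivial hg
      rw [← ball_prod_same]
      exact ⟨Metric.ball_subset_ball (min_le_right _ _) (hDball u hu),
        Metric.ball_subset_ball (min_le_right _ _) (hDball u' hu')⟩
    refine ⟨h1, ?_⟩
    have h2 : σ (ρ ⟨g, h1⟩ u) = σ u' := by rw [(hgoodD u hu).2.1 ⟨g, h1⟩, ← hg]
    have h3 := (hgoodD _ (hDρ ⟨g, h1⟩ u hu)).2.2.1.self_of_nhds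
    rw [h2, (hgoodD u' hu').2.2.1.self_of_nhds] at h3
    exact h3.symm
  · intro u hu
    obtain ⟨k1, k2, k3, k4, k5⟩ := hgoodD u hu
    refine ⟨q, k4, k3, Eventually.and ?_ k5⟩
    exact k4.continuousAt.eventually (by
      rw [k3.self_of_nhds]; exact D.isOpen.mem_nhds hu)

end Slices

/-! ### Two facts of linear algebra -/

section LinearAlgebra

variable {E E' F : Type*} [NormedAddCommGroup E] [NormedSpace ℝ E] [FiniteDimensional ℝ E]
  [NormedAddCommGroup E'] [NormedSpace ℝ E'] [FiniteDimensional ℝ E']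
  [NormedAddCommGroup F] [NormedSpace ℝ F] [FiniteDimensional ℝ F]

/-- A dimension count: the range of `o` lies in the kernel of `A` and has the same dimension. In the
applications `A` is the derivative of a projection to the quotient and `o` the infinitesimal action.
-/
lemma exists_eq_of_map_eq_zero (hE' : finrank ℝ E' + finrank ℝ F = finrank ℝ E) {A : E →L[ℝ] E'}
    {o : F →L[ℝ] E} (hA : Function.Surjective A) (ho : Function.Injective o)
    (hAo : ∀ ξ, A (o ξ) = 0) {v : E} (hv : A v = 0) : ∃ ξ, o ξ = v := by
  have hle : LinearMap.range (o : F →ₗ[ℝ] E) ≤ LinearMap.ker (A : E →ₗ[ℝ] E') := by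
    rintro _ ⟨ξ, rfl⟩; exact hAo ξ
  have h1 : finrank ℝ (LinearMap.range (o : F →ₗ[ℝ] E)) = finrank ℝ F :=
    LinearMap.finrank_range_of_inj ho
  have h2 := LinearMap.finrank_range_add_finrank_ker (A : E →ₗ[ℝ] E')
  have h3 : LinearMap.range (A : E →ₗ[ℝ] E') = ⊤ := LinearMap.range_eq_top.2 hA
  rw [h3, finrank_top] at h2
  have h4 := Submodule.eq_of_le_of_finrank_eq hle (by omega)
  have : v ∈ LinearMap.range (o : F →ₗ[ℝ] E) := by rw [h4]; exact hv
  exact this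

/-- Reflexivity of a finite-dimensional space; it yields the vector `P^♯(α)` from the functional
`P(α, ·)`. -/
lemma exists_forall_apply_eq (ℓ : (E →L[ℝ] ℝ) →ₗ[ℝ] ℝ) : ∃ p : E, ∀ β : E →L[ℝ] ℝ, β p = ℓ β := by
  refine ⟨(Module.evalEquiv ℝ E).symm
    (ℓ ∘ₗ (LinearMap.toContinuousLinearMap : (E →ₗ[ℝ] ℝ) ≃ₗ[ℝ] E →L[ℝ] ℝ).toLinearMap), fun β => ?_⟩
  have h := Module.apply_evalEquiv_symm_apply (R := ℝ) (M := E) (β : E →ₗ[ℝ] ℝ)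
    (ℓ ∘ₗ (LinearMap.toContinuousLinearMap : (E →ₗ[ℝ] ℝ) ≃ₗ[ℝ] E →L[ℝ] ℝ).toLinearMap)
  exact h

end LinearAlgebra

/-! ### Reduction of a bivector field along a local projection with a local section -/

section Reduction

variable {F : Type*} [NormedAddCommGroup F] [NormedSpace ℝ F] [FiniteDimensional ℝ F]
  {G : Type*} [TopologicalSpace G] [ChartedSpace F G] [Group G] [LieGroup 𝓘(ℝ, F) ∞ G]
  {E : Type*} [NormedAddCommGroup E] [NormedSpace ℝ E] [FiniteDimensional ℝ E]
  {M : Type*} [TopologicalSpace M] [ChartedSpace E M] [IsManifold 𝓘(ℝ, E) ∞ M] [T2Space M]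
  [MulAction G M] [ContMDiffSMul 𝓘(ℝ, F) 𝓘(ℝ, E) ∞ G M]
  {E' : Type*} [NormedAddCommGroup E'] [NormedSpace ℝ E'] [FiniteDimensional ℝ E']
  {X : Type*} [TopologicalSpace X] [ChartedSpace E' X] [IsManifold 𝓘(ℝ, E') ∞ X]

/-- Near `x`, the bilinear forms on `X` are the images of the bivector field on `M` under the
locally `G`-invariant map `q`, which has the local section `σ`. -/
structure IsReductionAt (G : Type*) [TopologicalSpace G] [Group G] {M : Type*} [TopologicalSpace M]
    [ChartedSpace E M] [MulAction G M] (P : BivectorField E M)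
    (B : X → LinearMap.BilinForm ℝ (E' →L[ℝ] ℝ)) (q : M → X) (σ : X → M) (x : X) : Prop where
  smooth_section : SmoothNear E' E σ x
  smooth_proj : SmoothNear E E' q (σ x)
  proj_section : ∀ᶠ y in 𝓝 x, q (σ y) = y
  invariant : ∀ᶠ w in 𝓝 (σ x), ∀ᶠ g in 𝓝 (1 : G), q (g • w) = q w
  form_eq : ∀ᶠ w in 𝓝 (σ x), ∀ α β : E' →L[ℝ] ℝ,
    B (q w) α β = P.pair w (α.comp (tmap E E' q w)) (β.comp (tmap E E' q w))
  finite_stabilizer : Finite (MulAction.stabilizer G (σ x))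

variable {P : BivectorField E M} {B : X → LinearMap.BilinForm ℝ (E' →L[ℝ] ℝ)} {q : M → X}
  {σ : X → M} {x : X}

namespace IsReductionAt

lemma proj_eq (h : IsReductionAt G P B q σ x) : q (σ x) = x := h.proj_section.self_of_nhds

lemma tendsto_section (h : IsReductionAt G P B q σ x) : Tendsto σ (𝓝 x) (𝓝 (σ x)) :=
  h.smooth_section.continuousAt

lemma tendsto_proj (h : IsReductionAt G P B q σ x) : Tendsto q (𝓝 (σ x)) (𝓝 x) := by
  have := h.smooth_proj.continuousAt
  rwa [ContinuousAt, h.proj_eq] at this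

lemma alternating (h : IsReductionAt G P B q σ x) (α : E' →L[ℝ] ℝ) : B x α α = 0 := by
  have := h.form_eq.self_of_nhds α α
  rwa [h.proj_eq, P.pair_self] at this

lemma tmap_proj_orb (h : IsReductionAt G P B q σ x) (ξ : F) :
    tmap E E' q (σ x) (orb F E G (σ x) ξ) = 0 :=
  tmap_orb_eq_zero h.smooth_proj h.invariant.self_of_nhds ξ

lemma tmap_proj_section (h : IsReductionAt G P B q σ x) (v : E') :
    tmap E E' q (σ x) (tmap E' E σ x v) = v :=
  DFunLike.congr_fun (tmap_comp_eq_id h.smooth_section h.smooth_proj h.proj_section) v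

lemma smoothNear_comp {E₂ : Type*} [NormedAddCommGroup E₂] [NormedSpace ℝ E₂]
    (h : IsReductionAt G P B q σ x) {f : X → E₂} (hf : SmoothNear E' E₂ f x) :
    SmoothNear E E₂ (f ∘ q) (σ x) :=
  SmoothNear.comp (by rwa [h.proj_eq]) h.smooth_proj

/-- By the chain rule, `form_eq` makes pullback by `q` compatible with the brackets. The identity
holds near `σ x`, so it can be differentiated and used in iterated brackets. -/
lemma bracket_comp (h : IsReductionAt G P B q σ x) {f g : X → ℝ} (hf : SmoothNear E' ℝ f x)
    (hg : SmoothNear E' ℝ g x) :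
    (fun y => B y (tmap E' ℝ f y) (tmap E' ℝ g y)) ∘ q =ᶠ[𝓝 (σ x)]
      P.bracket (f ∘ q) (g ∘ q) := by
  filter_upwards [h.form_eq, h.smooth_proj.eventually, h.tendsto_proj.eventually hf.eventually,
    h.tendsto_proj.eventually hg.eventually] with w h1 h2 h3 h4
  rw [P.bracket_eq_pair, h3.tmap_comp h2, h4.tmap_comp h2, ← h1]
  rfl

/-- The smoothness of the family `B` is not assumed: the bracket downstairs is the bracket upstairs
restricted to the section `σ`. -/
lemma smoothNear_bracket (h : IsReductionAt G P B q σ x) {f g : X → ℝ} (hf : SmoothNear E' ℝ f x)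
    (hg : SmoothNear E' ℝ g x) :
    SmoothNear E' ℝ (fun y => B y (tmap E' ℝ f y) (tmap E' ℝ g y)) x := by
  have h1 := (P.smoothNear_bracket (h.smoothNear_comp hf) (h.smoothNear_comp hg)).comp
    h.smooth_section
  refine h1.congr ?_
  filter_upwards [h.proj_section, h.tendsto_section.eventually (h.bracket_comp hf hg)] with y k1 k2
  rw [Function.comp_apply, ← k2, Function.comp_apply, k1]

end IsReductionAt

/-- The bivector field with the given local descriptions. -/
def reductionField (P : BivectorField E M) (B : X → LinearMap.BilinForm ℝ (E' →L[ℝ] ℝ))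
    (h : ∀ x, ∃ q σ, IsReductionAt G P B q σ x) : BivectorField E' X where
  form := B
  alternating x α := by
    obtain ⟨q, σ, hx⟩ := h x
    exact hx.alternating α
  smooth f g hf hg x := by
    obtain ⟨q, σ, hx⟩ := h x
    exact (hx.smoothNear_bracket (smoothNear_of_contMDiff hf x)
      (smoothNear_of_contMDiff hg x)).contMDiffAt

namespace IsReductionAt

lemma jacobiator_eq {Q : BivectorField E' X} (hQ : ∀ x, Q.form x = B x)
    (h : IsReductionAt G P B q σ x) [T2Space X] {f g k : X → ℝ} (hf : SmoothNear E' ℝ f x)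
    (hg : SmoothNear E' ℝ g x) (hk : SmoothNear E' ℝ k x) :
    Q.jacobiator f g k x = P.jacobiator (f ∘ q) (g ∘ q) (k ∘ q) (σ x) := by
  have key : ∀ {f g : X → ℝ}, SmoothNear E' ℝ f x → SmoothNear E' ℝ g x →
      Q.bracket f g ∘ q =ᶠ[𝓝 (σ x)] P.bracket (f ∘ q) (g ∘ q) := by
    intro f g hf hg
    have e : Q.bracket f g = fun y => B y (tmap E' ℝ f y) (tmap E' ℝ g y) := by
      funext y
      rw [← hQ]; rfl
    rw [e]
    exact h.bracket_comp hf hg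
  have key2 : ∀ {f g k : X → ℝ}, SmoothNear E' ℝ f x → SmoothNear E' ℝ g x →
      SmoothNear E' ℝ k x →
      Q.bracket (Q.bracket f g) k x = P.bracket (P.bracket (f ∘ q) (g ∘ q)) (k ∘ q) (σ x) := by
    intro f g k hf hg hk
    have h1 := (key (Q.smoothNear_bracket hf hg) hk).eq_of_nhds
    rw [Function.comp_apply, h.proj_eq] at h1
    rw [h1]
    exact (P.bracket_congr (key hf hg) (Eventually.of_forall fun _ => rfl)).eq_of_nhds
  unfold BivectorField.jacobiator
  rw [key2 hf hg hk, key2 hg hk hf, key2 hk hf hg]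

variable {κ : InvariantInnerProduct F G} {Φ : M → G}

/-- The jacobiator is that of the functions pulled back by `q`, whose differentials kill the orbit
directions. -/
lemma jacobiator_eq_zero (hΦ : IsHamiltonianQuasiPoisson κ P Φ)
    {Q : BivectorField E' X} (hQ : ∀ x, Q.form x = B x)
    (h : IsReductionAt G P B q σ x) [T2Space X] {f g k : X → ℝ} (hf : SmoothNear E' ℝ f x)
    (hg : SmoothNear E' ℝ g x) (hk : SmoothNear E' ℝ k x) :
    Q.jacobiator f g k x = 0 := by
  rw [h.jacobiator_eq hQ hf hg hk]
  have key : ∀ {f : X → ℝ}, SmoothNear E' ℝ f x → ∀ ξ : F,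
      tmap E ℝ (f ∘ q) (σ x) (orb F E G (σ x) ξ) = 0 := by
    intro f hf ξ
    rw [SmoothNear.tmap_comp (by rwa [h.proj_eq]) h.smooth_proj, ContinuousLinearMap.comp_apply,
      h.tmap_proj_orb, map_zero]
  exact hΦ.jacobiator_eq_zero (h.smoothNear_comp hf) (h.smoothNear_comp hg) (h.smoothNear_comp hk)
    (key hf) (key hg) (key hk)

/-- The reduced spaces are submanifolds, to which the reduced bivector field is tangent. -/
lemma exists_sliceChart_tangent [T2Space G] (hΦ : IsHamiltonianQuasiPoisson κ P Φ)
    (hE' : finrank ℝ E' + finrank ℝ F = finrank ℝ E) (h : IsReductionAt G P B q σ x)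
    {C : ConjClasses G} {d : ℕ}
    (hC : ∀ y ∈ C.carrier, ∃ c : G → EuclideanSpace ℝ (Fin d),
      SmoothNear F (EuclideanSpace ℝ (Fin d)) c y ∧
      Function.Surjective (tmap F (EuclideanSpace ℝ (Fin d)) c y) ∧
      ∀ᶠ z in 𝓝 y, (z ∈ C.carrier ↔ c z = 0))
    {S : Set X} (hS : ∀ᶠ w in 𝓝 (σ x), (q w ∈ S ↔ Φ w ∈ C.carrier)) (hx : x ∈ S) :
    ∃ (e : OpenPartialHomeomorph X E') (V : Submodule ℝ E'), x ∈ e.source ∧ IsSliceChart S e V ∧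
      finrank ℝ V = finrank ℝ E' - d ∧
      ∀ α : E' →L[ℝ] ℝ, ∃ v : E', (∀ β : E' →L[ℝ] ℝ, β v = B x α β) ∧ tmap E' E' e x v ∈ V := by
  have hm : Φ (σ x) ∈ C.carrier := by
    rw [← hS.self_of_nhds, h.proj_eq]; exact hx
  obtain ⟨c, hc, hcs, hcC⟩ := hC _ hm
  have hΦs : SmoothNear E F Φ (σ x) := smoothNear_of_contMDiff hΦ.smooth_moment _
  have hcΦ : SmoothNear E (EuclideanSpace ℝ (Fin d)) (c ∘ Φ) (σ x) := hc.comp hΦs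
  have hf : SmoothNear E' (EuclideanSpace ℝ (Fin d)) ((c ∘ Φ) ∘ σ) x := hcΦ.comp h.smooth_section
  -- The orbit of `σ x` is mapped by `Φ` into the class `C`, on which `c` vanishes near `Φ (σ x)`.
  have hcO : ∀ ξ : F, tmap E (EuclideanSpace ℝ (Fin d)) (c ∘ Φ) (σ x) (orb F E G (σ x) ξ) = 0 := by
    intro ξ
    refine tmap_orb_eq_zero hcΦ ?_ ξ
    have h1 : Tendsto (fun g : G => Φ (g • σ x)) (𝓝 1) (𝓝 (Φ (σ x))) := by
      have h2 := (contMDiff_orbitMap F E (G := G) (σ x)).continuous.tendsto 1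
      rw [one_smul] at h2
      exact hΦs.continuousAt.tendsto.comp h2
    filter_upwards [h1.eventually hcC] with g hg
    rw [Function.comp_apply, Function.comp_apply, hcC.self_of_nhds.1 hm, ← hg, hΦ.equivariant]
    rw [ConjClasses.mem_carrier_iff_mk_eq] at hm ⊢
    rw [← hm, ConjClasses.mk_eq_mk_iff_isConj]
    exact (isConj_iff.2 ⟨g, rfl⟩ : IsConj (Φ (σ x)) _).symm
  have hinj : Function.Injective (orb F E G (σ x)) := orb_injective h.finite_stabilizer
  have hqs : Function.Surjective (tmap E E' q (σ x)) := fun v => ⟨_, h.tmap_proj_section v⟩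
  -- Going to the quotient and back along the section changes a tangent vector by an orbit
  -- direction, which the derivative of `c ∘ Φ` does not see.
  have hdec : ∀ p : E, tmap E (EuclideanSpace ℝ (Fin d)) (c ∘ Φ) (σ x)
      (tmap E' E σ x (tmap E E' q (σ x) p)) =
        tmap E (EuclideanSpace ℝ (Fin d)) (c ∘ Φ) (σ x) p := by
    intro p
    obtain ⟨ξ, hξ⟩ := exists_eq_of_map_eq_zero (F := F) hE' hqs hinj h.tmap_proj_orb
      (v := tmap E' E σ x (tmap E E' q (σ x) p) - p)
      (by rw [map_sub, h.tmap_proj_section, sub_self])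
    have := hcO ξ
    rw [hξ, map_sub, sub_eq_zero] at this
    exact this
  have hft : tmap E' (EuclideanSpace ℝ (Fin d)) ((c ∘ Φ) ∘ σ) x =
      (tmap E (EuclideanSpace ℝ (Fin d)) (c ∘ Φ) (σ x)).comp (tmap E' E σ x) :=
    hcΦ.tmap_comp h.smooth_section
  have hcΦt : tmap E (EuclideanSpace ℝ (Fin d)) (c ∘ Φ) (σ x) =
      (tmap F (EuclideanSpace ℝ (Fin d)) c (Φ (σ x))).comp (tmap E F Φ (σ x)) := hc.tmap_comp hΦs
  have hsurj : Function.Surjective (tmap E' (EuclideanSpace ℝ (Fin d)) ((c ∘ Φ) ∘ σ) x) := by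
    intro y
    obtain ⟨z, rfl⟩ := hcs y
    obtain ⟨p, rfl⟩ := hΦ.tmap_moment_surjective h.finite_stabilizer z
    refine ⟨tmap E E' q (σ x) p, ?_⟩
    rw [hft, ContinuousLinearMap.comp_apply, hdec, hcΦt]
    rfl
  obtain ⟨e, V, hxe, hslice, hdim, htan⟩ := exists_isSliceChart hf hsurj (S := S) (by
    filter_upwards [h.proj_section, h.tendsto_section.eventually hS,
      (hΦs.continuousAt.tendsto.comp h.tendsto_section).eventually hcC] with y k1 k2 k3
    rw [k1] at k2
    rw [k2]; exact k3)
  refine ⟨e, V, hxe, hslice, by rw [hdim, finrank_euclideanSpace_fin], fun α => ?_⟩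
  set A := tmap E E' q (σ x) with hA
  -- The vector `p` is `P^♯(q^*α)` at `σ x`, and its projection `A p` is the sharp of `α`
  -- downstairs.
  obtain ⟨p, hp'⟩ : ∃ p : E, ∀ β : E →L[ℝ] ℝ, β p = P.pair (σ x) (α.comp A) β :=
    exists_forall_apply_eq (E := E) (P.form (σ x) (α.comp A))
  refine ⟨A p, fun β => ?_, htan _ ?_⟩
  · have h1 := h.form_eq.self_of_nhds α β
    rw [h.proj_eq] at h1
    rw [h1]
    exact hp' (β.comp A)
  · rw [hft, ContinuousLinearMap.comp_apply, hdec]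
    by_contra hne
    obtain ⟨l, hl⟩ := SeparatingDual.exists_ne_zero (R := ℝ) hne
    apply hl
    have hls : SmoothNear F ℝ (l ∘ c) (Φ (σ x)) :=
      (smoothNear_of_contDiff l.contDiff _).comp hc
    have hlt : tmap F ℝ (l ∘ c) (Φ (σ x)) =
        l.comp (tmap F (EuclideanSpace ℝ (Fin d)) c (Φ (σ x))) := by
      rw [SmoothNear.tmap_comp (smoothNear_of_contDiff l.contDiff _) hc, tmap_clm]
    obtain ⟨ξ, hξ, -⟩ := hΦ.exists_moment hls
    have h1 := hp' (l.comp (tmap E (EuclideanSpace ℝ (Fin d)) (c ∘ Φ) (σ x)))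
    rw [hcΦt, ← ContinuousLinearMap.comp_assoc, ← hlt, P.pair_swap, hξ,
      ContinuousLinearMap.comp_apply α, h.tmap_proj_orb, map_zero, neg_zero] at h1
    rw [hcΦt]
    rw [hlt] at h1
    exact h1

end IsReductionAt

variable {κ : InvariantInnerProduct F G} {Φ : M → G}

lemma isPoisson_of_isReductionAt (hΦ : IsHamiltonianQuasiPoisson κ P Φ) [T2Space X]
    {Q : BivectorField E' X} (hQ : ∀ x, Q.form x = B x)
    (h : ∀ x, ∃ q σ, IsReductionAt G P B q σ x) : Q.IsPoisson := by
  intro f g k hf hg hk x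
  obtain ⟨q, σ, hx⟩ := h x
  exact hx.jacobiator_eq_zero hΦ hQ (smoothNear_of_contMDiff hf x)
    (smoothNear_of_contMDiff hg x) (smoothNear_of_contMDiff hk x)

/-- Tangency is checked in one slice chart at each point and transferred to the others by
`IsSliceChart.tmap_mem`. The dimension formula is only required when `X` has a point, because it can
fail for an empty locus. -/
lemma isPoissonSubmanifold_of_isReductionAt [T2Space G] (hΦ : IsHamiltonianQuasiPoisson κ P Φ)
    (hE' : X → finrank ℝ E' + finrank ℝ F = finrank ℝ E) {Q : BivectorField E' X}
    (hQ : ∀ x, Q.form x = B x) {C : ConjClasses G} {d : ℕ}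
    (hC : ∀ y ∈ C.carrier, ∃ c : G → EuclideanSpace ℝ (Fin d),
      SmoothNear F (EuclideanSpace ℝ (Fin d)) c y ∧
      Function.Surjective (tmap F (EuclideanSpace ℝ (Fin d)) c y) ∧
      ∀ᶠ z in 𝓝 y, (z ∈ C.carrier ↔ c z = 0)) {S : Set X}
    (h : ∀ x, ∃ q σ, IsReductionAt G P B q σ x ∧
      ∀ᶠ w in 𝓝 (σ x), (q w ∈ S ↔ Φ w ∈ C.carrier)) :
    IsPoissonSubmanifold Q (finrank ℝ E' - d) S := by
  refine ⟨fun x hx => ?_, fun e' V' hs' x hx hxe' α => ?_⟩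
  · obtain ⟨q, σ, hr, hS⟩ := h x
    obtain ⟨e, V, h1, h2, h3, -⟩ := hr.exists_sliceChart_tangent hΦ (hE' x) hC hS hx
    exact ⟨e, V, h1, h2, h3⟩
  · obtain ⟨q, σ, hr, hS⟩ := h x
    obtain ⟨e, V, h1, h2, h3, h4⟩ := hr.exists_sliceChart_tangent hΦ (hE' x) hC hS hx
    obtain ⟨v, h5, h6⟩ := h4 α
    refine ⟨v, fun β => ?_, h2.tmap_mem hs' hx h1 hxe' h6⟩
    rw [hQ]; exact h5 β

end Reduction

/-! ### Push-forward of bivectors by linear maps, and corestriction to open subsets -/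

section Pullback

variable {E E' : Type*} [NormedAddCommGroup E] [NormedSpace ℝ E] [NormedAddCommGroup E']
  [NormedSpace ℝ E'] {M : Type*} [TopologicalSpace M] [ChartedSpace E M]

/-- The image of the bivector `P w` under the linear map `A`. -/
def BivectorField.push (P : BivectorField E M) (w : M) (A : E →L[ℝ] E') :
    LinearMap.BilinForm ℝ (E' →L[ℝ] ℝ) :=
  let L : (E' →L[ℝ] ℝ) →ₗ[ℝ] (E →L[ℝ] ℝ) :=
    { toFun := fun α => α.comp A
      map_add' := fun _ _ => rfl
      map_smul' := fun _ _ => rfl }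
  LinearMap.compl₁₂ (show LinearMap.BilinForm ℝ (E →L[ℝ] ℝ) from P.form w) L L

lemma BivectorField.push_apply (P : BivectorField E M) (w : M) (A : E →L[ℝ] E')
    (α β : E' →L[ℝ] ℝ) : P.push w A α β = P.pair w (α.comp A) (β.comp A) := rfl

/-- A map to an open subset, from a map to the ambient space that takes values there. -/
def codRestrictOpens {M : Type*} (D : Opens E') (d₀ : D) (q : M → E') (w : M) : D :=
  open Classical in if h : q w ∈ D then ⟨q w, h⟩ else d₀

lemma val_codRestrictOpens {M : Type*} {D : Opens E'} (d₀ : D) {q : M → E'} {w : M} (h : q w ∈ D) :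
    (codRestrictOpens D d₀ q w : E') = q w := by
  rw [codRestrictOpens, dif_pos h]

lemma eventually_val_codRestrictOpens {D : Opens E'} (d₀ : D) {q : M → E'} {w : M}
    (hq : ContinuousAt q w) (h : q w ∈ D) :
    Subtype.val ∘ codRestrictOpens D d₀ q =ᶠ[𝓝 w] q := by
  filter_upwards [hq.eventually (D.isOpen.mem_nhds h)] with y hy using val_codRestrictOpens d₀ hy

lemma smoothNear_codRestrictOpens {D : Opens E'} (d₀ : D) {q : M → E'} {w : M}
    (hq : SmoothNear E E' q w) (h : q w ∈ D) : SmoothNear E E' (codRestrictOpens D d₀ q) w :=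
  smoothNear_val_comp_iff.1 (hq.congr (eventually_val_codRestrictOpens d₀ hq.continuousAt h))

lemma tmap_codRestrictOpens {D : Opens E'} (d₀ : D) {q : M → E'} {w : M}
    (hq : SmoothNear E E' q w) (h : q w ∈ D) :
    tmap E E' (codRestrictOpens D d₀ q) w = tmap E E' q w := by
  rw [← tmap_val_comp (smoothNear_codRestrictOpens d₀ hq h)]
  exact tmap_congr (eventually_val_codRestrictOpens d₀ hq.continuousAt h)

end Pullback

/-! ### Lifts to a slice, and the bivector they induce on it -/

section SliceForm

variable {F : Type*} [NormedAddCommGroup F] [NormedSpace ℝ F] [FiniteDimensional ℝ F]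
  {G : Type*} [TopologicalSpace G] [ChartedSpace F G] [Group G] [LieGroup 𝓘(ℝ, F) ∞ G]
  {E : Type*} [NormedAddCommGroup E] [NormedSpace ℝ E] [FiniteDimensional ℝ E]
  {M : Type*} [TopologicalSpace M] [ChartedSpace E M] [IsManifold 𝓘(ℝ, E) ∞ M] [T2Space M]
  [MulAction G M] [ContMDiffSMul 𝓘(ℝ, F) 𝓘(ℝ, E) ∞ G M]
  {E' : Type*} [NormedAddCommGroup E'] [NormedSpace ℝ E'] [FiniteDimensional ℝ E']

namespace Slice

lemma stabilizer_le {m : M} (s : Slice E E' G m) {u : E'} (hu : u ∈ s.dom) :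
    MulAction.stabilizer G (s.σ u) ≤ MulAction.stabilizer G m := fun g hg =>
  (s.exists_of_smul_eq u hu u hu g hg).1

lemma finite_stabilizer {m : M} (s : Slice E E' G m) (hm : Finite (MulAction.stabilizer G m))
    {u : E'} (hu : u ∈ s.dom) : Finite (MulAction.stabilizer G (s.σ u)) :=
  Finite.of_injective _ (Subgroup.inclusion_injective (s.stabilizer_le hu))

/-- `q` is a smooth map near `w` to the parameter space of the slice, over the orbit space. -/
def IsLiftAt {m : M} (s : Slice E E' G m) (q : M → E') (w : M) : Prop :=
  SmoothNear E E' q w ∧ ∀ᶠ y in 𝓝 w, q y ∈ s.dom ∧ ∃ g : G, g • s.σ (q y) = y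

variable {m : M} {s : Slice E E' G m} {q q' : M → E'} {w : M}

lemma IsLiftAt.eventually (h : s.IsLiftAt q w) : ∀ᶠ y in 𝓝 w, s.IsLiftAt q y := by
  filter_upwards [h.1.eventually, h.2.eventually_nhds] with y h1 h2 using ⟨h1, h2⟩

lemma IsLiftAt.congr (h : s.IsLiftAt q w) (hq : q' =ᶠ[𝓝 w] q) : s.IsLiftAt q' w := by
  refine ⟨h.1.congr hq, ?_⟩
  filter_upwards [h.2, hq] with y h1 h2
  rwa [h2]

/-- Two lifts differ by the action of the stabilizer. -/
lemma IsLiftAt.exists_eq (hm : Finite (MulAction.stabilizer G m)) (h : s.IsLiftAt q w)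
    (h' : s.IsLiftAt q' w) : ∃ γ, q w = s.ρ γ (q' w) ∧
      tmap E E' q w = (s.ρ γ).comp (tmap E E' q' w) := by
  -- The element of the stabilizer found below depends on the point `y`; the pigeonhole lemma
  -- provides one that works to first order at `w`.
  refine exists_eq_tmap_of_finite s.ρ h.1 h'.1 ?_
  filter_upwards [h.2, h'.2] with y ⟨h1, g, h2⟩ ⟨h3, g', h4⟩
  obtain ⟨h5, h6⟩ := s.exists_of_smul_eq (q' y) h3 (q y) h1 (g⁻¹ * g') (by
    rw [mul_smul, h4, inv_smul_eq_iff, h2])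
  exact ⟨_, h6.symm⟩

/-- Lifts are locally invariant. -/
lemma IsLiftAt.invariant (F : Type*) [NormedAddCommGroup F] [NormedSpace ℝ F]
    [ChartedSpace F G] [ContMDiffSMul 𝓘(ℝ, F) 𝓘(ℝ, E) ∞ G M]
    (hm : Finite (MulAction.stabilizer G m)) (h : s.IsLiftAt q w) :
    ∀ᶠ g in 𝓝 (1 : G), q (g • w) = q w := by
  have h1 : Tendsto (fun g : G => g • w) (𝓝 1) (𝓝 w) := by
    have h2 := (contMDiff_orbitMap F E (G := G) w).continuous.tendsto 1
    rwa [one_smul] at h2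
  -- The values `q (g • w)` lie in the finite orbit of `q w` under the stabilizer, so by continuity
  -- they are equal to `q w` for `g` near 1.
  have hfin : (Set.range (fun γ => s.ρ γ (q w)) \ {q w}).Finite := (Set.finite_range _).sdiff
  have hmem : (Set.range (fun γ => s.ρ γ (q w)) \ {q w})ᶜ ∈ 𝓝 (q w) :=
    hfin.isClosed.isOpen_compl.mem_nhds fun hh => hh.2 rfl
  obtain ⟨k1, g₀, k2⟩ := h.2.self_of_nhds
  filter_upwards [h1.eventually h.2, h1.eventually (h.1.continuousAt.eventually hmem)]
    with g ⟨h3, g', h4⟩ h5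
  obtain ⟨h6, h7⟩ := s.exists_of_smul_eq (q w) k1 (q (g • w)) h3 (g'⁻¹ * (g * g₀)) (by
    rw [mul_smul, mul_smul, k2, inv_smul_eq_iff, h4])
  by_contra hne
  exact h5 ⟨⟨_, h7⟩, hne⟩

lemma exists_isLiftAt (s : Slice E E' G m) {u : E'} (hu : u ∈ s.dom) :
    ∃ q : M → E', s.IsLiftAt q (s.σ u) ∧ ∀ᶠ v in 𝓝 u, q (s.σ v) = v := by
  obtain ⟨q, h1, h2, h3⟩ := s.exists_lift u hu
  exact ⟨q, ⟨h1, h3⟩, h2⟩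

lemma tendsto_σ (s : Slice E E' G m) {u : E'} (hu : u ∈ s.dom) :
    Tendsto s.σ (𝓝 u) (𝓝 (s.σ u)) := (s.smooth u hu).continuousAt

lemma IsLiftAt.comp_smul (F : Type*) [NormedAddCommGroup F] [NormedSpace ℝ F]
    [ChartedSpace F G] [ContMDiffSMul 𝓘(ℝ, F) 𝓘(ℝ, E) ∞ G M]
    (h : s.IsLiftAt q w) (g : G) :
    s.IsLiftAt (fun y => q (g⁻¹ • y)) (g • w) := by
  have h0 : g⁻¹ • g • w = w := inv_smul_smul g w
  have h1 := smoothNear_of_contMDiff (contMDiff_smul_const F E (M := M) g⁻¹) (g • w)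
  have h2 : Tendsto (fun y : M => g⁻¹ • y) (𝓝 (g • w)) (𝓝 w) := by
    have := h1.continuousAt; rwa [ContinuousAt, h0] at this
  refine ⟨SmoothNear.comp (g := q) (by rw [h0]; exact h.1) h1, ?_⟩
  filter_upwards [h2.eventually h.2] with y ⟨k1, g', k2⟩
  exact ⟨k1, g * g', by rw [mul_smul, k2, smul_inv_smul]⟩

/-- A standard lift at a point of the slice. -/
def lift (s : Slice E E' G m) (u : E') : M → E' :=
  Classical.epsilon fun q => s.IsLiftAt q (s.σ u) ∧ ∀ᶠ v in 𝓝 u, q (s.σ v) = v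

lemma isLiftAt_lift (s : Slice E E' G m) {u : E'} (hu : u ∈ s.dom) :
    s.IsLiftAt (s.lift u) (s.σ u) := (Classical.epsilon_spec (s.exists_isLiftAt hu)).1

lemma lift_σ (s : Slice E E' G m) {u : E'} (hu : u ∈ s.dom) :
    ∀ᶠ v in 𝓝 u, s.lift u (s.σ v) = v := (Classical.epsilon_spec (s.exists_isLiftAt hu)).2

lemma tmap_lift_σ (s : Slice E E' G m) {u : E'} (hu : u ∈ s.dom) (v : E') :
    tmap E E' (s.lift u) (s.σ u) (tmap E' E s.σ u v) = v :=
  DFunLike.congr_fun (tmap_comp_eq_id (s.smooth u hu) (s.isLiftAt_lift hu).1 (s.lift_σ hu)) v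

lemma tmap_lift_orb (hm : Finite (MulAction.stabilizer G m)) {u : E'} (hu : u ∈ s.dom) (ξ : F) :
    tmap E E' (s.lift u) (s.σ u) (orb F E G (s.σ u) ξ) = 0 :=
  tmap_orb_eq_zero (s.isLiftAt_lift hu).1 ((s.isLiftAt_lift hu).invariant F hm) ξ

/-- The image under the local projections to the slice of the bivector field on `M`. -/
def form (s : Slice E E' G m) (P : BivectorField E M) (u : E') :
    LinearMap.BilinForm ℝ (E' →L[ℝ] ℝ) :=
  P.push (s.σ u) (tmap E E' (s.lift u) (s.σ u))

variable (F) in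
/-- The projection to the slice is equivariant for the stabilizer. -/
lemma tmap_lift_smul [T2Space G] (hE' : finrank ℝ E' + finrank ℝ F = finrank ℝ E)
    (hm : Finite (MulAction.stabilizer G m)) {u : E'} (hu : u ∈ s.dom)
    (γ : MulAction.stabilizer G m) (hγ : s.ρ γ u = u) :
    (tmap E E' (s.lift u) (s.σ u)).comp (tmap E E (fun x : M => (γ : G) • x) (s.σ u)) =
      (s.ρ γ).comp (tmap E E' (s.lift u) (s.σ u)) := by
  set A := tmap E E' (s.lift u) (s.σ u) with hA
  have hfix : (γ : G) • s.σ u = s.σ u := by rw [← s.equivariant γ u hu, hγ]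
  have hinj : Function.Injective (orb F E G (s.σ u)) := orb_injective (s.finite_stabilizer hm hu)
  have hAs : Function.Surjective A := fun v => ⟨_, s.tmap_lift_σ hu v⟩
  ext p
  -- A tangent vector is split into an orbit direction and a vector along the slice. Both maps kill
  -- the former, as isotropy preserves orbit directions, and on the latter the equivariance of `σ`
  -- applies.
  obtain ⟨ξ, hξ⟩ := exists_eq_of_map_eq_zero (F := F) hE' hAs hinj (s.tmap_lift_orb hm hu)
    (v := p - tmap E' E s.σ u (A p)) (by rw [map_sub, hA, s.tmap_lift_σ hu, sub_self])
  have hp : p = orb F E G (s.σ u) ξ + tmap E' E s.σ u (A p) := by rw [hξ]; abel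
  obtain ⟨η, hη⟩ := isotropy_orb (F := F) (E := E) (G := G) (s.σ u) ⟨γ, hfix⟩ ξ
  rw [isotropy_apply] at hη
  have h1 := SmoothNear.tmap_comp (f := s.σ) (x := u)
    (smoothNear_of_contMDiff (contMDiff_smul_const F E (M := M) (γ : G)) (s.σ u)) (s.smooth u hu)
  have h2 := SmoothNear.tmap_comp (g := s.σ) (f := s.ρ γ) (x := u)
    (by rw [hγ]; exact s.smooth u hu) (smoothNear_of_contDiff (s.ρ γ).contDiff u)
  have h3 : (fun x : M => (γ : G) • x) ∘ s.σ =ᶠ[𝓝 u] s.σ ∘ s.ρ γ := by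
    filter_upwards [s.dom.isOpen.mem_nhds hu] with v hv using (s.equivariant γ v hv).symm
  rw [tmap_congr h3, h2, hγ, tmap_clm] at h1
  have h4 := DFunLike.congr_fun h1 (A p)
  simp only [ContinuousLinearMap.comp_apply] at h4 hη ⊢
  rw [hp, map_add, map_add, hη, ← h4, s.tmap_lift_orb hm hu, zero_add, s.tmap_lift_σ hu, map_add,
    s.tmap_lift_orb hm hu, zero_add, s.tmap_lift_σ hu]

variable {κ : InvariantInnerProduct F G} {P : BivectorField E M} {Φ : M → G}

/-- All lifts map the bivector field on `M` to the same bivector on the slice. -/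
lemma IsLiftAt.form_eq [T2Space G] (hΦ : IsHamiltonianQuasiPoisson κ P Φ)
    (hE' : finrank ℝ E' + finrank ℝ F = finrank ℝ E)
    (hm : Finite (MulAction.stabilizer G m)) (h : s.IsLiftAt q w) :
    s.form P (q w) = P.push w (tmap E E' q w) := by
  obtain ⟨hu, g, hg⟩ := h.2.self_of_nhds
  set u := q w with hu'
  set A := tmap E E' (s.lift u) (s.σ u) with hA
  -- The lift `q` is compared with the translate by `g` of the standard lift at `u`. They differ to
  -- first order by some `γ` that fixes `u`, and the invariance of `P` under `g⁻¹` and under `γ`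
  -- absorbs both.
  have h1 := (s.isLiftAt_lift hu).comp_smul F g
  rw [hg] at h1
  obtain ⟨γ, h2, h3⟩ := h.exists_eq hm h1
  have hσ : g⁻¹ • w = s.σ u := by rw [inv_smul_eq_iff, hg]
  have h4 : s.lift u (g⁻¹ • w) = u := by rw [hσ]; exact (s.lift_σ hu).self_of_nhds
  rw [h4, ← hu'] at h2
  have h5 : tmap E E' (fun y => s.lift u (g⁻¹ • y)) w =
      A.comp (tmap E E (fun y : M => g⁻¹ • y) w) := by
    have := SmoothNear.tmap_comp (g := s.lift u) (f := fun y : M => g⁻¹ • y) (x := w)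
      (by rw [hσ]; exact (s.isLiftAt_lift hu).1)
      (smoothNear_of_contMDiff (contMDiff_smul_const F E (M := M) g⁻¹) w)
    rw [hσ] at this
    exact this
  have h6 := s.tmap_lift_smul F hE' hm hu γ h2.symm
  have hfix : (γ : G) • s.σ u = s.σ u := by rw [← s.equivariant γ u hu, ← h2]
  rw [h3, h5]
  ext α β
  have h7 := hΦ.pair_smul g⁻¹ w ((α.comp (s.ρ γ)).comp A) ((β.comp (s.ρ γ)).comp A)
  have h8 := hΦ.pair_smul γ (s.σ u) (α.comp A) (β.comp A)
  rw [hσ] at h7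
  rw [hfix] at h8
  simp only [ContinuousLinearMap.comp_assoc] at h7 h8
  rw [P.push_apply, h7]
  change P.pair (s.σ u) (α.comp A) (β.comp A) = _
  rw [← h8, h6]

/-- The slice is a reduction of the bivector field on `M`. -/
lemma exists_isReductionAt [T2Space G] (hΦ : IsHamiltonianQuasiPoisson κ P Φ)
    (hE' : finrank ℝ E' + finrank ℝ F = finrank ℝ E)
    (hm : Finite (MulAction.stabilizer G m)) {D : Opens E'} (hD : D = s.dom) (u : D) :
    ∃ (q : M → D) (σ : D → M), IsReductionAt G P (fun v : D => s.form P v) q σ u ∧ σ u = s.σ u ∧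
      ∀ᶠ w in 𝓝 (s.σ u), s.IsLiftAt (fun y => (q y : E')) w := by
  -- A separate `D` is needed since the domain of an orbifold chart is only propositionally equal to
  -- that of its slice.
  subst hD
  have hq := s.isLiftAt_lift u.2
  have hqu : s.lift u (s.σ u) = u := (s.lift_σ u.2).self_of_nhds
  have hqm : s.lift u (s.σ u) ∈ s.dom := by rw [hqu]; exact u.2
  have hqe := eventually_val_codRestrictOpens u hq.1.continuousAt hqm
  have hl : s.IsLiftAt (fun y => (codRestrictOpens s.dom u (s.lift u) y : E')) (s.σ u) := hq.congr hqe
  have hcs := smoothNear_codRestrictOpens u hq.1 hqm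
  refine ⟨codRestrictOpens s.dom u (s.lift u), fun v => s.σ v,
    ⟨smoothNear_comp_val_iff.2 (s.smooth u u.2), hcs, ?_, ?_, ?_, s.finite_stabilizer hm u.2⟩, rfl,
    hl.eventually⟩
  · filter_upwards [continuous_subtype_val.continuousAt.eventually (s.lift_σ u.2)] with v hv
    refine Subtype.ext ?_
    rw [val_codRestrictOpens u (by rw [hv]; exact v.2), hv]
  · filter_upwards [hl.eventually] with w hw
    exact (hw.invariant F hm).mono fun g hg => Subtype.ext hg
  · filter_upwards [hl.eventually, hcs.eventually] with w hw hw' α β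
    rw [hw.form_eq hΦ hE' hm, tmap_val_comp hw']
    rfl

end Slice
end SliceForm

/-! ### Topology of the orbit space -/

section OrbitSpace

variable {G : Type*} [Group G] {M : Type*} [MulAction G M]

lemma mk_eq_mk_iff {x y : M} : (Quotient.mk (MulAction.orbitRel G M) x : OrbitSpace G M) =
    Quotient.mk (MulAction.orbitRel G M) y ↔ ∃ g : G, g • y = x := by
  rw [Quotient.eq (r := MulAction.orbitRel G M), MulAction.orbitRel_apply]
  rfl

lemma mk_smul (g : G) (x : M) : (Quotient.mk (MulAction.orbitRel G M) (g • x) : OrbitSpace G M) =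
    Quotient.mk (MulAction.orbitRel G M) x := mk_eq_mk_iff.2 ⟨g, rfl⟩

lemma mk_mem_reducedSpace_iff {Φ : M → G} (hΦ : ∀ (g : G) (m : M), Φ (g • m) = g * Φ m * g⁻¹)
    {C : ConjClasses G} {x : M} :
    (Quotient.mk (MulAction.orbitRel G M) x : OrbitSpace G M) ∈ reducedSpace Φ C ↔
      Φ x ∈ C.carrier := by
  refine ⟨?_, fun h => ⟨x, h, rfl⟩⟩
  rintro ⟨y, hy, hyx⟩
  obtain ⟨g, rfl⟩ := mk_eq_mk_iff.1 hyx
  have hy' : Φ (g • x) ∈ C.carrier := hy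
  rw [ConjClasses.mem_carrier_iff_mk_eq] at hy' ⊢
  rw [← hy', ConjClasses.mk_eq_mk_iff_isConj, hΦ]
  exact isConj_iff.2 ⟨g, rfl⟩

variable [TopologicalSpace M]

lemma continuous_orbitMap (U : Opens M) : Continuous (orbitMap G U) :=
  (continuous_quot_mk.comp continuous_subtype_val).subtype_mk _

lemma isOpenMap_orbitMap [ContinuousConstSMul G M] (U : Opens M) : IsOpenMap (orbitMap G U) := by
  intro O hO
  have h1 := (MulAction.isOpenQuotientMap_quotientMk (Γ := G) (T := M)).isOpenMap _
    (U.isOpen.isOpenMap_subtype_val O hO)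
  refine isOpen_induced_iff.2 ⟨_, h1, ?_⟩
  ext y
  constructor
  · rintro ⟨_, ⟨u, hu, rfl⟩, h⟩
    exact ⟨u, hu, Subtype.ext h⟩
  · rintro ⟨u, hu, rfl⟩
    exact ⟨_, ⟨u, hu, rfl⟩, rfl⟩

lemma surjective_orbitMap (U : Opens M) : Function.Surjective (orbitMap G U) := by
  rintro ⟨_, x, hx, rfl⟩
  exact ⟨⟨x, hx⟩, rfl⟩

/-- The orbit space of a continuous action of a compact group is a Hausdorff space. -/
lemma t2Space_orbitSpace [TopologicalSpace G] [CompactSpace G] [T2Space M] [ContinuousSMul G M] :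
    T2Space (OrbitSpace G M) := by
  rw [t2Space_iff_of_isOpenQuotientMap (MulAction.isOpenQuotientMap_quotientMk (Γ := G) (T := M))]
  -- The orbit relation is the projection of this closed set along the compact factor `G`, hence
  -- closed; and the quotient map is open.
  have h1 : IsClosed {p : G × M × M | p.1 • p.2.2 = p.2.1} :=
    isClosed_eq (by fun_prop) (by fun_prop)
  convert isClosedMap_snd_of_compactSpace _ h1 using 1
  ext p
  constructor
  · intro h
    obtain ⟨g, hg⟩ := mk_eq_mk_iff.1 h
    exact ⟨(g, p), hg, rfl⟩
  · rintro ⟨⟨g, p⟩, hg, rfl⟩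
    exact mk_eq_mk_iff.2 ⟨g, hg⟩

end OrbitSpace

/-! ### Openness of the free and the locally free locus -/

section Loci

variable {F : Type*} [NormedAddCommGroup F] [NormedSpace ℝ F] [FiniteDimensional ℝ F]
  {G : Type*} [TopologicalSpace G] [ChartedSpace F G] [Group G] [LieGroup 𝓘(ℝ, F) ∞ G]
  [T2Space G] {E : Type*} [NormedAddCommGroup E] [NormedSpace ℝ E] [FiniteDimensional ℝ E]
  {M : Type*} [TopologicalSpace M] [ChartedSpace E M] [IsManifold 𝓘(ℝ, E) ∞ M] [T2Space M]
  [MulAction G M] [ContMDiffSMul 𝓘(ℝ, F) 𝓘(ℝ, E) ∞ G M]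

/-- The injectivity of the infinitesimal action at `m` gives `dim G ≤ dim M`. Without a point of
finite stabilizer the difference may be truncated to 0. -/
lemma finrank_model_add (F E : Type*) [NormedAddCommGroup F] [NormedSpace ℝ F]
    [FiniteDimensional ℝ F] [NormedAddCommGroup E] [NormedSpace ℝ E] [FiniteDimensional ℝ E]
    {G : Type*} [TopologicalSpace G] [ChartedSpace F G] [Group G] [LieGroup 𝓘(ℝ, F) ∞ G]
    [T2Space G] {M : Type*} [TopologicalSpace M] [ChartedSpace E M] [IsManifold 𝓘(ℝ, E) ∞ M]
    [T2Space M] [MulAction G M] [ContMDiffSMul 𝓘(ℝ, F) 𝓘(ℝ, E) ∞ G M] {m : M}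
    (hm : Finite (MulAction.stabilizer G m)) :
    finrank ℝ (EuclideanSpace ℝ (Fin (finrank ℝ E - finrank ℝ F))) + finrank ℝ F =
      finrank ℝ E := by
  have := LinearMap.finrank_le_finrank_of_injective (f := (orb F E G m : F →ₗ[ℝ] E))
    (orb_injective hm)
  rw [finrank_euclideanSpace_fin]
  omega

namespace Slice

variable {E' : Type*} [NormedAddCommGroup E'] [NormedSpace ℝ E'] [FiniteDimensional ℝ E'] {m : M}

lemma exists_isLiftAt_base (s : Slice E E' G m) : ∃ q : M → E', s.IsLiftAt q m := by
  have := s.isLiftAt_lift s.zero_mem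
  rw [s.σ_zero] at this
  exact ⟨_, this⟩

/-- Every point near `m` can be moved into the slice, where the stabilizers are contained in that of
`m`. -/
lemma stabilizer_conj_eventually (s : Slice E E' G m) :
    ∀ᶠ w in 𝓝 m, ∃ g : G, MulAction.stabilizer G (g • w) ≤ MulAction.stabilizer G m := by
  obtain ⟨q, hq⟩ := s.exists_isLiftAt_base
  filter_upwards [hq.2] with w ⟨h1, g, h2⟩
  refine ⟨g⁻¹, ?_⟩
  rw [inv_smul_eq_iff.2 h2.symm]
  exact s.stabilizer_le h1

end Slice

lemma finite_stabilizer_smul {G : Type*} [Group G] {M : Type*} [MulAction G M] {g : G} {w : M}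
    (h : Finite (MulAction.stabilizer G (g • w))) : Finite (MulAction.stabilizer G w) :=
  Finite.of_equiv _ (MulAction.stabilizerEquivStabilizer (g := g) (a := w) rfl).toEquiv.symm

lemma isOpen_locallyFreeLocus (F E : Type*) [NormedAddCommGroup F] [NormedSpace ℝ F]
    [FiniteDimensional ℝ F] [NormedAddCommGroup E] [NormedSpace ℝ E] [FiniteDimensional ℝ E]
    {G : Type*} [TopologicalSpace G] [ChartedSpace F G] [Group G] [LieGroup 𝓘(ℝ, F) ∞ G]
    [T2Space G] [CompactSpace G] {M : Type*} [TopologicalSpace M] [ChartedSpace E M]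
    [IsManifold 𝓘(ℝ, E) ∞ M] [T2Space M] [MulAction G M] [ContMDiffSMul 𝓘(ℝ, F) 𝓘(ℝ, E) ∞ G M] :
    IsOpen (locallyFreeLocus G M) := by
  rw [isOpen_iff_mem_nhds]
  intro m hm
  obtain ⟨s⟩ := exists_slice F (finrank_model_add F E hm) hm
  filter_upwards [s.stabilizer_conj_eventually] with w ⟨g, hg⟩
  have : Finite (MulAction.stabilizer G m) := hm
  exact finite_stabilizer_smul (g := g) (Finite.of_injective _ (Subgroup.inclusion_injective hg))

lemma isOpen_freeLocus (F E : Type*) [NormedAddCommGroup F] [NormedSpace ℝ F]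
    [FiniteDimensional ℝ F] [NormedAddCommGroup E] [NormedSpace ℝ E] [FiniteDimensional ℝ E]
    {G : Type*} [TopologicalSpace G] [ChartedSpace F G] [Group G] [LieGroup 𝓘(ℝ, F) ∞ G]
    [T2Space G] [CompactSpace G] {M : Type*} [TopologicalSpace M] [ChartedSpace E M]
    [IsManifold 𝓘(ℝ, E) ∞ M] [T2Space M] [MulAction G M] [ContMDiffSMul 𝓘(ℝ, F) 𝓘(ℝ, E) ∞ G M] :
    IsOpen (freeLocus G M) := by
  rw [isOpen_iff_mem_nhds]
  intro m hm
  have hm' : MulAction.stabilizer G m = ⊥ := hm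
  have hf : Finite (MulAction.stabilizer G m) := by rw [hm']; infer_instance
  obtain ⟨s⟩ := exists_slice F (finrank_model_add F E hf) hf
  filter_upwards [s.stabilizer_conj_eventually] with w ⟨g, hg⟩
  rw [hm', le_bot_iff, MulAction.stabilizer_smul_eq_stabilizer_map_conj] at hg
  exact (Subgroup.map_eq_bot_iff_of_injective _ (MulAut.conj g).injective).1 hg

end Loci

/-! ### Lifts as submersions, and the comparison of two slices -/

section SliceLifts

variable {F : Type*} [NormedAddCommGroup F] [NormedSpace ℝ F] [FiniteDimensional ℝ F]
  {G : Type*} [TopologicalSpace G] [ChartedSpace F G] [Group G] [LieGroup 𝓘(ℝ, F) ∞ G]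
  [T2Space G] {E : Type*} [NormedAddCommGroup E] [NormedSpace ℝ E] [FiniteDimensional ℝ E]
  {M : Type*} [TopologicalSpace M] [ChartedSpace E M] [IsManifold 𝓘(ℝ, E) ∞ M] [T2Space M]
  [MulAction G M] [ContMDiffSMul 𝓘(ℝ, F) 𝓘(ℝ, E) ∞ G M]
  {E' : Type*} [NormedAddCommGroup E'] [NormedSpace ℝ E'] [FiniteDimensional ℝ E']

namespace Slice

variable {m : M} {s : Slice E E' G m} {q : M → E'} {w : M}

/-- There are lifts through all points above a given one. -/
lemma exists_isLiftAt_through (F : Type*) [NormedAddCommGroup F] [NormedSpace ℝ F]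
    [ChartedSpace F G] [ContMDiffSMul 𝓘(ℝ, F) 𝓘(ℝ, E) ∞ G M] (s : Slice E E' G m) {u : E'}
    (hu : u ∈ s.dom) {g : G} (hg : g • s.σ u = w) :
    ∃ q : M → E', s.IsLiftAt q w ∧ ∀ᶠ v in 𝓝 u, q (g • s.σ v) = v := by
  obtain ⟨q, h1, h2⟩ := s.exists_isLiftAt hu
  have h3 := h1.comp_smul F g
  rw [hg] at h3
  refine ⟨_, h3, ?_⟩
  simpa only [inv_smul_smul] using h2

lemma smoothNear_smul_σ (F : Type*) [NormedAddCommGroup F] [NormedSpace ℝ F]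
    [ChartedSpace F G] [ContMDiffSMul 𝓘(ℝ, F) 𝓘(ℝ, E) ∞ G M] (s : Slice E E' G m) {u : E'}
    (hu : u ∈ s.dom) (g : G) : SmoothNear E' E (fun v => g • s.σ v) u :=
  SmoothNear.comp (f := s.σ)
    (smoothNear_of_contMDiff (contMDiff_smul_const F E (M := M) g) _) (s.smooth u hu)

lemma bijective_ρ (s : Slice E E' G m) (γ : MulAction.stabilizer G m) :
    Function.Bijective (s.ρ γ) := by
  have key : ∀ (δ ε : MulAction.stabilizer G m), δ * ε = 1 → ∀ v, s.ρ δ (s.ρ ε v) = v := by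
    intro δ ε h v
    have := map_mul s.ρ δ ε
    rw [h, map_one] at this
    exact (DFunLike.congr_fun this v).symm
  exact Function.bijective_iff_has_inverse.2
    ⟨s.ρ γ⁻¹, key _ _ (inv_mul_cancel γ), key _ _ (mul_inv_cancel γ)⟩

/-- Lifts are submersions. -/
lemma IsLiftAt.surjective (F : Type*) [NormedAddCommGroup F] [NormedSpace ℝ F]
    [ChartedSpace F G] [ContMDiffSMul 𝓘(ℝ, F) 𝓘(ℝ, E) ∞ G M]
    (hm : Finite (MulAction.stabilizer G m)) (h : s.IsLiftAt q w) :
    Function.Surjective (tmap E E' q w) := by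
  obtain ⟨hu, g, hg⟩ := h.2.self_of_nhds
  obtain ⟨q', h1, h2⟩ := s.exists_isLiftAt_through F hu hg
  -- The lift `q'` has a local section through `w`, and the derivative of `q` is that of `q'`
  -- followed by the invertible map `s.ρ γ`.
  obtain ⟨γ, h3, h4⟩ := h.exists_eq hm h1
  have h5 := tmap_comp_eq_id (s.smoothNear_smul_σ F hu g) (r := q') (by rw [hg]; exact h1.1) h2
  rw [hg] at h5
  rw [h4]
  refine (s.bijective_ρ γ).2.comp fun v => ⟨_, DFunLike.congr_fun h5 v⟩

/-- The kernel of the derivative of a lift consists of the orbit directions. -/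
lemma IsLiftAt.exists_orb_eq (hE' : finrank ℝ E' + finrank ℝ F = finrank ℝ E)
    (hm : Finite (MulAction.stabilizer G m)) (h : s.IsLiftAt q w) {p : E}
    (hp : tmap E E' q w p = 0) : ∃ ξ, orb F E G w ξ = p := by
  obtain ⟨hu, g, hg⟩ := h.2.self_of_nhds
  have hw : Finite (MulAction.stabilizer G w) := by
    refine finite_stabilizer_smul (g := g⁻¹) ?_
    rw [inv_smul_eq_iff.2 hg.symm]
    exact s.finite_stabilizer hm hu
  exact exists_eq_of_map_eq_zero hE' (h.surjective F hm) (orb_injective hw)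
    (tmap_orb_eq_zero h.1 (h.invariant F hm)) hp

/-- The local comparison of two slices: the composition of a parametrization of the first with a
lift to the second is a local diffeomorphism. -/
lemma bijective_tmap_lift_smul_σ (hE' : finrank ℝ E' + finrank ℝ F = finrank ℝ E)
    {m' : M} {s' : Slice E E' G m'}
    (hm : Finite (MulAction.stabilizer G m)) (hm' : Finite (MulAction.stabilizer G m')) {u : E'}
    (hu : u ∈ s.dom) {g : G} (hg : g • s.σ u = w) (h : s'.IsLiftAt q w) :
    Function.Bijective (tmap E' E' (fun v => q (g • s.σ v)) u) := by
  obtain ⟨q', h1, h2⟩ := s.exists_isLiftAt_through F hu hg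
  have hτ := s.smoothNear_smul_σ F hu g
  have h3 := tmap_comp_eq_id hτ (r := q') (by rw [hg]; exact h1.1) h2
  have h4 := SmoothNear.tmap_comp (g := q) (by rw [hg]; exact h.1) hτ
  rw [hg] at h3 h4
  -- A vector in the kernel is mapped by the parametrization of the first slice to an orbit
  -- direction. The lift `q'` to the first slice kills this direction but also recovers the vector.
  have hinj : Function.Injective (tmap E' E' (fun v => q (g • s.σ v)) u) := by
    rw [injective_iff_map_eq_zero]
    intro v hv
    have h5 : tmap E E' q w (tmap E' E (fun v => g • s.σ v) u v) = 0 := by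
      rw [← hv]; exact (DFunLike.congr_fun h4 v).symm
    obtain ⟨ξ, hξ⟩ := h.exists_orb_eq (F := F) hE' hm' h5
    have h6 : tmap E E' q' w (tmap E' E (fun v => g • s.σ v) u v) = v := DFunLike.congr_fun h3 v
    rw [← hξ, tmap_orb_eq_zero h1.1 (h1.invariant F hm)] at h6
    exact h6.symm
  exact ⟨hinj, (LinearMap.injective_iff_surjective
    (f := (tmap E' E' (fun v => q (g • s.σ v)) u : E' →ₗ[ℝ] E'))).1 hinj⟩

end Slice
end SliceLifts

/-! ### Orbifold charts from slices -/

section OrbifoldChart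

variable {G : Type*} [TopologicalSpace G] [Group G]
  {E : Type*} [NormedAddCommGroup E] [NormedSpace ℝ E] [FiniteDimensional ℝ E]
  {M : Type*} [TopologicalSpace M] [ChartedSpace E M] [IsManifold 𝓘(ℝ, E) ∞ M]
  [T2Space M] [MulAction G M]
  {E' : Type} [NormedAddCommGroup E'] [NormedSpace ℝ E'] [FiniteDimensional ℝ E']

namespace Slice

/-- The action of the stabilizer on the domain of a slice. -/
def permHom {m : M} (s : Slice E E' G m) : MulAction.stabilizer G m →* Equiv.Perm s.dom :=
  letI : MulAction (MulAction.stabilizer G m) s.dom :=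
    { smul := fun γ u => ⟨s.ρ γ u, s.ρ_mem γ u u.2⟩
      one_smul := fun u => Subtype.ext (by
        change s.ρ 1 (u : E') = u
        rw [map_one]; rfl)
      mul_smul := fun γ δ u => Subtype.ext (by
        change s.ρ (γ * δ) (u : E') = s.ρ γ (s.ρ δ u)
        rw [map_mul]; rfl) }
  MulAction.toPermHom _ _

/-- The orbifold chart of a slice. -/
def orbifoldChart {m : M} (s : Slice E E' G m) (hm : Finite (MulAction.stabilizer G m))
    [ContinuousConstSMul G M] {U : Opens M} (hU : ∀ u : s.dom, s.σ u ∈ U) :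
    OrbifoldChart E' (orbitImage G (U : Set M)) where
  dom := s.dom
  isConnected_dom := s.isConnected_dom
  -- The image of the stabilizer in the permutations of the domain acts effectively, which the
  -- stabilizer itself need not do. It also lies in the universe required of `Γ`, whatever that of
  -- `G`.
  Γ := s.permHom.range
  finite := by
    have := Set.finite_range s.permHom
    exact this.to_subtype
  smooth_action := by
    rintro ⟨_, γ, rfl⟩
    refine contMDiff_of_smoothNear fun u => smoothNear_val_comp_iff.1 ?_
    exact smoothNear_comp_val_iff.2 (smoothNear_of_contDiff (s.ρ γ).contDiff (u : E'))
  toFun u := orbitMap G U ⟨s.σ u, hU u⟩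
  continuous_toFun := by
    refine (continuous_orbitMap U).comp (Continuous.subtype_mk ?_ _)
    rw [continuous_iff_continuousAt]
    exact fun u => (s.smooth u u.2).continuousAt.comp continuous_subtype_val.continuousAt
  isOpenMap_toFun := by
    rw [isOpenMap_iff_nhds_le]
    intro u S hS
    have hS' : (fun u : s.dom => orbitMap G U ⟨s.σ u, hU u⟩) ⁻¹' S ∈ 𝓝 u := hS
    -- The projection of `M` is open, and near `s.σ u` it factors through the chart by means of the
    -- lift `q`; hence the chart is open too.
    obtain ⟨q, h1, h2⟩ := s.exists_isLiftAt u.2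
    have hqu : q (s.σ u) = u := h2.self_of_nhds
    have hq : Tendsto (fun y : U => q y) (𝓝 ⟨s.σ u, hU u⟩) (𝓝 (u : E')) := by
      have h3 : Tendsto q (𝓝 (s.σ u)) (𝓝 (q (s.σ u))) := h1.1.continuousAt
      rw [hqu] at h3
      exact h3.comp continuous_subtype_val.continuousAt
    have h3 : ∀ᶠ v in 𝓝 (u : E'), ∀ hv : v ∈ s.dom, orbitMap G U ⟨s.σ v, hU ⟨v, hv⟩⟩ ∈ S := by
      rw [← s.dom.isOpenEmbedding'.map_nhds_eq u, eventually_map]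
      filter_upwards [hS'] with v hv _ using hv
    have h4 : ∀ᶠ y : U in 𝓝 ⟨s.σ u, hU u⟩, orbitMap G U y ∈ S := by
      filter_upwards [hq.eventually h3,
        (continuous_subtype_val.tendsto (⟨s.σ u, hU u⟩ : U)).eventually h1.2] with y k1 ⟨k2, g, k3⟩
      convert k1 k2 using 1
      exact Subtype.ext (mk_eq_mk_iff.2 ⟨g, k3⟩)
    exact mem_of_superset ((isOpenMap_orbitMap U).image_mem_nhds h4)
      (Set.image_subset_iff.2 fun y hy => hy)
  toFun_eq_iff u v := by
    constructor
    · intro h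
      obtain ⟨g, hg⟩ := mk_eq_mk_iff.1 (Subtype.ext_iff.1 h).symm
      obtain ⟨h1, h2⟩ := s.exists_of_smul_eq u u.2 v v.2 g hg
      exact ⟨⟨_, ⟨g, h1⟩, rfl⟩, Subtype.ext h2⟩
    · rintro ⟨⟨_, γ, rfl⟩, h⟩
      have h1 : s.ρ γ u = v := congrArg Subtype.val h
      refine Subtype.ext (mk_eq_mk_iff.2 ⟨(γ : G)⁻¹, ?_⟩)
      rw [inv_smul_eq_iff, ← s.equivariant γ u u.2, h1]

end Slice

end OrbifoldChart

/-! ### The atlas of slice charts and its changes of charts -/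

section SliceCharts

variable {F : Type*} [NormedAddCommGroup F] [NormedSpace ℝ F] [FiniteDimensional ℝ F]
  {G : Type*} [TopologicalSpace G] [ChartedSpace F G] [Group G] [LieGroup 𝓘(ℝ, F) ∞ G]
  [T2Space G] {E : Type*} [NormedAddCommGroup E] [NormedSpace ℝ E] [FiniteDimensional ℝ E]
  {M : Type*} [TopologicalSpace M] [ChartedSpace E M] [IsManifold 𝓘(ℝ, E) ∞ M] [T2Space M]
  [MulAction G M] [ContMDiffSMul 𝓘(ℝ, F) 𝓘(ℝ, E) ∞ G M]
  {E' : Type} [NormedAddCommGroup E'] [NormedSpace ℝ E'] [FiniteDimensional ℝ E']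
  {U : Opens M}

/-- The orbifold chart `c` is given by the slice `s`. -/
structure Slice.IsSliceOf {m : M} (s : Slice E E' G m)
    (c : OrbifoldChart E' (orbitImage G (U : Set M))) : Prop where
  finite_stabilizer : Finite (MulAction.stabilizer G m)
  dom_eq : c.dom = s.dom
  toFun_eq : ∀ u : c.dom, (c.toFun u : OrbitSpace G M) = Quotient.mk _ (s.σ u)

namespace Slice.IsSliceOf

variable {m m' : M} {s : Slice E E' G m} {s' : Slice E E' G m'}
  {c c' : OrbifoldChart E' (orbitImage G (U : Set M))}

lemma mem_dom (h : s.IsSliceOf c) (u : c.dom) : (u : E') ∈ s.dom := h.dom_eq ▸ u.2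

/-- This translates lifts in the sense of orbifolds into lifts to the slice, so that the
independence of the lift applies to them. -/
lemma isLiftAt_of_toFun_eq (h : s.IsSliceOf c) {q : M → c.dom} {w : M} (hq : SmoothNear E E' q w)
    (hw : ∀ᶠ y in 𝓝 w, (c.toFun (q y) : OrbitSpace G M) = Quotient.mk _ y) :
    s.IsLiftAt (fun y => (q y : E')) w := by
  refine ⟨smoothNear_val_comp_iff.2 hq, hw.mono fun y hy => ⟨h.mem_dom _, ?_⟩⟩
  rw [h.toFun_eq] at hy
  exact mk_eq_mk_iff.1 hy.symm

lemma toFun_eq_of_isLiftAt (h : s.IsSliceOf c) {q : M → c.dom} {w : M}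
    (hw : s.IsLiftAt (fun y => (q y : E')) w) :
    (c.toFun (q w) : OrbitSpace G M) = Quotient.mk _ w := by
  obtain ⟨-, g, hg⟩ := hw.2.self_of_nhds
  rw [h.toFun_eq]
  exact (mk_eq_mk_iff.2 ⟨g, hg⟩).symm

/-- Slices through the same orbit are related by a local change of charts. -/
lemma exists_isChange (hE' : finrank ℝ E' + finrank ℝ F = finrank ℝ E) (h : s.IsSliceOf c)
    (h' : s'.IsSliceOf c') (u : c.dom) (u' : c'.dom) (huu' : c.toFun u = c'.toFun u') :
    ∃ k : PartialDiffeomorph 𝓘(ℝ, E') 𝓘(ℝ, E') c.dom c'.dom ∞,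
      u ∈ k.source ∧ k u = u' ∧ c.IsChange c' k := by
  have h1 := Subtype.ext_iff.1 huu'
  rw [h.toFun_eq, h'.toFun_eq] at h1
  obtain ⟨g, hg⟩ := mk_eq_mk_iff.1 h1.symm
  -- The change of charts is `v ↦ q (g • s.σ v)`: the first slice is moved by `g` to the point of
  -- the second one and then projected to it.
  obtain ⟨q, hq, hqσ⟩ := s'.exists_isLiftAt (h'.mem_dom u')
  have hb := bijective_tmap_lift_smul_σ hE' h.finite_stabilizer h'.finite_stabilizer
    (h.mem_dom u) hg hq
  have hτ := s.smoothNear_smul_σ F (h.mem_dom u) g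
  have hf : SmoothNear E' E' (fun v => q (g • s.σ v)) (u : E') :=
    SmoothNear.comp (g := q) (by rw [hg]; exact hq.1) hτ
  have hqu : q (g • s.σ u) = u' := by rw [hg]; exact hqσ.self_of_nhds
  have hmem : (fun v : c.dom => q (g • s.σ v)) u ∈ c'.dom := by
    change q (g • s.σ u) ∈ _; rw [hqu]; exact u'.2
  have hf' : SmoothNear E' E' (fun v : c.dom => q (g • s.σ v)) u := smoothNear_comp_val_iff.2 hf
  have hft : tmap E' E' (fun v : c.dom => q (g • s.σ v)) u =
      tmap E' E' (fun v => q (g • s.σ v)) (u : E') := tmap_comp_val hf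
  have hk := smoothNear_codRestrictOpens u' hf' hmem
  obtain ⟨r, hr, -, hr1, hr2⟩ := exists_localInverse hk (by
    rw [tmap_codRestrictOpens u' hf' hmem, hft]; exact hb)
  have hτc : Tendsto (fun v : c.dom => g • s.σ v) (𝓝 u) (𝓝 (s'.σ u')) := by
    have h2 : Tendsto (fun v : E' => g • s.σ v) (𝓝 (u : E')) (𝓝 (g • s.σ u)) := hτ.continuousAt
    rw [hg] at h2
    exact h2.comp continuous_subtype_val.continuousAt
  have hO : {v : c.dom | c'.toFun (codRestrictOpens c'.dom u' (fun v : c.dom => q (g • s.σ v)) v) =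
      c.toFun v} ∈ 𝓝 u := by
    filter_upwards [hτc.eventually hq.2] with v ⟨k1, g', k2⟩
    refine Subtype.ext ?_
    rw [h.toFun_eq, h'.toFun_eq, val_codRestrictOpens u' (by rw [h'.dom_eq]; exact k1),
      ← mk_smul g (s.σ v)]
    exact (mk_eq_mk_iff.2 ⟨g', k2⟩).symm
  obtain ⟨k, k1, k2, k3, -⟩ := exists_partialDiffeomorph hk hr hr1 hr2 hO
  refine ⟨k, k1, ?_, fun v hv => ?_⟩
  · rw [k3]
    exact Subtype.ext ((val_codRestrictOpens u' hmem).trans hqu)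
  · rw [k3]; exact k2 hv

variable {κ : InvariantInnerProduct F G} {P : BivectorField E M} {Φ : M → G}

/-- The bivector on a slice is preserved by changes of charts. -/
lemma form_isChange (hΦ : IsHamiltonianQuasiPoisson κ P Φ)
    (hE' : finrank ℝ E' + finrank ℝ F = finrank ℝ E) (h : s.IsSliceOf c) (h' : s'.IsSliceOf c')
    {k : PartialDiffeomorph 𝓘(ℝ, E') 𝓘(ℝ, E') c.dom c'.dom ∞} (hk : c.IsChange c' k) {u : c.dom}
    (hu : u ∈ k.source) (α β : E' →L[ℝ] ℝ) :
    s.form P u (α.comp (tmap E' E' k u)) (β.comp (tmap E' E' k u)) = s'.form P (k u) α β := by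
  have hks : SmoothNear E' E' k u := smoothNear_of_contMDiffOn k.open_source k.contMDiffOn_toFun hu
  obtain ⟨q, σ, hr, hσ, hl⟩ := exists_isReductionAt hΦ hE' h.finite_stabilizer h.dom_eq u
  have hq : SmoothNear E E' q (s.σ u) := by rw [← hσ]; exact hr.smooth_proj
  have hqu : q (s.σ u) = u := by rw [← hσ]; exact hr.proj_eq
  have hqt : Tendsto q (𝓝 (s.σ u)) (𝓝 u) := by rw [← hσ]; exact hr.tendsto_proj
  have hkq : SmoothNear E E' (k ∘ q) (s.σ u) := SmoothNear.comp (by rwa [hqu]) hq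
  -- Following a lift to the first slice by the change `k` gives a lift to the second, so both forms
  -- are push-forwards of the same bivector `P` at `s.σ u`.
  have h1 : s'.IsLiftAt (fun y => ((k ∘ q) y : E')) (s.σ u) := by
    refine h'.isLiftAt_of_toFun_eq hkq ?_
    filter_upwards [hqt.eventually (k.open_source.mem_nhds hu), hl] with y k1 k2
    rw [Function.comp_apply, hk _ k1, h.toFun_eq_of_isLiftAt k2]
  have h2 := h1.form_eq hΦ hE' h'.finite_stabilizer
  have h3 := hl.self_of_nhds.form_eq hΦ hE' h.finite_stabilizer
  rw [tmap_val_comp hkq, SmoothNear.tmap_comp (by rwa [hqu]) hq] at h2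
  rw [tmap_val_comp hq] at h3
  simp only [Function.comp_apply, hqu] at h2 h3
  rw [h2, h3]
  rfl

end Slice.IsSliceOf

variable (F U) in
/-- The orbifold atlas consisting of the charts given by slices. -/
def sliceAtlas (E' : Type) [NormedAddCommGroup E'] [NormedSpace ℝ E'] [FiniteDimensional ℝ E']
    [CompactSpace G] (hU : (U : Set M) = locallyFreeLocus G M)
    (hE' : ∀ m : M, Finite (MulAction.stabilizer G m) →
      finrank ℝ E' + finrank ℝ F = finrank ℝ E) :
    OrbifoldAtlas E' (orbitImage G (U : Set M)) where
  charts := {c | ∃ (m : M) (s : Slice E E' G m), s.IsSliceOf c}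
  covers := by
    rintro ⟨_, m, hm, rfl⟩
    have : ContinuousSMul G M := ContMDiffSMul.continuousSMul (I := 𝓘(ℝ, F)) (I' := 𝓘(ℝ, E)) ∞
    have hm' : Finite (MulAction.stabilizer G m) := by rw [hU] at hm; exact hm
    obtain ⟨s⟩ := exists_slice F (hE' m hm') hm'
    have hsU : ∀ u : s.dom, s.σ u ∈ U := fun u => by
      have : s.σ u ∈ (U : Set M) := by rw [hU]; exact s.finite_stabilizer hm' u.2
      exact this
    exact ⟨s.orbifoldChart hm' hsU, ⟨m, s, hm', rfl, fun u => rfl⟩, ⟨0, s.zero_mem⟩,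
      Subtype.ext (congrArg (Quotient.mk (MulAction.orbitRel G M)) s.σ_zero)⟩
  compatible := by
    rintro c ⟨m, s, h⟩ c' ⟨m', s', h'⟩ u u' huu'
    exact h.exists_isChange (hE' m h.finite_stabilizer) h' u u' huu'

end SliceCharts

/-! ### Related bivector fields, and maps defined on open subsets of open subsets -/

section Lifts

variable {E : Type*} [NormedAddCommGroup E] [NormedSpace ℝ E]
  {M : Type*} [TopologicalSpace M] [ChartedSpace E M]
  {E' : Type*} [NormedAddCommGroup E'] [NormedSpace ℝ E']
  {X : Type*} [TopologicalSpace X] [ChartedSpace E' X]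
  {N : Type*} [TopologicalSpace N] [ChartedSpace E N]

/-- When `i` has derivative the identity, the covector upstairs is determined by the one downstairs,
and being related is an equality of forms. -/
lemma isBivectorRelated_iff {P : BivectorField E M} {i : N → M} {p : N → X}
    {Q : BivectorField E' X} (hi : ∀ u, tmap E E i u = ContinuousLinearMap.id ℝ E) :
    IsBivectorRelated E P i p Q ↔
      ∀ u (α β : E' →L[ℝ] ℝ), Q.form (p u) α β = P.push (i u) (tmap E E' p u) α β := by
  constructor
  · intro h u α β
    refine (h u (α.comp (tmap E E' p u)) (β.comp (tmap E E' p u)) α β ?_ ?_).symm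
    · change (α.comp (tmap E E' p u)).comp (tmap E E i u) = _
      rw [hi]; rfl
    · change (β.comp (tmap E E' p u)).comp (tmap E E i u) = _
      rw [hi]; rfl
  · intro h u α β α' β' h1 h2
    have key : ∀ (α : E →L[ℝ] ℝ) (α' : E' →L[ℝ] ℝ),
        α.comp (tmap E E i u) = α'.comp (tmap E E' p u) → α = α'.comp (tmap E E' p u) := by
      intro α α' h1
      rwa [hi, ContinuousLinearMap.comp_id] at h1
    rw [key _ _ h1, key _ _ h2]
    exact (h u α' β').symm

/-- The extension of a map from an open subset of an open subset. -/
def extendOpens (U : Opens M) (W : Opens U) (d : X) (q : W → X) (y : M) : X :=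
  open Classical in if h : ∃ hU : y ∈ U, (⟨y, hU⟩ : U) ∈ W then q ⟨⟨y, h.1⟩, h.2⟩ else d

lemma extendOpens_apply {U : Opens M} {W : Opens U} {d : X} {q : W → X} (w : W) :
    extendOpens U W d q w.1.1 = q w := by
  rw [extendOpens, dif_pos ⟨w.1.2, w.2⟩]

lemma smoothNear_extendOpens {U : Opens M} {W : Opens U} {d : X} {q : W → X} {w : W}
    (hq : SmoothNear E E' q w) : SmoothNear E E' (extendOpens U W d q) w.1.1 := by
  refine (smoothNear_comp_val_iff (x := w.1)).1 (smoothNear_comp_val_iff (x := w).1 ?_)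
  exact hq.congr (Eventually.of_forall fun y => extendOpens_apply y)

lemma tmap_extendOpens {U : Opens M} {W : Opens U} {d : X} {q : W → X} {w : W}
    (hq : SmoothNear E E' q w) : tmap E E' (extendOpens U W d q) w.1.1 = tmap E E' q w := by
  have h := smoothNear_extendOpens (d := d) hq
  rw [← tmap_comp_val h, ← tmap_comp_val (smoothNear_comp_val_iff.2 h)]
  exact tmap_congr (Eventually.of_forall fun y => extendOpens_apply y)

lemma eventually_exists_mem_opens {U : Opens M} {W : Opens U} (w : W) :
    ∀ᶠ y in 𝓝 w.1.1, ∃ w' : W, w'.1.1 = y := by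
  have h : IsOpen ((fun w : W => w.1.1) '' Set.univ) :=
    (U.isOpen.isOpenMap_subtype_val.comp W.isOpen.isOpenMap_subtype_val) _ isOpen_univ
  filter_upwards [h.mem_nhds ⟨w, trivial, rfl⟩] with y ⟨w', _, hw'⟩ using ⟨w', hw'⟩

lemma tmap_val_val {U : Opens M} {W : Opens U} (w : W) :
    tmap E E (fun w : W => w.1.1) w = ContinuousLinearMap.id ℝ E := by
  have := tmap_comp_val (E₁ := E) (U := W) (x := w) (smoothNear_val U w.1)
  rw [tmap_val] at this
  exact this

end Lifts

/-! ### The Poisson orbifold of orbits with finite stabilizers -/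

section Orbifold

variable {F : Type*} [NormedAddCommGroup F] [NormedSpace ℝ F] [FiniteDimensional ℝ F]
  {G : Type*} [TopologicalSpace G] [ChartedSpace F G] [Group G] [LieGroup 𝓘(ℝ, F) ∞ G]
  [T2Space G] [CompactSpace G]
  {E : Type*} [NormedAddCommGroup E] [NormedSpace ℝ E] [FiniteDimensional ℝ E]
  {M : Type*} [TopologicalSpace M] [ChartedSpace E M] [IsManifold 𝓘(ℝ, E) ∞ M] [T2Space M]
  [MulAction G M] [ContMDiffSMul 𝓘(ℝ, F) 𝓘(ℝ, E) ∞ G M]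
  {E' : Type} [NormedAddCommGroup E'] [NormedSpace ℝ E'] [FiniteDimensional ℝ E']
  {U : Opens M} (hU : (U : Set M) = locallyFreeLocus G M)
  (hE' : ∀ m : M, Finite (MulAction.stabilizer G m) → finrank ℝ E' + finrank ℝ F = finrank ℝ E)
  {κ : InvariantInnerProduct F G} {P : BivectorField E M} {Φ : M → G}

/-- Through each prescribed point of a slice chart passes a lift to the slice, which remains a lift
on an open set; and lifts to a slice are submersions. -/
lemma isOrbifoldSubmersion_orbitMap :
    IsOrbifoldSubmersion E (sliceAtlas F U E' hU hE') (orbitMap G U) := by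
  rintro c ⟨m, s, h⟩ n u hu
  have hu' := Subtype.ext_iff.1 hu
  rw [h.toFun_eq] at hu'
  obtain ⟨g, hg⟩ := mk_eq_mk_iff.1 hu'.symm
  obtain ⟨q, hq, hqσ⟩ := s.exists_isLiftAt_through F (h.mem_dom u) hg
  have hqn : q n = u := by have := hqσ.self_of_nhds; rwa [hg] at this
  obtain ⟨O, hO, hOo, hnO⟩ := eventually_nhds_iff.1 hq.eventually
  let W : Opens U := ⟨Subtype.val ⁻¹' O, hOo.preimage continuous_subtype_val⟩
  have hW : ∀ w : W, s.IsLiftAt q w.1.1 := fun w => hO _ w.2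
  have hWd : ∀ w : W, q w.1.1 ∈ c.dom := fun w => by
    rw [h.dom_eq]; exact (hW w).2.self_of_nhds.1
  let p : W → c.dom := fun w => ⟨q w.1.1, hWd w⟩
  have hp1 : ∀ w : W, SmoothNear E E' (fun w : U => q w.1) w.1 := fun w =>
    smoothNear_comp_val_iff.2 (hW w).1
  have hp : ∀ w : W, SmoothNear E E' p w := fun w =>
    smoothNear_val_comp_iff.1
      (smoothNear_comp_val_iff.2 (hp1 w) : SmoothNear E E' (fun w : W => q w.1.1) w)
  refine ⟨W, hnO, p, ⟨⟨contMDiff_of_smoothNear hp, fun w => ?_⟩, fun w => ?_⟩, Subtype.ext hqn⟩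
  · have h1 : tmap E E' p w = tmap E E' q w.1.1 := by
      rw [← tmap_val_comp (hp w), ← tmap_comp_val (hW w).1, ← tmap_comp_val (hp1 w)]
    change Function.Surjective (tmap E E' p w)
    rw [h1]
    exact (hW w).surjective F h.finite_stabilizer
  · obtain ⟨-, g', hg'⟩ := (hW w).2.self_of_nhds
    refine Subtype.ext ?_
    rw [h.toFun_eq]
    exact (mk_eq_mk_iff.2 ⟨g', hg'⟩).symm

/-- The bivector field on the orbit space, in a slice chart. -/
lemma exists_reduction
    (hE' : ∀ m : M, Finite (MulAction.stabilizer G m) → finrank ℝ E' + finrank ℝ F = finrank ℝ E)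
    (hΦ : IsHamiltonianQuasiPoisson κ P Φ)
    {c : OrbifoldChart E' (orbitImage G (U : Set M))} {m : M} {s : Slice E E' G m}
    (h : s.IsSliceOf c) (u : c.dom) :
    ∃ q σ, IsReductionAt G P (fun v : c.dom => s.form P v) q σ u ∧
      ∀ (C : ConjClasses G), ∀ᶠ w in 𝓝 (σ u),
        (q w ∈ c.toFun ⁻¹' {x | x.1 ∈ reducedSpace Φ C} ↔ Φ w ∈ C.carrier) := by
  obtain ⟨q, σ, hr, hσ, hl⟩ := Slice.exists_isReductionAt hΦ (hE' m h.finite_stabilizer)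
    h.finite_stabilizer h.dom_eq u
  refine ⟨q, σ, hr, fun C => ?_⟩
  rw [hσ]
  filter_upwards [hl] with w hw
  rw [Set.mem_preimage, Set.mem_ofPred_eq, h.toFun_eq_of_isLiftAt hw,
    mk_mem_reducedSpace_iff hΦ.equivariant]

/-- The reduced bivector field on the orbifold of orbits with finite stabilizers. -/
def orbifoldField (hΦ : IsHamiltonianQuasiPoisson κ P Φ) :
    OrbifoldBivectorField (sliceAtlas F U E' hU hE') where
  -- A slice that gives the chart `c` is chosen; `Slice.IsSliceOf.form_isChange` makes the forms of
  -- the chosen slices agree under changes of charts.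
  field c := reductionField (G := G) P (fun v : c.1.dom => c.2.choose_spec.choose.form P v)
    fun u => by
      obtain ⟨q, σ, h, -⟩ := exists_reduction hE' hΦ c.2.choose_spec.choose_spec u
      exact ⟨q, σ, h⟩
  invariant c c' k hk u hu α β := by
    have h := c.2.choose_spec.choose_spec
    have h' := c'.2.choose_spec.choose_spec
    exact h.form_isChange hΦ (hE' _ h.finite_stabilizer) h' hk hu α β

lemma orbifoldField_form (hΦ : IsHamiltonianQuasiPoisson κ P Φ)
    (c : (sliceAtlas F U E' hU hE').charts) (u : c.1.dom) :
    ((orbifoldField hU hE' hΦ).field c).form u = c.2.choose_spec.choose.form P u := rfl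

lemma isPoisson_orbifoldField (hΦ : IsHamiltonianQuasiPoisson κ P Φ) :
    (orbifoldField hU hE' hΦ).IsPoisson := fun c =>
  isPoisson_of_isReductionAt (G := G) hΦ (fun u => orbifoldField_form hU hE' hΦ c u) fun u => by
    obtain ⟨q, σ, h, -⟩ := exists_reduction hE' hΦ c.2.choose_spec.choose_spec u
    exact ⟨q, σ, h⟩

/-- Any submersive lift, extended arbitrarily to `M`, is near the points of its domain a lift to the
slice, and all of those push `P` to the form of the slice. -/
lemma isOrbifoldBivectorRelated_orbifoldField (hΦ : IsHamiltonianQuasiPoisson κ P Φ) :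
    IsOrbifoldBivectorRelated E P (fun m : U => m.1) (orbitMap G U) (orbifoldField hU hE' hΦ) := by
  rintro c W q ⟨⟨hq, -⟩, hqp⟩
  rw [isBivectorRelated_iff fun w => tmap_val_val w]
  intro w α β
  have h := c.2.choose_spec.choose_spec
  have hqw : SmoothNear E E' q w := smoothNear_of_contMDiff hq w
  have h1 := h.isLiftAt_of_toFun_eq (smoothNear_extendOpens (d := q w) hqw) (by
    filter_upwards [eventually_exists_mem_opens w]
    rintro _ ⟨w', rfl⟩
    rw [extendOpens_apply, hqp]
    rfl)
  have h2 := h1.form_eq hΦ (hE' _ h.finite_stabilizer) h.finite_stabilizer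
  rw [tmap_val_comp (smoothNear_extendOpens hqw), tmap_extendOpens hqw, extendOpens_apply] at h2
  rw [orbifoldField_form, h2]
  rfl

lemma BivectorField.ext_form {E : Type*} [NormedAddCommGroup E] [NormedSpace ℝ E]
    {M : Type*} [TopologicalSpace M] [ChartedSpace E M] {P P' : BivectorField E M}
    (h : ∀ (m : M) (α β : E →L[ℝ] ℝ), P.form m α β = P'.form m α β) : P = P' := by
  cases P; cases P'
  congr
  funext m
  exact LinearMap.ext₂ (h m)

/-- Every point of a chart is a value of some submersive lift, and there the relation prescribes the
form completely. -/
lemma eq_of_isOrbifoldBivectorRelated {Q Q' : OrbifoldBivectorField (sliceAtlas F U E' hU hE')}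
    (hQ : IsOrbifoldBivectorRelated E P (fun m : U => m.1) (orbitMap G U) Q)
    (hQ' : IsOrbifoldBivectorRelated E P (fun m : U => m.1) (orbitMap G U) Q') : Q = Q' := by
  have h : Q.field = Q'.field := by
    funext c
    refine BivectorField.ext_form fun u α β => ?_
    obtain ⟨n, hn⟩ := surjective_orbitMap U (c.1.toFun u)
    obtain ⟨W, hnW, q, hq, hqu⟩ := isOrbifoldSubmersion_orbitMap hU hE' c.1 c.2 n u hn.symm
    have h1 := (isBivectorRelated_iff fun w => tmap_val_val w).1 (hQ c W q hq) ⟨n, hnW⟩ α β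
    have h2 := (isBivectorRelated_iff fun w => tmap_val_val w).1 (hQ' c W q hq) ⟨n, hnW⟩ α β
    rw [← hqu]
    exact h1.trans h2.symm
  cases Q; cases Q'
  congr

/-- The dimension is common to all charts because the number `d` of local equations depends only on
the class `C`. -/
lemma exists_isPoissonSuborbifold (hΦ : IsHamiltonianQuasiPoisson κ P Φ) (C : ConjClasses G) :
    ∃ k : ℕ, IsPoissonSuborbifold (orbifoldField hU hE' hΦ) k {x | x.1 ∈ reducedSpace Φ C} := by
  obtain ⟨d, hd⟩ := exists_conj_equations (F := F) C
  refine ⟨finrank ℝ E' - d, fun c => ?_⟩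
  have h := c.2.choose_spec.choose_spec
  refine isPoissonSubmanifold_of_isReductionAt (G := G) hΦ (fun _ => hE' _ h.finite_stabilizer)
    (fun u => orbifoldField_form hU hE' hΦ c u) hd fun u => ?_
  obtain ⟨q, σ, hr, hS⟩ := exists_reduction hE' hΦ h u
  exact ⟨q, σ, hr, hS C⟩

end Orbifold

/-! ### The manifold of free orbits -/

section FreeQuotient

variable {F : Type*} [NormedAddCommGroup F] [NormedSpace ℝ F] [FiniteDimensional ℝ F]
  {G : Type*} [TopologicalSpace G] [ChartedSpace F G] [Group G] [LieGroup 𝓘(ℝ, F) ∞ G]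
  [T2Space G] {E : Type*} [NormedAddCommGroup E] [NormedSpace ℝ E] [FiniteDimensional ℝ E]
  {M : Type*} [TopologicalSpace M] [ChartedSpace E M] [IsManifold 𝓘(ℝ, E) ∞ M] [T2Space M]
  [MulAction G M] [ContMDiffSMul 𝓘(ℝ, F) 𝓘(ℝ, E) ∞ G M]
  {E' : Type} [NormedAddCommGroup E'] [NormedSpace ℝ E'] [FiniteDimensional ℝ E']
  {U : Opens M}

/-- The chart `e` of the space of orbits is given by the slice `s` at a point with trivial
stabilizer. -/
structure Slice.IsFreeSliceOf {m : M} (s : Slice E E' G m)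
    (e : OpenPartialHomeomorph (orbitImage G (U : Set M)) E') : Prop where
  stabilizer_eq : MulAction.stabilizer G m = ⊥
  target_eq : e.target = s.dom
  symm_eq : ∀ u ∈ s.dom, (e.symm u : OrbitSpace G M) = Quotient.mk _ (s.σ u)

lemma finite_of_eq_bot {m : M} (h : MulAction.stabilizer G m = ⊥) :
    Finite (MulAction.stabilizer G m) := by
  rw [h]; infer_instance

/-- With trivial stabilizer, the open map from the slice to the orbit space is also injective, hence
an open embedding, and its inverse is the chart. -/
lemma Slice.exists_isFreeSliceOf [ContinuousConstSMul G M] {m : M} (s : Slice E E' G m)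
    (hm : MulAction.stabilizer G m = ⊥) (hU : ∀ u : s.dom, s.σ u ∈ U) :
    ∃ e : OpenPartialHomeomorph (orbitImage G (U : Set M)) E', s.IsFreeSliceOf e ∧
      ⟨Quotient.mk _ (s.σ 0), Set.mem_image_of_mem _ (hU ⟨0, s.zero_mem⟩)⟩ ∈ e.source := by
  let f : s.dom → orbitImage G (U : Set M) := (s.orbifoldChart (finite_of_eq_bot hm) hU).toFun
  have hinj : Function.Injective f := by
    intro u v huv
    obtain ⟨g, hg⟩ := mk_eq_mk_iff.1 (Subtype.ext_iff.1 huv).symm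
    obtain ⟨h1, h2⟩ := s.exists_of_smul_eq u u.2 v v.2 g hg
    have h3 : (⟨g, h1⟩ : MulAction.stabilizer G m) = 1 := by
      have : g ∈ (⊥ : Subgroup G) := by rw [← hm]; exact h1
      exact Subtype.ext (Subgroup.mem_bot.1 this)
    rw [h3, map_one] at h2
    exact Subtype.ext h2
  have hemb : IsOpenEmbedding f :=
    .of_continuous_injective_isOpenMap
      (s.orbifoldChart (finite_of_eq_bot hm) hU).continuous_toFun hinj
      (s.orbifoldChart (finite_of_eq_bot hm) hU).isOpenMap_toFun
  have hne : Nonempty s.dom := ⟨⟨0, s.zero_mem⟩⟩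
  let φ := hemb.toOpenPartialHomeomorph f
  let ι := s.dom.openPartialHomeomorphSubtypeCoe hne
  refine ⟨φ.symm.trans ι, ⟨hm, ?_, fun u hu => ?_⟩, ?_⟩
  · ext u
    simp [φ, ι]
  · have h1 : ι.symm u = ⟨u, hu⟩ := ι.left_inv (x := ⟨u, hu⟩) (by simp [ι])
    change ((φ (ι.symm u) : orbitImage G (U : Set M)) : OrbitSpace G M) = _
    rw [h1]
    rfl
  · have h1 : f ⟨0, s.zero_mem⟩ ∈ (φ.symm.trans ι).source := by
      simp [φ, ι]
    exact h1

/-- The projection to the orbit space, extended to the whole manifold. -/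
def orbitMapExt (x₀ : orbitImage G (U : Set M)) (m : M) : orbitImage G (U : Set M) :=
  open Classical in if h : m ∈ U then orbitMap G U ⟨m, h⟩ else x₀

lemma orbitMapExt_apply (x₀ : orbitImage G (U : Set M)) {m : M} (h : m ∈ U) :
    orbitMapExt x₀ m = orbitMap G U ⟨m, h⟩ := by
  rw [orbitMapExt, dif_pos h]

lemma val_orbitMapExt (x₀ : orbitImage G (U : Set M)) {m : M} (h : m ∈ U) :
    (orbitMapExt x₀ m : OrbitSpace G M) = Quotient.mk _ m := by
  rw [orbitMapExt_apply x₀ h]; rfl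

namespace Slice.IsFreeSliceOf

variable {m m' : M} {s : Slice E E' G m} {s' : Slice E E' G m'}
  {e e' : OpenPartialHomeomorph (orbitImage G (U : Set M)) E'}

/-- Read in the chart of a free slice, the projection to the orbit space is a lift to this slice, so
all that is known about lifts applies to it. -/
lemma orbitMapExt_eventually (h : s.IsFreeSliceOf e) {x₀ : orbitImage G (U : Set M)} {w : M}
    (hw : w ∈ U) {q : M → E'} (hq : s.IsLiftAt q w) :
    orbitMapExt x₀ =ᶠ[𝓝 w] e.symm ∘ q := by
  filter_upwards [U.isOpen.mem_nhds hw, hq.2] with y hy ⟨h1, g, h2⟩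
  refine Subtype.ext ?_
  rw [val_orbitMapExt x₀ hy, Function.comp_apply, h.symm_eq _ h1]
  exact mk_eq_mk_iff.2 ⟨g, h2⟩

lemma exists_isLiftAt (F : Type*) [NormedAddCommGroup F] [NormedSpace ℝ F]
    [ChartedSpace F G] [ContMDiffSMul 𝓘(ℝ, F) 𝓘(ℝ, E) ∞ G M] (h : s.IsFreeSliceOf e)
    {x₀ : orbitImage G (U : Set M)} {w : M}
    (hw : w ∈ U) (hwe : orbitMapExt x₀ w ∈ e.source) :
    ∃ q : M → E', s.IsLiftAt q w := by
  have h1 : e (orbitMapExt x₀ w) ∈ s.dom := by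
    have := e.map_source hwe
    rwa [h.target_eq] at this
  have h2 := h.symm_eq _ h1
  rw [e.left_inv hwe, val_orbitMapExt x₀ hw] at h2
  obtain ⟨g, hg⟩ := mk_eq_mk_iff.1 h2
  obtain ⟨q, hq, -⟩ := s.exists_isLiftAt_through F h1 hg
  exact ⟨q, hq⟩

/-- The changes of charts are smooth. -/
lemma contDiffAt (F : Type*) [NormedAddCommGroup F] [NormedSpace ℝ F]
    [ChartedSpace F G] [ContMDiffSMul 𝓘(ℝ, F) 𝓘(ℝ, E) ∞ G M]
    (hU : ∀ u ∈ s.dom, s.σ u ∈ U) (h : s.IsFreeSliceOf e) (h' : s'.IsFreeSliceOf e')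
    {v : E'} (hv : v ∈ e.target) (hv' : e.symm v ∈ e'.source) :
    ContDiffAt ℝ ∞ (e' ∘ e.symm) v := by
  have hvd : v ∈ s.dom := by rwa [h.target_eq] at hv
  have key : ∀ u ∈ s.dom, orbitMapExt (e.symm v) (s.σ u) = e.symm u := fun u hu =>
    Subtype.ext (by rw [val_orbitMapExt _ (hU u hu), h.symm_eq u hu])
  -- Near `v` the change of charts is `q ∘ s.σ`, with `q` a lift to the second slice.
  obtain ⟨q, hq⟩ := h'.exists_isLiftAt F (x₀ := e.symm v) (hU v hvd) (by rw [key v hvd]; exact hv')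
  have h1 : SmoothNear E' E' (q ∘ s.σ) v := hq.1.comp (s.smooth v hvd)
  refine (h1.congr ?_).contDiffAt
  filter_upwards [s.dom.isOpen.mem_nhds hvd, (s.tendsto_σ hvd).eventually
    (h'.orbitMapExt_eventually (x₀ := e.symm v) (hU v hvd) hq),
    (s.tendsto_σ hvd).eventually hq.2] with u hu h2 h3
  rw [Function.comp_apply, ← key u hu, h2, Function.comp_apply, e'.right_inv]
  · rfl
  · rw [h'.target_eq]; exact h3.1

end Slice.IsFreeSliceOf

/-- The manifold structure on the space of free orbits. -/
lemma exists_chartedSpace [CompactSpace G] (E' : Type) [NormedAddCommGroup E'] [NormedSpace ℝ E']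
    [FiniteDimensional ℝ E'] (hU : (U : Set M) = freeLocus G M)
    (hE' : ∀ m : M, Finite (MulAction.stabilizer G m) →
      finrank ℝ E' + finrank ℝ F = finrank ℝ E) :
    ∃ _ : ChartedSpace E' (orbitImage G (U : Set M)),
      IsManifold 𝓘(ℝ, E') ∞ (orbitImage G (U : Set M)) ∧
      ∀ x : orbitImage G (U : Set M), ∃ (m : M) (s : Slice E E' G m),
        s.IsFreeSliceOf (chartAt E' x) := by
  have : ContinuousSMul G M := ContMDiffSMul.continuousSMul (I := 𝓘(ℝ, F)) (I' := 𝓘(ℝ, E)) ∞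
  have hsU : ∀ {m : M}, MulAction.stabilizer G m = ⊥ → ∀ s : Slice E E' G m, ∀ u ∈ s.dom,
      s.σ u ∈ U := by
    intro m hm s u hu
    have : s.σ u ∈ (U : Set M) := by
      rw [hU]
      have := s.stabilizer_le hu
      rwa [hm, le_bot_iff] at this
    exact this
  have key : ∀ x : orbitImage G (U : Set M),
      ∃ e : OpenPartialHomeomorph (orbitImage G (U : Set M)) E', x ∈ e.source ∧
        ∃ (m : M) (s : Slice E E' G m), s.IsFreeSliceOf e := by
    rintro ⟨_, m, hm, rfl⟩
    have hm' : MulAction.stabilizer G m = ⊥ := by rw [hU] at hm; exact hm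
    have hf := finite_of_eq_bot hm'
    obtain ⟨s⟩ := exists_slice F (hE' m hf) hf
    obtain ⟨e, he, hme⟩ := s.exists_isFreeSliceOf hm' fun u => hsU hm' s u u.2
    refine ⟨e, ?_, m, s, he⟩
    convert hme using 1
    exact Subtype.ext (congrArg (Quotient.mk (MulAction.orbitRel G M)) s.σ_zero.symm)
  choose e he hes using key
  let C : ChartedSpace E' (orbitImage G (U : Set M)) :=
    { atlas := Set.range e
      chartAt := e
      mem_chart_source := he
      chart_mem_atlas := fun x => ⟨x, rfl⟩ }
  refine ⟨C, isManifold_of_contDiffOn _ _ _ ?_, hes⟩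
  rintro _ _ ⟨x, rfl⟩ ⟨x', rfl⟩ v ⟨hv, -⟩
  obtain ⟨m, s, hs⟩ := hes x
  obtain ⟨m', s', hs'⟩ := hes x'
  have hv' : v ∈ ((e x).symm.trans (e x')).source := hv
  rw [OpenPartialHomeomorph.trans_source] at hv'
  exact (hs.contDiffAt F (hsU hs.stabilizer_eq s) hs' hv'.1 hv'.2).contDiffWithinAt

variable [ChartedSpace E' (orbitImage G (U : Set M))]
  [IsManifold 𝓘(ℝ, E') ∞ (orbitImage G (U : Set M))]

lemma smoothNear_orbitMapExt (F : Type*) [NormedAddCommGroup F] [NormedSpace ℝ F]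
    [ChartedSpace F G] [ContMDiffSMul 𝓘(ℝ, F) 𝓘(ℝ, E) ∞ G M]
    (hch : ∀ x : orbitImage G (U : Set M), ∃ (m : M) (s : Slice E E' G m),
      s.IsFreeSliceOf (chartAt E' x)) (x₀ : orbitImage G (U : Set M)) {w : M} (hw : w ∈ U) :
    SmoothNear E E' (orbitMapExt x₀) w ∧
      Function.Surjective (tmap E E' (orbitMapExt x₀) w) ∧
      ∀ᶠ g in 𝓝 (1 : G), orbitMapExt x₀ (g • w) = orbitMapExt x₀ w := by
  obtain ⟨m, s, hs⟩ := hch (orbitMapExt x₀ w)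
  set e := chartAt E' (orbitMapExt x₀ w) with he
  obtain ⟨q, hq⟩ := hs.exists_isLiftAt F (x₀ := x₀) hw (mem_chart_source E' _)
  have hqt : q w ∈ e.target := by rw [hs.target_eq]; exact hq.2.self_of_nhds.1
  have h1 : SmoothNear E' E' e.symm (q w) :=
    smoothNear_of_contMDiffOn e.open_target contMDiffOn_chart_symm hqt
  have h2 : SmoothNear E' E' e (e.symm (q w)) :=
    smoothNear_of_contMDiffOn e.open_source contMDiffOn_chart (e.map_target hqt)
  have hev := hs.orbitMapExt_eventually (x₀ := x₀) hw hq
  have hb : Function.Bijective (tmap E' E' e.symm (q w)) := tmap_bijective_of_inverse h1 h2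
    (e.eventually_right_inverse hqt) (e.eventually_left_inverse (e.map_target hqt))
  refine ⟨(h1.comp hq.1).congr hev, ?_, ?_⟩
  · rw [tmap_congr hev, h1.tmap_comp hq.1]
    exact hb.2.comp (hq.surjective F (finite_of_eq_bot hs.stabilizer_eq))
  · have h3 : Tendsto (fun g : G => g • w) (𝓝 1) (𝓝 w) := by
      have h2 := (contMDiff_orbitMap F E (G := G) w).continuous.tendsto 1
      rwa [one_smul] at h2
    filter_upwards [h3.eventually hev, hq.invariant F (finite_of_eq_bot hs.stabilizer_eq)]
      with g k1 k2
    rw [k1, hev.self_of_nhds, Function.comp_apply, Function.comp_apply, k2]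

lemma tmap_orbitMap (x₀ : orbitImage G (U : Set M)) {w : U}
    (h : SmoothNear E E' (orbitMapExt x₀) (w : M)) :
    SmoothNear E E' (orbitMap G U) w ∧
      tmap E E' (orbitMap G U) w = tmap E E' (orbitMapExt x₀) (w : M) := by
  have h1 : (fun w : U => orbitMapExt x₀ w) = orbitMap G U :=
    funext fun w => orbitMapExt_apply x₀ w.2
  have h2 := smoothNear_comp_val_iff.2 h
  have h3 := tmap_comp_val h
  rw [h1] at h2 h3
  exact ⟨h2, h3⟩

lemma isSmoothSubmersion_orbitMap (F : Type*) [NormedAddCommGroup F] [NormedSpace ℝ F]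
    [ChartedSpace F G] [ContMDiffSMul 𝓘(ℝ, F) 𝓘(ℝ, E) ∞ G M]
    (hch : ∀ x : orbitImage G (U : Set M), ∃ (m : M) (s : Slice E E' G m),
      s.IsFreeSliceOf (chartAt E' x)) : IsSmoothSubmersion E E' (orbitMap G U) := by
  refine ⟨contMDiff_of_smoothNear fun w => ?_, fun w => ?_⟩
  · exact (tmap_orbitMap _ (smoothNear_orbitMapExt F hch (orbitMap G U w) w.2).1).1
  · obtain ⟨h1, h2, -⟩ := smoothNear_orbitMapExt F hch (orbitMap G U w) w.2
    change Function.Surjective (tmap E E' (orbitMap G U) w)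
    rw [(tmap_orbitMap _ h1).2]
    exact h2

/-- The image in the orbit space of the bivector field on `M`. -/
def orbitForm (P : BivectorField E M) (x : orbitImage G (U : Set M)) :
    LinearMap.BilinForm ℝ (E' →L[ℝ] ℝ) :=
  P.push x.2.choose (tmap E E' (orbitMapExt x) x.2.choose)

variable {κ : InvariantInnerProduct F G} {P : BivectorField E M} {Φ : M → G}

/-- The form at an orbit was defined with a chosen representative. Any other is a translate of it,
and both `P` and the projection are invariant. -/
lemma orbitForm_eq (hΦ : IsHamiltonianQuasiPoisson κ P Φ) (hU : ∀ (g : G), ∀ w ∈ U, g • w ∈ U)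
    (hch : ∀ x : orbitImage G (U : Set M), ∃ (m : M) (s : Slice E E' G m),
      s.IsFreeSliceOf (chartAt E' x)) (x₀ : orbitImage G (U : Set M)) {w : M} (hw : w ∈ U) :
    orbitForm P (orbitMapExt x₀ w) = P.push w (tmap E E' (orbitMapExt x₀) w) := by
  set x := orbitMapExt x₀ w with hx
  obtain ⟨h1, h2⟩ := x.2.choose_spec
  set n := x.2.choose with hn
  have h3 : (x : OrbitSpace G M) = Quotient.mk _ w := val_orbitMapExt x₀ hw
  rw [h3] at h2
  obtain ⟨g, hg⟩ := mk_eq_mk_iff.1 h2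
  have h4 : orbitMapExt x ∘ (fun y : M => g • y) =ᶠ[𝓝 w] orbitMapExt x₀ := by
    filter_upwards [U.isOpen.mem_nhds hw] with y hy
    refine Subtype.ext ?_
    rw [Function.comp_apply, val_orbitMapExt x (hU g y hy), val_orbitMapExt x₀ hy, mk_smul]
  have h5 : SmoothNear E E' (orbitMapExt x) (g • w) :=
    (smoothNear_orbitMapExt F hch x (hU g w hw)).1
  rw [← tmap_congr h4,
    h5.tmap_comp (smoothNear_of_contMDiff (contMDiff_smul_const F E (M := M) g) w)]
  have h6 : orbitForm P x = P.push (g • w) (tmap E E' (orbitMapExt x) (g • w)) := by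
    rw [hg]; rfl
  rw [h6]
  ext α β
  exact (hΦ.pair_smul g w (α.comp (tmap E E' (orbitMapExt x) (g • w)))
    (β.comp (tmap E E' (orbitMapExt x) (g • w)))).symm

/-- The projection is the quotient map itself, and the local section is the slice composed with its
chart. -/
lemma exists_isReductionAt_orbitForm (hΦ : IsHamiltonianQuasiPoisson κ P Φ)
    (hU : ∀ (g : G), ∀ w ∈ U, g • w ∈ U) (hfin : ∀ w ∈ U, Finite (MulAction.stabilizer G w))
    (hch : ∀ x : orbitImage G (U : Set M), ∃ (m : M) (s : Slice E E' G m),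
      s.IsFreeSliceOf (chartAt E' x)) (hsU : ∀ {m : M} (s : Slice E E' G m),
      MulAction.stabilizer G m = ⊥ → ∀ u ∈ s.dom, s.σ u ∈ U) (x : orbitImage G (U : Set M)) :
    ∃ q σ, IsReductionAt G P (orbitForm (E' := E') P) q σ x ∧ ∀ (C : ConjClasses G), ∀ᶠ w in 𝓝 (σ x),
        (q w ∈ {x : orbitImage G (U : Set M) | x.1 ∈ reducedSpace Φ C} ↔ Φ w ∈ C.carrier) := by
  obtain ⟨m, s, hs⟩ := hch x
  set e := chartAt E' x with he
  have hxe : x ∈ e.source := mem_chart_source E' x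
  have hd : ∀ y ∈ e.source, e y ∈ s.dom := fun y hy => by
    have := e.map_source hy
    rwa [hs.target_eq] at this
  have hσU := hsU s hs.stabilizer_eq _ (hd x hxe)
  have hUn := U.isOpen.eventually_mem hσU
  obtain ⟨h1, -, -⟩ := smoothNear_orbitMapExt F hch x hσU
  refine ⟨orbitMapExt x, s.σ ∘ e, ⟨?_, h1, ?_, ?_, ?_, hfin _ hσU⟩, fun C => ?_⟩
  · exact (s.smooth _ (hd x hxe)).comp
      (smoothNear_of_contMDiffOn e.open_source contMDiffOn_chart hxe)
  · filter_upwards [e.open_source.mem_nhds hxe] with y hy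
    refine Subtype.ext ?_
    rw [Function.comp_apply, val_orbitMapExt x (hsU s hs.stabilizer_eq _ (hd y hy)),
      ← hs.symm_eq _ (hd y hy), e.left_inv hy]
  · filter_upwards [hUn] with w hw using (smoothNear_orbitMapExt F hch x hw).2.2
  · filter_upwards [hUn] with w hw α β
    rw [orbitForm_eq hΦ hU hch x hw]
    rfl
  · filter_upwards [hUn] with w hw
    rw [val_orbitMapExt x hw, mk_mem_reducedSpace_iff hΦ.equivariant]

end FreeQuotient

/-! ### Assembly of the Poisson quotient of the free locus -/

section Main

variable {F : Type*} [NormedAddCommGroup F] [NormedSpace ℝ F] [FiniteDimensional ℝ F]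
  {G : Type*} [TopologicalSpace G] [ChartedSpace F G] [Group G] [LieGroup 𝓘(ℝ, F) ∞ G]
  [CompactSpace G] [T2Space G]
  {E : Type*} [NormedAddCommGroup E] [NormedSpace ℝ E] [FiniteDimensional ℝ E]
  {M : Type*} [TopologicalSpace M] [ChartedSpace E M] [IsManifold 𝓘(ℝ, E) ∞ M]
  [T2Space M] [MulAction G M] [ContMDiffSMul 𝓘(ℝ, F) 𝓘(ℝ, E) ∞ G M]
  {κ : InvariantInnerProduct F G} {P : BivectorField E M} {Φ : M → G}

/-- The quotient of the free locus is a Poisson manifold. -/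
theorem exists_poisson_quotient (E' : Type) [NormedAddCommGroup E'] [NormedSpace ℝ E']
    [FiniteDimensional ℝ E'] (hΦ : IsHamiltonianQuasiPoisson κ P Φ)
    {U : Opens M} (hU : (U : Set M) = freeLocus G M) [T2Space (orbitImage G (U : Set M))]
    (hE' : ∀ m : M, Finite (MulAction.stabilizer G m) →
      finrank ℝ E' + finrank ℝ F = finrank ℝ E) :
    ∃ _ : ChartedSpace E' (orbitImage G (U : Set M)),
      IsManifold 𝓘(ℝ, E') ∞ (orbitImage G (U : Set M)) ∧
      IsSmoothSubmersion E E' (orbitMap G U) ∧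
      ∃ Q : BivectorField E' (orbitImage G (U : Set M)),
        Q.IsPoisson ∧
        IsBivectorRelated E P (fun m : U => m.1) (orbitMap G U) Q ∧
        (∀ Q', IsBivectorRelated E P (fun m : U => m.1) (orbitMap G U) Q' → Q' = Q) ∧
        ∀ C : ConjClasses G, ∃ k : ℕ, IsPoissonSubmanifold Q k {x | x.1 ∈ reducedSpace Φ C} := by
  obtain ⟨hC, hM, hch⟩ := exists_chartedSpace E' hU hE'
  have hmem : ∀ w, w ∈ U ↔ MulAction.stabilizer G w = ⊥ := fun w => by
    rw [← SetLike.mem_coe, hU]; rfl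
  have hUG : ∀ (g : G), ∀ w ∈ U, g • w ∈ U := by
    intro g w hw
    rw [hmem] at hw ⊢
    rw [MulAction.stabilizer_smul_eq_stabilizer_map_conj, hw, Subgroup.map_bot]
  have hfin : ∀ w ∈ U, Finite (MulAction.stabilizer G w) := fun w hw =>
    finite_of_eq_bot ((hmem w).1 hw)
  have hsU : ∀ {m : M} (s : Slice E E' G m),
      MulAction.stabilizer G m = ⊥ → ∀ u ∈ s.dom, s.σ u ∈ U := by
    intro m s hm u hu
    have := s.stabilizer_le hu
    rw [hm, le_bot_iff] at this
    exact (hmem _).2 this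
  have hred := exists_isReductionAt_orbitForm hΦ hUG hfin hch hsU
  let Q : BivectorField E' (orbitImage G (U : Set M)) :=
    reductionField (G := G) P (orbitForm P) fun x => by
      obtain ⟨q, σ, h, -⟩ := hred x
      exact ⟨q, σ, h⟩
  have hQ : IsBivectorRelated E P (fun m : U => m.1) (orbitMap G U) Q := by
    rw [isBivectorRelated_iff fun w => tmap_val U w]
    intro w α β
    have h1 := orbitForm_eq hΦ hUG hch (orbitMap G U w) w.2
    rw [← (tmap_orbitMap _ (smoothNear_orbitMapExt F hch (orbitMap G U w) w.2).1).2,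
      orbitMapExt_apply _ w.2] at h1
    exact LinearMap.congr_fun₂ h1 α β
  refine ⟨hC, hM, isSmoothSubmersion_orbitMap F hch, Q,
    isPoisson_of_isReductionAt (G := G) hΦ (fun x => rfl) fun x => ?_, hQ, fun Q' hQ' => ?_,
    fun C => ?_⟩
  · obtain ⟨q, σ, h, -⟩ := hred x
    exact ⟨q, σ, h⟩
  -- Every orbit has a representative in `U`, at which the relation determines the form.
  · refine BivectorField.ext_form fun x α β => ?_
    obtain ⟨w, rfl⟩ := surjective_orbitMap U x
    rw [isBivectorRelated_iff fun w => tmap_val U w] at hQ hQ'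
    exact (hQ' w α β).trans (hQ w α β).symm
  · obtain ⟨d, hd⟩ := exists_conj_equations (F := F) C
    refine ⟨finrank ℝ E' - d, isPoissonSubmanifold_of_isReductionAt (G := G) hΦ (fun x => ?_)
      (fun x => rfl) hd fun x => ?_⟩
    · obtain ⟨w, -⟩ := surjective_orbitMap U x
      exact hE' w (hfin w w.2)
    · obtain ⟨q, σ, h, h'⟩ := hred x
      exact ⟨q, σ, h, h' C⟩

end Main
end QuasiPoisson

end

open QuasiPoisson in
theorem mainTheorem7
    {F : Type*} [NormedAddCommGroup F] [NormedSpace ℝ F] [FiniteDimensional ℝ F]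
    {G : Type*} [TopologicalSpace G] [ChartedSpace F G] [Group G] [LieGroup 𝓘(ℝ, F) ∞ G]
    [CompactSpace G] [T2Space G]
    {E : Type*} [NormedAddCommGroup E] [NormedSpace ℝ E] [FiniteDimensional ℝ E]
    {M : Type*} [TopologicalSpace M] [ChartedSpace E M] [IsManifold 𝓘(ℝ, E) ∞ M]
    [T2Space M] [SecondCountableTopology M]
    [MulAction G M] [ContMDiffSMul 𝓘(ℝ, F) 𝓘(ℝ, E) ∞ G M]
    (κ : InvariantInnerProduct F G) (P : BivectorField E M) (Φ : M → G)
    (hΦ : IsHamiltonianQuasiPoisson κ P Φ) :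
    -- the moment map has maximal rank on `M_**`
    (∀ m ∈ locallyFreeLocus G M,
      Function.Surjective (mfderiv 𝓘(ℝ, E) 𝓘(ℝ, F) Φ m)) ∧
    -- `M_* / G` is a Poisson manifold, with the structures induced from `M`, and its intersections
    -- with the reduced spaces are Poisson submanifolds
    (∃ U : Opens M, (U : Set M) = freeLocus G M ∧
      T2Space (orbitImage G (U : Set M)) ∧
      SecondCountableTopology (orbitImage G (U : Set M)) ∧
      ∃ _ : ChartedSpace (EuclideanSpace ℝ (Fin (finrank ℝ E - finrank ℝ F)))
          (orbitImage G (U : Set M)),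
        IsManifold 𝓘(ℝ, EuclideanSpace ℝ (Fin (finrank ℝ E - finrank ℝ F))) ∞
          (orbitImage G (U : Set M)) ∧
        IsSmoothSubmersion E (EuclideanSpace ℝ (Fin (finrank ℝ E - finrank ℝ F)))
          (orbitMap G U) ∧
        ∃ Q : BivectorField (EuclideanSpace ℝ (Fin (finrank ℝ E - finrank ℝ F)))
            (orbitImage G (U : Set M)),
          Q.IsPoisson ∧
          IsBivectorRelated E P (fun m : U => m.1) (orbitMap G U) Q ∧
          (∀ Q', IsBivectorRelated E P (fun m : U => m.1) (orbitMap G U) Q' → Q' = Q) ∧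
          ∀ C : ConjClasses G, ∃ k : ℕ,
            IsPoissonSubmanifold Q k {x | x.1 ∈ reducedSpace Φ C}) ∧
    -- `M_** / G` is a Poisson orbifold, with the structures induced from `M`, and its intersections
    -- with the reduced spaces are Poisson suborbifolds
    (∃ U : Opens M, (U : Set M) = locallyFreeLocus G M ∧
      T2Space (orbitImage G (U : Set M)) ∧
      SecondCountableTopology (orbitImage G (U : Set M)) ∧
      ∃ 𝒜 : OrbifoldAtlas (EuclideanSpace ℝ (Fin (finrank ℝ E - finrank ℝ F)))
          (orbitImage G (U : Set M)),
        IsOrbifoldSubmersion E 𝒜 (orbitMap G U) ∧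
        ∃ Q : OrbifoldBivectorField 𝒜,
          Q.IsPoisson ∧
          IsOrbifoldBivectorRelated E P (fun m : U => m.1) (orbitMap G U) Q ∧
          (∀ Q', IsOrbifoldBivectorRelated E P (fun m : U => m.1) (orbitMap G U) Q' → Q' = Q) ∧
          ∀ C : ConjClasses G, ∃ k : ℕ,
            IsPoissonSuborbifold Q k {x | x.1 ∈ reducedSpace Φ C}) := by
  have : ContinuousSMul G M := ContMDiffSMul.continuousSMul (I := 𝓘(ℝ, F)) (I' := 𝓘(ℝ, E)) ∞
  have : T2Space (OrbitSpace G M) := t2Space_orbitSpace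
  have : SecondCountableTopology (OrbitSpace G M) :=
    ContinuousConstSMul.secondCountableTopology
  have hE' := fun (m : M) (hm : Finite (MulAction.stabilizer G m)) => finrank_model_add F E hm
  refine ⟨fun m hm => hΦ.tmap_moment_surjective hm,
    ⟨⟨freeLocus G M, isOpen_freeLocus F E⟩, rfl, inferInstance, inferInstance,
      exists_poisson_quotient _ hΦ rfl hE'⟩,
    ⟨⟨locallyFreeLocus G M, isOpen_locallyFreeLocus F E⟩, rfl, inferInstance, inferInstance,
      sliceAtlas F _ _ rfl hE', isOrbifoldSubmersion_orbitMap rfl hE', orbifoldField rfl hE' hΦ,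
      isPoisson_orbifoldField rfl hE' hΦ, isOrbifoldBivectorRelated_orbifoldField rfl hE' hΦ,
      fun Q' hQ' => eq_of_isOrbifoldBivectorRelated rfl hE' hQ'
        (isOrbifoldBivectorRelated_orbifoldField rfl hE' hΦ),
      exists_isPoissonSuborbifold rfl hE' hΦ⟩⟩
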